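/- Let $p$ be a prime, $h,d\ge 0$ integers, and let $E\in\mathbb{F}_p[x,y]$ have degree at most $h$ in $x$ and at most $d$ in $y$, with $E(0,0)=0$ and $E_y(0,0)\neq 0$, where $E_y=\partial E/\partial y$. Then there is a unique $f=\sum_{n\ge 0} f_n x^n\in\mathbb{F}_p[[x]]$ with $E(x,f(x))=0$ and $f(0)=0$. For $N\ge 1$, the coefficient $f_N$ can be computed from the coefficients of $E$ in $$O\big(h^2(d+h)^2\log N\big)+\tilde O\big(h(d+h)^5p\big)$$ arithmetic operations $(+,-,\times,\div)$ in $\mathbb{F}_p$, where $\tilde O(g)$ stands for $O\big(g\log^k(2+g)\big)$ for some constant $k$. That is: there are a single algorithm which, given $p,h,d,N$ alone, produces a straight-line program (a finite list of additions, subtractions, multiplications and divisions in $\mathbb{F}_p$, applied to the coefficients of $E$, to constants of $\mathbb{F}_p$ and to earlier results, without branching) and absolute constants $C,k$ such that, for all $p,h,d,N$ as above, the program consists of at most $$C\,h^2(d+h)^2\log N+C\,h(d+h)^5p\,\log^k\!\big(2+h(d+h)^5p\big)$$ operations and, for every such $E$, it never divides by zero and returns $f_N$. -/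

import Mathlib

/-- The four arithmetic operations of a field. -/
inductive ArithOp where
  | add
  | sub
  | mul
  | div

/-- What an arithmetic operation may be applied to. -/
inductive Operand where
  /-- The input coefficient of `x ^ i * y ^ j`. -/
  | coeff (i j : ℕ)
  /-- The field element `c • 1`. -/
  | const (c : ℕ)
  /-- The result of the `k`-th operation carried out so far (counted from zero). -/
  | result (k : ℕ)

/-- One step of a straight-line program: a single arithmetic operation. -/
structure ArithStep where
  op : ArithOp
  left : Operand
  right : Operand

/-- A straight-line program whose input is the array of coefficients of a bivariate polynomial:
a list of arithmetic operations, followed by the operand that is returned. -/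
structure ArithProgram where
  steps : List ArithStep
  output : Operand

namespace ArithOp

/-- Division by zero is not defined. -/
def apply {F : Type*} [Field F] [DecidableEq F] : ArithOp → F → F → Option F
  | add, a, b => some (a + b)
  | sub, a, b => some (a - b)
  | mul, a, b => some (a * b)
  | div, a, b => if b = 0 then none else some (a / b)

def equivFin : ArithOp ≃ Fin 4 where
  toFun
    | add => 0
    | sub => 1
    | mul => 2
    | div => 3
  invFun
    | 0 => add
    | 1 => sub
    | 2 => mul
    | 3 => div
  left_inv o := by cases o <;> rfl
  right_inv i := by fin_cases i <;> rfl

instance instPrimcodable : Primcodable ArithOp := Primcodable.ofEquiv _ equivFin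

end ArithOp

namespace Operand

/-- The value of an operand, given the input coefficients `e` and the list of the results of the
operations carried out so far; a result that is not there yet has no value. -/
def value {F : Type*} [Field F] (e : ℕ → ℕ → F) (mem : List F) : Operand → Option F
  | coeff i j => some (e i j)
  | const c => some (c : F)
  | result k => mem[k]?

def equivSum : Operand ≃ (ℕ × ℕ) ⊕ ℕ ⊕ ℕ where
  toFun
    | coeff i j => .inl (i, j)
    | const c => .inr (.inl c)
    | result k => .inr (.inr k)
  invFun
    | .inl (i, j) => coeff i j
    | .inr (.inl c) => const c
    | .inr (.inr k) => result k
  left_inv o := by cases o <;> rfl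
  right_inv s := by rcases s with ⟨i, j⟩ | c | k <;> rfl

instance instPrimcodable : Primcodable Operand := Primcodable.ofEquiv _ equivSum

end Operand

namespace ArithStep

def equivProd : ArithStep ≃ ArithOp × Operand × Operand where
  toFun s := (s.op, s.left, s.right)
  invFun s := ⟨s.1, s.2.1, s.2.2⟩
  left_inv _ := rfl
  right_inv _ := rfl

instance instPrimcodable : Primcodable ArithStep := Primcodable.ofEquiv _ equivProd

end ArithStep

namespace ArithProgram

/-- Carry out a list of operations, appending every result to the memory. -/
def run {F : Type*} [Field F] [DecidableEq F] (e : ℕ → ℕ → F) :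
    List ArithStep → List F → Option (List F)
  | [], mem => some mem
  | s :: rest, mem =>
    (s.left.value e mem).bind fun a =>
      (s.right.value e mem).bind fun b =>
        (s.op.apply a b).bind fun c => run e rest (mem ++ [c])

/-- The field element that the program returns on the input coefficients `e`; there is none if a
division by zero or a reference to a missing result occurs. -/
def eval {F : Type*} [Field F] [DecidableEq F] (P : ArithProgram) (e : ℕ → ℕ → F) : Option F :=
  (run e P.steps []).bind fun mem => P.output.value e mem

/-- The number of arithmetic operations in the field. -/
def cost (P : ArithProgram) : ℕ := P.steps.length

def equivProd : ArithProgram ≃ List ArithStep × Operand where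
  toFun P := (P.steps, P.output)
  invFun P := ⟨P.1, P.2⟩
  left_inv _ := rfl
  right_inv _ := rfl

instance instPrimcodable : Primcodable ArithProgram := Primcodable.ofEquiv _ equivProd

end ArithProgram

/-- `f` is a root `E(x, f(x)) = 0` with `f(0) = 0`. The outer variable of `E` is `y`, so that
`(E.coeff j).coeff i` is the coefficient of `x ^ i * y ^ j`. -/
def IsRootAtOrigin {F : Type*} [Field F] (E : Polynomial (Polynomial F)) (f : PowerSeries F) :
    Prop :=
  E.eval₂ Polynomial.coeToPowerSeries.ringHom f = 0 ∧ PowerSeries.constantCoeff f = 0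

/-! Let `u = 1 / E_y(x, f)` and let `ρ(n)` be the row of the coefficients of `x ^ n` in the `D = (h
+ 1) * d` series `x ^ i * f ^ j * u` with `i ≤ h`, `j < d`. Since `f = (y * E_y - d * E)(x, f) * u`,
the coefficient `f_N` is the scalar product of `ρ(N)` with a vector that is explicit in `E`
(`coeff_root_eq`). For `r < p`, extracting the coefficients with index `p * n + r` turns `P(x, f) *
u` into `Q(x, f) * u`, where `Q` is a bivariate section of `P * E ^ (p - 1)` (`section_eval_mul`),
and the degree bounds survive. Hence `ρ(p * n + r) = ρ(n) * L_r` for fixed matrices `L_r`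
(`exists_transition`), and `ρ(N)` follows from `ρ(0)` by one vector-matrix product per digit of `N`
in base `p`. This is the term `h² (d + h)² log N`.

The matrices `L_r` are not computed from `E ^ (p - 1)`. A resultant bound shows that `P(x, f)`
vanishes as soon as it vanishes modulo `x ^ (2 * d * h + 1)` (`eval₂_eq_zero_of_X_pow_dvd`), so the
first `T = 2 * d * h + 1` rows span all rows (`coeffRow_mem_rowSpan`). If `B` consists of these
rows, `B_r` of the rows `ρ(p * t + r)` with `t < T`, and `B * G * B = B`, then `G * B_r` can replace
`L_r`. Thus only `f` and `u` modulo `x ^ (p * T)` are needed. Newton iteration provides them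
(`exists_root_reach`), with multiplication by fast Fourier transforms in the rings `R[X] / (X ^ m +
1)` (`mulCost_pow_two`).

To get one program for all inputs, everything is computed in the ring `R` of `F_p`-valued functions
on the set of admissible `E`: a chain of ring operations in `R` is a program without branching
(`RingReach.exists_program`). As `a ^ p = a` in `R`, inverses become powers, no division is needed,
and a generalized inverse `G` exists without case distinctions (`exists_generalizedInverse`).

Finally, for given `p, h, d, N` there are finitely many coefficient arrays modulo `p`, so the cost
and the correctness of a program can be checked primitive recursively. Unbounded search is then the
single algorithm, and it terminates because a suitable program exists (`exists_computable_program`).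
-/

/-! ### Counting the steps of a computation -/

/-- `Reach step n S T`: all elements of `T` can be obtained from those of `S` by at most `n`
successive steps, where `step S x` says that `x` is obtained from elements of `S` in one step. -/
inductive Reach {α : Type*} (step : Set α → α → Prop) : ℕ → Set α → Set α → Prop
  | done {n : ℕ} {S T : Set α} : T ⊆ S → Reach step n S T
  | next {n : ℕ} {S T : Set α} (x : α) : step S x → Reach step n (insert x S) T →
      Reach step (n + 1) S T

namespace Reach

variable {α : Type*} {step : Set α → α → Prop}

theorem mono_cost {n m : ℕ} {S T : Set α} (h : Reach step n S T) (hnm : n ≤ m) :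
    Reach step m S T := by
  induction h generalizing m with
  | done h => exact done h
  | next x hx _ ih =>
    obtain ⟨k, rfl⟩ : ∃ k, m = k + 1 := ⟨m - 1, by omega⟩
    exact next x hx (ih (by omega))

theorem mono_target {n : ℕ} {S T T' : Set α} (h : Reach step n S T) (hT : T' ⊆ T) :
    Reach step n S T' := by
  induction h with
  | done h => exact done (hT.trans h)
  | next x hx _ ih => exact next x hx (ih hT)

theorem mono_source (hs : ∀ S S' x, S ⊆ S' → step S x → step S' x)
    {n : ℕ} {S S' T : Set α} (h : Reach step n S T) (hS : S ⊆ S') : Reach step n S' T := by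
  induction h generalizing S' with
  | done h => exact done (h.trans hS)
  | next x hx _ ih => exact next x (hs _ _ _ hS hx) (ih (Set.insert_subset_insert hS))

theorem trans (hs : ∀ S S' x, S ⊆ S' → step S x → step S' x)
    {n m : ℕ} {S T U : Set α} (h : Reach step n S T) (h' : Reach step m (S ∪ T) U) :
    Reach step (n + m) S U := by
  induction h with
  | done h =>
    rw [Set.union_eq_left.2 h] at h'
    exact h'.mono_cost (by omega)
  | @next n S T x hx _ ih =>
    rw [show n + 1 + m = n + m + 1 by ring]
    exact next x hx (ih (h'.mono_source hs (Set.union_subset_union_left _ (Set.subset_insert _ _))))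

theorem trans' (hs : ∀ S S' x, S ⊆ S' → step S x → step S' x)
    {n m : ℕ} {S T U : Set α} (h : Reach step n S T) (h' : Reach step m T U) :
    Reach step (n + m) S U :=
  h.trans hs (h'.mono_source hs Set.subset_union_right)

theorem union_self {n : ℕ} {S T : Set α} (h : Reach step n S T) : Reach step n S (S ∪ T) := by
  induction h with
  | done h => exact done (Set.union_subset le_rfl h)
  | next x hx _ ih =>
    exact next x hx (ih.mono_target (Set.union_subset_union_left _ (Set.subset_insert _ _)))

theorem union (hs : ∀ S S' x, S ⊆ S' → step S x → step S' x)
    {n m : ℕ} {S T U : Set α} (h : Reach step n S T) (h' : Reach step m S U) :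
    Reach step (n + m) S (T ∪ U) := by
  refine h.trans hs ?_
  have := (h'.mono_source hs (Set.subset_union_left (t := T))).union_self
  exact this.mono_target (by intro x; simp only [Set.mem_union]; tauto)

theorem biUnion (hs : ∀ S S' x, S ⊆ S' → step S x → step S' x)
    {ι : Type*} {S : Set α} (s : Finset ι) {c : ι → ℕ} {T : ι → Set α}
    (h : ∀ i ∈ s, Reach step (c i) S (T i)) : Reach step (∑ i ∈ s, c i) S (⋃ i ∈ s, T i) := by
  classical
  induction s using Finset.induction_on with
  | empty => exact done (by simp)
  | insert a s ha ih =>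
    rw [Finset.sum_insert ha, Finset.set_biUnion_insert]
    exact (h a (Finset.mem_insert_self _ _)).union hs
      (ih fun i hi => h i (Finset.mem_insert_of_mem hi))

theorem biUnion_const (hs : ∀ S S' x, S ⊆ S' → step S x → step S' x)
    {ι : Type*} {S : Set α} (s : Finset ι) {c : ℕ} {T : ι → Set α}
    (h : ∀ i ∈ s, Reach step c S (T i)) : Reach step (s.card * c) S (⋃ i ∈ s, T i) := by
  simpa using biUnion hs s h

theorem single {S : Set α} {x : α} (hx : step S x) : Reach step 1 S {x} :=
  next x hx (done (by simp))

theorem finset_image (hs : ∀ S S' x, S ⊆ S' → step S x → step S' x)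
    {ι : Type*} {S : Set α} (s : Finset ι) {c : ℕ} {g : ι → α}
    (h : ∀ i ∈ s, Reach step c S {g i}) : Reach step (s.card * c) S (g '' s) :=
  (biUnion_const hs s h).mono_target (by rintro _ ⟨i, hi, rfl⟩; simp; exact ⟨i, hi, rfl⟩)

end Reach

/-! ### Computations with ring operations -/

/-- `x` is the sum, difference or product of two elements of `S`. -/
def RingStep {R : Type*} [CommRing R] (S : Set R) (x : R) : Prop :=
  ∃ a ∈ S, ∃ b ∈ S, x = a + b ∨ x = a - b ∨ x = a * b

theorem RingStep.mono {R : Type*} [CommRing R] (S S' : Set R) (x : R) (h : S ⊆ S')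
    (hx : RingStep S x) : RingStep S' x := by
  obtain ⟨a, ha, b, hb, hx⟩ := hx
  exact ⟨a, h ha, b, h hb, hx⟩

/-- All elements of `T` can be computed from those of `S` by at most `n` additions, subtractions
and multiplications. -/
abbrev RingReach {R : Type*} [CommRing R] (n : ℕ) (S T : Set R) : Prop := Reach RingStep n S T

namespace RingReach

variable {R : Type*} [CommRing R] {S T U : Set R} {n m : ℕ}

theorem trans (h : RingReach n S T) (h' : RingReach m (S ∪ T) U) : RingReach (n + m) S U :=
  Reach.trans RingStep.mono h h'

theorem trans' (h : RingReach n S T) (h' : RingReach m T U) : RingReach (n + m) S U :=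
  Reach.trans' RingStep.mono h h'

theorem union (h : RingReach n S T) (h' : RingReach m S U) : RingReach (n + m) S (T ∪ U) :=
  Reach.union RingStep.mono h h'

theorem biUnion_const {ι : Type*} (s : Finset ι) {c : ℕ} {T : ι → Set R}
    (h : ∀ i ∈ s, RingReach c S (T i)) : RingReach (s.card * c) S (⋃ i ∈ s, T i) :=
  Reach.biUnion_const RingStep.mono s h

theorem finset_image {ι : Type*} (s : Finset ι) {c : ℕ} {g : ι → R}
    (h : ∀ i ∈ s, RingReach c S {g i}) : RingReach (s.card * c) S (g '' s) :=
  Reach.finset_image RingStep.mono s h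

theorem add {a b : R} (ha : a ∈ S) (hb : b ∈ S) : RingReach 1 S {a + b} :=
  Reach.single ⟨a, ha, b, hb, by simp⟩

theorem sub {a b : R} (ha : a ∈ S) (hb : b ∈ S) : RingReach 1 S {a - b} :=
  Reach.single ⟨a, ha, b, hb, by simp⟩

theorem mul {a b : R} (ha : a ∈ S) (hb : b ∈ S) : RingReach 1 S {a * b} :=
  Reach.single ⟨a, ha, b, hb, by simp⟩

theorem mem {a : R} (ha : a ∈ S) : RingReach 0 S {a} := Reach.done (by simpa using ha)

theorem add_of {a b : R} (ha : RingReach n S {a}) (hb : RingReach m S {b}) :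
    RingReach (n + m + 1) S {a + b} := (ha.union hb).trans' (add (by simp) (by simp))

theorem sub_of {a b : R} (ha : RingReach n S {a}) (hb : RingReach m S {b}) :
    RingReach (n + m + 1) S {a - b} := (ha.union hb).trans' (sub (by simp) (by simp))

theorem mul_of {a b : R} (ha : RingReach n S {a}) (hb : RingReach m S {b}) :
    RingReach (n + m + 1) S {a * b} := (ha.union hb).trans' (mul (by simp) (by simp))

theorem sum {ι : Type*} (s : Finset ι) {c : ι → ℕ} {g : ι → R} (h0 : (0 : R) ∈ S)
    (h : ∀ i ∈ s, RingReach (c i) S {g i}) :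
    RingReach (∑ i ∈ s, (c i + 1)) S {∑ i ∈ s, g i} := by
  classical
  induction s using Finset.induction_on with
  | empty => exact Reach.done (by simpa using h0)
  | insert a s ha ih =>
    rw [Finset.sum_insert ha, Finset.sum_insert ha]
    exact (add_of (h a (Finset.mem_insert_self _ _))
      (ih fun i hi => h i (Finset.mem_insert_of_mem hi))).mono_cost (by omega)

theorem sum_const {ι : Type*} (s : Finset ι) {c : ℕ} {g : ι → R} (h0 : (0 : R) ∈ S)
    (h : ∀ i ∈ s, RingReach c S {g i}) :
    RingReach (s.card * (c + 1)) S {∑ i ∈ s, g i} := by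
  simpa using sum s (c := fun _ => c) h0 h

theorem sum_mul {ι : Type*} (s : Finset ι) {a b : ι → R} (h0 : (0 : R) ∈ S)
    (ha : ∀ i ∈ s, a i ∈ S) (hb : ∀ i ∈ s, b i ∈ S) :
    RingReach (s.card * 2) S {∑ i ∈ s, a i * b i} :=
  sum_const s h0 fun i hi => mul (ha i hi) (hb i hi)

/-- Repeated multiplication is affordable: the exponents that occur are below `p`, and the budget is
linear in `p`. -/
theorem pow {a : R} (h1 : (1 : R) ∈ S) (ha : a ∈ S) (k : ℕ) : RingReach k S {a ^ k} := by
  induction k with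
  | zero => exact Reach.done (by simpa using h1)
  | succ k ih =>
    rw [pow_succ]
    exact (mul_of ih (mem ha))

end RingReach

/-! ### The fast Fourier transform -/

/-- `x` is a sum or difference of elements of `S`, or a multiple of one by `half` or by a power of
`w`. -/
def TwiddleStep {A : Type*} [CommRing A] (w half : A) (S : Set A) (x : A) : Prop :=
  ∃ a ∈ S, (∃ b ∈ S, x = a + b ∨ x = a - b) ∨ (∃ i : ℕ, x = w ^ i * a) ∨ x = half * a

namespace TwiddleStep

variable {A : Type*} [CommRing A] {w half : A}

theorem mono (S S' : Set A) (x : A) (h : S ⊆ S') (hx : TwiddleStep w half S x) :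
    TwiddleStep w half S' x := by
  obtain ⟨a, ha, hx⟩ := hx
  refine ⟨a, h ha, ?_⟩
  rcases hx with ⟨b, hb, hx⟩ | hx | hx
  · exact .inl ⟨b, h hb, hx⟩
  · exact .inr (.inl hx)
  · exact .inr (.inr hx)

/-- Reduction modulo `X ^ 2 ^ k - y`, which halves the length. In the transforms `x ^ 2 ^ k` takes
only two values, `y` and `-y`. -/
theorem sum_even {k : ℕ} (c : ℕ → A) (x y : A) (h : x ^ 2 ^ k = y) :
    ∑ i ∈ Finset.range (2 ^ (k + 1)), c i * x ^ i =
      ∑ i ∈ Finset.range (2 ^ k), (c i + y * c (2 ^ k + i)) * x ^ i := by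
  rw [pow_succ, mul_two, Finset.sum_range_add, ← Finset.sum_add_distrib]
  refine Finset.sum_congr rfl fun i _ => ?_
  rw [pow_add, h]; ring

/-- The fast Fourier transform. -/
theorem reach_eval (k : ℕ) : ∀ (c : ℕ → A) (s t : ℕ),
    (∀ l, l + 1 = k → (w ^ t) ^ 2 ^ l = -1) →
    Reach (TwiddleStep w half) (3 * k * 2 ^ k) (c '' Finset.range (2 ^ k))
      ((fun j => ∑ i ∈ Finset.range (2 ^ k), c i * (w ^ s * (w ^ t) ^ j) ^ i) ''
        Finset.range (2 ^ k)) := by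
  induction k with
  | zero =>
    intro c s t _
    exact .done (by simp)
  | succ k ih =>
    intro c s t ht
    have ht' := ht k rfl
    -- At the point with index `j` the power `2 ^ k` is `y` for even `j` and `-y` for odd `j`. So
    -- `U` and `V` carry the even and the odd points, which are again of the form `w ^ s' * (w ^ (2
    -- * t)) ^ l`, with `s' = s` and `s' = s + t`. A butterfly takes three steps: one twiddle, one
    -- sum, one difference.
    set y := (w ^ s) ^ 2 ^ k with hy
    set U : ℕ → A := fun i => c i + y * c (2 ^ k + i) with hU
    set V : ℕ → A := fun i => c i - y * c (2 ^ k + i) with hV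
    have hsub : ∀ l, l + 1 = k → (w ^ (2 * t)) ^ 2 ^ l = -1 := by
      rintro l rfl
      rw [← ht', ← pow_mul, ← pow_mul, pow_succ]; ring_nf
    have h1 : Reach (TwiddleStep w half) ((Finset.range (2 ^ k)).card * 3)
        (c '' Finset.range (2 ^ (k + 1))) (⋃ i ∈ Finset.range (2 ^ k), {U i, V i}) := by
      refine Reach.biUnion_const mono _ fun i hi => ?_
      rw [Finset.mem_range] at hi
      have hc1 : c i ∈ c '' Finset.range (2 ^ (k + 1)) :=
        ⟨i, by simp [pow_succ]; omega, rfl⟩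
      have hc2 : c (2 ^ k + i) ∈ c '' Finset.range (2 ^ (k + 1)) :=
        ⟨2 ^ k + i, by simp [pow_succ]; omega, rfl⟩
      refine .next (y * c (2 ^ k + i)) ⟨_, hc2, .inr (.inl ⟨s * 2 ^ k, by rw [hy, pow_mul]⟩)⟩ ?_
      refine .next (U i) ⟨c i, .inr hc1, .inl ⟨_, .inl rfl, .inl rfl⟩⟩ ?_
      refine .next (V i) ⟨c i, .inr (.inr hc1), .inl ⟨_, .inr (.inl rfl), .inr rfl⟩⟩ ?_
      exact .done (by rintro x (rfl | rfl) <;> simp)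
    have hUV : ∀ i ∈ Finset.range (2 ^ k), U i ∈ (⋃ i ∈ Finset.range (2 ^ k), {U i, V i}) ∧
        V i ∈ (⋃ i ∈ Finset.range (2 ^ k), ({U i, V i} : Set A)) := fun i hi =>
      ⟨Set.mem_biUnion hi (by simp), Set.mem_biUnion hi (by simp)⟩
    have h2 := (ih U s (2 * t) hsub).mono_source mono
      (S' := ⋃ i ∈ Finset.range (2 ^ k), {U i, V i}) (by
        rintro _ ⟨i, hi, rfl⟩; exact (hUV i hi).1)
    have h3 := (ih V (s + t) (2 * t) hsub).mono_source mono
      (S' := ⋃ i ∈ Finset.range (2 ^ k), {U i, V i}) (by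
        rintro _ ⟨i, hi, rfl⟩; exact (hUV i hi).2)
    refine ((h1.trans' mono (h2.union mono h3)).mono_cost ?_).mono_target ?_
    · simp only [Finset.card_range, pow_succ]; ring_nf; omega
    · rintro _ ⟨j, hj, rfl⟩
      simp only [Finset.coe_range, Set.mem_Iio, pow_succ] at hj
      obtain ⟨l, rfl | rfl⟩ := Nat.even_or_odd' j
      · left
        refine ⟨l, by simp; omega, ?_⟩
        dsimp only
        rw [sum_even (y := y)]
        · simp only [hU]; refine Finset.sum_congr rfl fun i _ => ?_
          congr 2; rw [← pow_mul, ← pow_mul]; ring_nf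
        · rw [mul_pow, ← hy]
          have : ((w ^ t) ^ (2 * l)) ^ 2 ^ k = ((w ^ t) ^ 2 ^ k) ^ (2 * l) := pow_right_comm _ _ _
          rw [this, ht']; simp
      · right
        refine ⟨l, by simp; omega, ?_⟩
        dsimp only
        rw [sum_even (y := -y)]
        · simp only [hV]; refine Finset.sum_congr rfl fun i _ => ?_
          congr 2
          · ring
          · rw [← pow_mul, ← pow_mul]; ring_nf
        · rw [mul_pow, ← hy]
          have : ((w ^ t) ^ (2 * l + 1)) ^ 2 ^ k = ((w ^ t) ^ 2 ^ k) ^ (2 * l + 1) := pow_right_comm _ _ _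
          rw [this, ht']; simp [pow_succ]

/-- The inverse fast Fourier transform. -/
theorem reach_interpolate {o : ℕ} (ho : w ^ (o + 1) = 1) (hhalf : 2 * half = 1) (k : ℕ) :
    ∀ (c : ℕ → A) (s t : ℕ), (∀ l, l + 1 = k → (w ^ t) ^ 2 ^ l = -1) →
    Reach (TwiddleStep w half) (5 * k * 2 ^ k)
      ((fun j => ∑ i ∈ Finset.range (2 ^ k), c i * (w ^ s * (w ^ t) ^ j) ^ i) ''
        Finset.range (2 ^ k)) (c '' Finset.range (2 ^ k)) := by
  induction k with
  | zero =>
    intro c s t _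
    exact .done (by simp)
  | succ k ih =>
    intro c s t ht
    have ht' := ht k rfl
    set y := (w ^ s) ^ 2 ^ k with hy
    -- Undoing a butterfly divides by `y`; as `w ^ (o + 1) = 1`, the inverse of `y` is itself a
    -- power of `w`.
    have hyi : (w ^ (o * (s * 2 ^ k))) * y = 1 := by
      rw [hy, ← pow_mul, ← pow_add, show o * (s * 2 ^ k) + s * 2 ^ k = (o + 1) * (s * 2 ^ k) by ring,
        pow_mul, ho, one_pow]
    set U : ℕ → A := fun i => c i + y * c (2 ^ k + i) with hU
    set V : ℕ → A := fun i => c i - y * c (2 ^ k + i) with hV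
    have hsub : ∀ l, l + 1 = k → (w ^ (2 * t)) ^ 2 ^ l = -1 := by
      rintro l rfl
      rw [← ht', ← pow_mul, ← pow_mul, pow_succ]; ring_nf
    set W := ((fun j => ∑ i ∈ Finset.range (2 ^ (k + 1)), c i * (w ^ s * (w ^ t) ^ j) ^ i) ''
        Finset.range (2 ^ (k + 1))) with hW
    have h2 := (ih U s (2 * t) hsub).mono_source mono (S' := W) (by
      rintro _ ⟨l, hl, rfl⟩
      simp only [Finset.coe_range, Set.mem_Iio] at hl
      refine ⟨2 * l, by simp [pow_succ]; omega, ?_⟩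
      dsimp only
      rw [sum_even (y := y)]
      · simp only [hU]; refine Finset.sum_congr rfl fun i _ => ?_
        congr 2; rw [← pow_mul, ← pow_mul]; ring_nf
      · rw [mul_pow, ← hy]
        have : ((w ^ t) ^ (2 * l)) ^ 2 ^ k = ((w ^ t) ^ 2 ^ k) ^ (2 * l) := pow_right_comm _ _ _
        rw [this, ht']; simp)
    have h3 := (ih V (s + t) (2 * t) hsub).mono_source mono (S' := W) (by
      rintro _ ⟨l, hl, rfl⟩
      simp only [Finset.coe_range, Set.mem_Iio] at hl
      refine ⟨2 * l + 1, by simp [pow_succ]; omega, ?_⟩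
      dsimp only
      rw [sum_even (y := -y)]
      · simp only [hV]; refine Finset.sum_congr rfl fun i _ => ?_
        congr 2
        · ring
        · rw [← pow_mul, ← pow_mul]; ring_nf
      · rw [mul_pow, ← hy]
        have : ((w ^ t) ^ (2 * l + 1)) ^ 2 ^ k = ((w ^ t) ^ 2 ^ k) ^ (2 * l + 1) := pow_right_comm _ _ _
        rw [this, ht']; simp [pow_succ])
    have h1 : Reach (TwiddleStep w half) ((Finset.range (2 ^ k)).card * 5)
        (U '' Finset.range (2 ^ k) ∪ V '' Finset.range (2 ^ k))
        (⋃ i ∈ Finset.range (2 ^ k), {c i, c (2 ^ k + i)}) := by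
      refine Reach.biUnion_const mono _ fun i hi => ?_
      have hu : U i ∈ U '' Finset.range (2 ^ k) ∪ V '' Finset.range (2 ^ k) := .inl ⟨i, hi, rfl⟩
      have hv : V i ∈ U '' Finset.range (2 ^ k) ∪ V '' Finset.range (2 ^ k) := .inr ⟨i, hi, rfl⟩
      refine .next (U i + V i) ⟨_, hu, .inl ⟨_, hv, .inl rfl⟩⟩ ?_
      refine .next (U i - V i) ⟨_, .inr hu, .inl ⟨_, .inr hv, .inr rfl⟩⟩ ?_
      refine .next (half * (U i + V i)) ⟨_, .inr (.inl rfl), .inr (.inr rfl)⟩ ?_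
      refine .next (half * (U i - V i)) ⟨_, .inr (.inl rfl), .inr (.inr rfl)⟩ ?_
      refine .next (w ^ (o * (s * 2 ^ k)) * (half * (U i - V i)))
        ⟨_, .inl rfl, .inr (.inl ⟨_, rfl⟩)⟩ (.done ?_)
      have e1 : half * (U i + V i) = c i := by
        simp only [hU, hV]; linear_combination c i * hhalf
      have e2 : w ^ (o * (s * 2 ^ k)) * (half * (U i - V i)) = c (2 ^ k + i) := by
        simp only [hU, hV]
        linear_combination c (2 ^ k + i) * hyi +
          w ^ (o * (s * 2 ^ k)) * y * c (2 ^ k + i) * hhalf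
      rintro x (rfl | rfl)
      · simp [e1]
      · simp [e2]
    refine (((h2.union mono h3).trans' mono h1).mono_cost ?_).mono_target ?_
    · simp only [Finset.card_range, pow_succ]; ring_nf; omega
    · rintro _ ⟨j, hj, rfl⟩
      simp only [Finset.coe_range, Set.mem_Iio, pow_succ] at hj
      by_cases h : j < 2 ^ k
      · exact Set.mem_biUnion (x := j) (by simpa using h) (by simp)
      · refine Set.mem_biUnion (x := j - 2 ^ k) (by simp; omega) ?_
        rw [Nat.add_sub_cancel' (by omega)]; simp

end TwiddleStep

/-! ### Fast multiplication modulo `X ^ m + 1` -/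

/-- The coefficients of a product modulo `X ^ M + 1`. -/
def negConv {A : Type*} [CommRing A] (M : ℕ) (p q : ℕ → A) (i : ℕ) : A :=
  ∑ j ∈ Finset.range M, if j ≤ i then p j * q (i - j) else -(p j * q (i + M - j))

theorem map_negConv {A B : Type*} [CommRing A] [CommRing B] (φ : A →+* B) (M : ℕ) (p q : ℕ → A)
    (i : ℕ) : φ (negConv M p q i) = negConv M (fun j => φ (p j)) (fun j => φ (q j)) i := by
  simp only [negConv, map_sum, apply_ite φ, map_mul, map_neg]

theorem sum_mul_sum_eq_negConv {A : Type*} [CommRing A] {M : ℕ} {x : A} (hx : x ^ M = -1)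
    (p q : ℕ → A) :
    (∑ i ∈ Finset.range M, p i * x ^ i) * (∑ i ∈ Finset.range M, q i * x ^ i) =
      ∑ i ∈ Finset.range M, negConv M p q i * x ^ i := by
  simp only [negConv, Finset.sum_mul]
  rw [Finset.sum_comm]
  refine Finset.sum_congr rfl fun j hj => ?_
  obtain ⟨r, rfl⟩ := Nat.exists_eq_add_of_lt (Finset.mem_range.1 hj)
  have e : j + r + 1 = j + (r + 1) := by ring
  rw [e] at hx ⊢
  have h1 : ∑ i ∈ Finset.range (j + (r + 1)), q i * x ^ i =
      (∑ i ∈ Finset.range (r + 1), q i * x ^ i) +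
        ∑ i ∈ Finset.range j, q (r + 1 + i) * x ^ (r + 1 + i) := by
    rw [add_comm j, Finset.sum_range_add]
  rw [h1, Finset.sum_range_add _ j (r + 1), mul_add, add_comm]
  congr 1
  · rw [Finset.mul_sum]
    refine Finset.sum_congr rfl fun i hi => ?_
    rw [Finset.mem_range] at hi
    rw [if_neg (by omega), show i + (j + (r + 1)) - j = r + 1 + i by omega]
    have : x ^ j * x ^ (r + 1 + i) = - x ^ i := by
      rw [← pow_add, show j + (r + 1 + i) = j + (r + 1) + i by ring, pow_add, hx]; ring
    linear_combination p j * q (r + 1 + i) * this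
  · rw [Finset.mul_sum]
    refine Finset.sum_congr rfl fun i hi => ?_
    rw [if_pos (by omega), Nat.add_sub_cancel_left]; ring

/-- Multiplication by `y` is a rotation of the coefficients in which the one that wraps around
changes sign. -/
theorem sum_shift_of_pow_eq_neg_one {A : Type*} [CommRing A] {M : ℕ} {y : A} (hM : 0 < M)
    (hy : y ^ M = -1) (g : ℕ → A) :
    ∑ i ∈ Finset.range M, g i * y ^ (i + 1) =
      ∑ i ∈ Finset.range M, (if i = 0 then -g (M - 1) else g (i - 1)) * y ^ i := by
  obtain ⟨M, rfl⟩ : ∃ m, M = m + 1 := ⟨M - 1, by omega⟩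
  rw [Finset.sum_range_succ, Finset.sum_range_succ', hy]
  simp

theorem sum_range_mul_eq {A : Type*} [AddCommMonoid A] (M q : ℕ) (g : ℕ → A) :
    ∑ t ∈ Finset.range (M * q), g t =
      ∑ i ∈ Finset.range M, ∑ l ∈ Finset.range q, g (i * q + l) := by
  induction M with
  | zero => simp
  | succ M ih => rw [Nat.succ_mul, Finset.sum_range_add, ih, Finset.sum_range_succ]

open Polynomial in
/-- The ring of polynomials modulo `X ^ m + 1`. -/
abbrev Nega (R : Type*) [CommRing R] (m : ℕ) : Type _ := AdjoinRoot (X ^ m + 1 : R[X])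

namespace Nega

open Polynomial

variable {R : Type*} [CommRing R] {m : ℕ}

/-- The class of `X`. -/
noncomputable abbrev ζ (R : Type*) [CommRing R] (m : ℕ) : Nega R m := AdjoinRoot.root _

theorem ζ_pow : ζ R m ^ m = -1 := by
  have : AdjoinRoot.mk (X ^ m + 1 : R[X]) (X ^ m + 1) = 0 := AdjoinRoot.mk_self
  rw [map_add, map_pow, AdjoinRoot.mk_X, map_one] at this
  exact eq_neg_of_add_eq_zero_left this

/-- The coefficients of the reduced representative. -/
noncomputable def coord (α : Nega R m) (i : ℕ) : R :=
  ((AdjoinRoot.mk_surjective α).choose %ₘ (X ^ m + 1)).coeff i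

theorem monic_modulus (hm : m ≠ 0) : (X ^ m + 1 : R[X]).Monic := by
  simpa using monic_X_pow_add_C (1 : R) hm

theorem coord_mk (hm : m ≠ 0) (P : R[X]) (i : ℕ) :
    coord (AdjoinRoot.mk (X ^ m + 1) P) i = (P %ₘ (X ^ m + 1)).coeff i := by
  rw [coord]
  congr 1
  refine modByMonic_eq_of_dvd_sub (monic_modulus hm) ?_
  rw [← AdjoinRoot.mk_eq_mk]
  exact (AdjoinRoot.mk_surjective (AdjoinRoot.mk (X ^ m + 1) P)).choose_spec

theorem coord_mk_of_natDegree_lt (hm : m ≠ 0) {P : R[X]} (hP : P.natDegree < m) (i : ℕ) :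
    coord (AdjoinRoot.mk (X ^ m + 1) P) i = P.coeff i := by
  nontriviality R
  rw [coord_mk hm, (modByMonic_eq_self_iff (monic_modulus hm)).2]
  rw [show (X ^ m + 1 : R[X]) = X ^ m + C 1 by simp, degree_X_pow_add_C (by omega)]
  exact degree_le_natDegree.trans_lt (by exact_mod_cast hP)

theorem mk_eq_sum {P : R[X]} {q : ℕ} (hP : P.natDegree < q) :
    AdjoinRoot.mk (X ^ m + 1) P =
      ∑ t ∈ Finset.range q, AdjoinRoot.of (X ^ m + 1) (P.coeff t) * ζ R m ^ t := by
  conv_lhs => rw [P.as_sum_range' q hP]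
  rw [map_sum]
  refine Finset.sum_congr rfl fun t _ => ?_
  rw [← C_mul_X_pow_eq_monomial, map_mul, map_pow, AdjoinRoot.mk_C, AdjoinRoot.mk_X]

theorem coord_sum (s : ℕ → R) {i : ℕ} (hi : i < m) :
    coord (∑ t ∈ Finset.range m, AdjoinRoot.of (X ^ m + 1) (s t) * ζ R m ^ t) i = s i := by
  have hm : m ≠ 0 := by omega
  have hdeg : (∑ t ∈ Finset.range m, C (s t) * X ^ t).natDegree < m := by
    refine lt_of_le_of_lt (natDegree_sum_le_of_forall_le (n := m - 1) _ _ fun t ht => ?_)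
      (by omega)
    rw [Finset.mem_range] at ht
    exact (natDegree_C_mul_X_pow_le _ _).trans (by omega)
  have : ∑ t ∈ Finset.range m, AdjoinRoot.of (X ^ m + 1) (s t) * ζ R m ^ t =
      AdjoinRoot.mk (X ^ m + 1) (∑ t ∈ Finset.range m, C (s t) * X ^ t) := by
    simp [map_sum]
  rw [this, coord_mk_of_natDegree_lt hm hdeg]
  simp [coeff_C_mul, coeff_X_pow]
  omega

theorem eq_sum_coord (hm : m ≠ 0) (α : Nega R m) :
    α = ∑ t ∈ Finset.range m, AdjoinRoot.of (X ^ m + 1) (coord α t) * ζ R m ^ t := by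
  rcases subsingleton_or_nontrivial R with hR | hR
  · have := Module.subsingleton R (Nega R m)
    exact Subsingleton.elim _ _
  obtain ⟨P, rfl⟩ := AdjoinRoot.mk_surjective α
  have h : AdjoinRoot.mk (X ^ m + 1) P = AdjoinRoot.mk (X ^ m + 1) (P %ₘ (X ^ m + 1)) := by
    rw [AdjoinRoot.mk_eq_mk]
    exact ⟨P /ₘ (X ^ m + 1), by linear_combination -(modByMonic_add_div P (X ^ m + 1 : R[X]))⟩
  simp only [coord_mk hm]
  refine h.trans (mk_eq_sum ?_)
  have := natDegree_modByMonic_lt P (monic_modulus (R := R) hm) (by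
    intro h
    have := congrArg natDegree h
    rw [show (X ^ m + 1 : R[X]) = X ^ m + C 1 by simp, natDegree_X_pow_add_C] at this
    simp at this; omega)
  rwa [show (X ^ m + 1 : R[X]) = X ^ m + C 1 by simp, natDegree_X_pow_add_C] at this

theorem coord_eq_of_eq_sum {α : Nega R m} (s : ℕ → R)
    (h : α = ∑ t ∈ Finset.range m, AdjoinRoot.of (X ^ m + 1) (s t) * ζ R m ^ t) {i : ℕ}
    (hi : i < m) : coord α i = s i := by
  rw [h, coord_sum s hi]

theorem coord_add (α β : Nega R m) {i : ℕ} (hi : i < m) :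
    coord (α + β) i = coord α i + coord β i := by
  refine coord_eq_of_eq_sum (fun i => coord α i + coord β i) ?_ hi
  conv_lhs => rw [eq_sum_coord (by omega) α, eq_sum_coord (by omega) β]
  simp only [map_add, add_mul, Finset.sum_add_distrib]

theorem coord_sub (α β : Nega R m) {i : ℕ} (hi : i < m) :
    coord (α - β) i = coord α i - coord β i := by
  refine coord_eq_of_eq_sum (fun i => coord α i - coord β i) ?_ hi
  conv_lhs => rw [eq_sum_coord (by omega) α, eq_sum_coord (by omega) β]
  simp only [map_sub, sub_mul, Finset.sum_sub_distrib]

theorem coord_of_mul (r : R) (α : Nega R m) {i : ℕ} (hi : i < m) :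
    coord (AdjoinRoot.of _ r * α) i = r * coord α i := by
  refine coord_eq_of_eq_sum (fun i => r * coord α i) ?_ hi
  conv_lhs => rw [eq_sum_coord (by omega) α]
  simp only [map_mul, Finset.mul_sum, mul_assoc]

theorem coord_ζ_mul (α : Nega R m) {i : ℕ} (hi : i < m) :
    coord (ζ R m * α) i = if i = 0 then -coord α (m - 1) else coord α (i - 1) := by
  refine coord_eq_of_eq_sum (fun i => if i = 0 then -coord α (m - 1) else coord α (i - 1)) ?_ hi
  conv_lhs => rw [eq_sum_coord (by omega) α]
  simp only [apply_ite (AdjoinRoot.of (X ^ m + 1 : R[X])), map_neg]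
  rw [← sum_shift_of_pow_eq_neg_one (by omega) ζ_pow
    (fun i => AdjoinRoot.of (X ^ m + 1) (coord α i)), Finset.mul_sum]
  exact Finset.sum_congr rfl fun i _ => by ring

/-- This makes twiddles cheap: a power of `ζ` only permutes the coordinates up to sign, so no
multiplication in `R` is spent on it. -/
theorem coord_ζ_pow_mul (α : Nega R m) (e : ℕ) {i : ℕ} (hi : i < m) :
    ∃ l < m, coord (ζ R m ^ e * α) i = coord α l ∨ coord (ζ R m ^ e * α) i = -coord α l := by
  induction e generalizing i with
  | zero => exact ⟨i, hi, by simp⟩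
  | succ e ih =>
    rw [pow_succ', mul_assoc, coord_ζ_mul _ hi]
    split_ifs with h
    · obtain ⟨l, hl, h | h⟩ := ih (i := m - 1) (by omega)
      · exact ⟨l, hl, .inr (by rw [h])⟩
      · exact ⟨l, hl, .inl (by rw [h, neg_neg])⟩
    · exact ih (by omega)

theorem coord_mul (α β : Nega R m) {i : ℕ} (hi : i < m) :
    coord (α * β) i = negConv m (coord α) (coord β) i := by
  refine coord_eq_of_eq_sum _ ?_ hi
  conv_lhs => rw [eq_sum_coord (by omega) α, eq_sum_coord (by omega) β]
  rw [sum_mul_sum_eq_negConv ζ_pow]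
  simp only [map_negConv]

/-- The set of coordinates of the elements of `S`. -/
def coordSet (S : Set (Nega R m)) : Set R := {x | ∃ α ∈ S, ∃ i < m, coord α i = x}

theorem coordSet_mono {S T : Set (Nega R m)} (h : S ⊆ T) : coordSet S ⊆ coordSet T := by
  rintro x ⟨α, hα, hx⟩
  exact ⟨α, h hα, hx⟩

theorem coordSet_singleton (α : Nega R m) : coordSet {α} = coord α '' Finset.range m := by
  ext x; simp [coordSet]

theorem coordSet_insert (α : Nega R m) (S : Set (Nega R m)) :
    coordSet (insert α S) = coordSet {α} ∪ coordSet S := by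
  ext x; simp [coordSet]

theorem coordSet_image {ι : Type*} (g : ι → Nega R m) (s : Set ι) :
    coordSet (g '' s) = ⋃ i ∈ s, coordSet {g i} := by
  ext x; simp [coordSet]

/-- Every step of the transform acts on coordinates with at most one ring operation for each of the
`m` coordinates. -/
theorem ringReach_coordSet {e : ℕ} {half : R} {n : ℕ} {S T : Set (Nega R m)}
    (h : Reach (TwiddleStep (ζ R m ^ e) (AdjoinRoot.of _ half)) n S T) {K : Set R}
    (h0 : (0 : R) ∈ K) (hhalf : half ∈ K) (hS : coordSet S ⊆ K) :
    RingReach (n * m) K (coordSet T) := by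
  induction h generalizing K with
  | done h => exact .done ((coordSet_mono h).trans hS)
  | @next n S T x hx _ ih =>
    have h1 : RingReach m K (coordSet {x}) := by
      have : RingReach ((Finset.range m).card * 1) K (coord x '' Finset.range m) := by
        refine RingReach.finset_image _ fun i hi => ?_
        rw [Finset.mem_range] at hi
        obtain ⟨a, ha, hx⟩ := hx
        have hK : ∀ b ∈ S, ∀ i < m, coord b i ∈ K := fun b hb i hi => hS ⟨b, hb, i, hi, rfl⟩
        rcases hx with ⟨b, hb, rfl | rfl⟩ | ⟨j, rfl⟩ | rfl
        · rw [coord_add _ _ hi]; exact .add (hK a ha i hi) (hK b hb i hi)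
        · rw [coord_sub _ _ hi]; exact .sub (hK a ha i hi) (hK b hb i hi)
        · rw [← pow_mul]
          obtain ⟨l, hl, h | h⟩ := coord_ζ_pow_mul a (e * j) hi
          · rw [h]; exact .done (by simpa using hK a ha l hl)
          · rw [h, ← zero_sub]; exact .sub h0 (hK a ha l hl)
        · rw [coord_of_mul _ _ hi]; exact .mul hhalf (hK a ha i hi)
      simpa [coordSet_singleton] using this
    have h2 := h1.trans (ih (K := K ∪ coordSet {x}) (.inl h0) (.inl hhalf) (by
      rw [coordSet_insert]
      exact Set.union_subset Set.subset_union_right (hS.trans Set.subset_union_left)))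
    exact h2.mono_cost (by ring_nf; omega)

/-- Multiplication modulo `X ^ m + 1` can be done in `c` operations, given `half`. -/
def MulCost (half : R) (m c : ℕ) : Prop :=
  ∀ (K : Set R) (α β : Nega R m), (0 : R) ∈ K → half ∈ K → coordSet {α} ⊆ K → coordSet {β} ⊆ K →
    RingReach c K (coordSet {α * β})

theorem mulCost_naive (half : R) (m : ℕ) : MulCost half m (m * (m * 3)) := by
  intro K α β h0 _ hα hβ
  have : RingReach ((Finset.range m).card * (m * 3)) K (coord (α * β) '' Finset.range m) := by
    refine RingReach.finset_image _ fun i hi => ?_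
    rw [Finset.mem_range] at hi
    rw [coord_mul _ _ hi, negConv]
    have ha : ∀ i < m, coord α i ∈ K := fun i hi => hα ⟨α, rfl, i, hi, rfl⟩
    have hb : ∀ i < m, coord β i ∈ K := fun i hi => hβ ⟨β, rfl, i, hi, rfl⟩
    refine (RingReach.sum_const (Finset.range m) (c := 2) h0 fun j hj => ?_).mono_cost (by simp)
    rw [Finset.mem_range] at hj
    split_ifs with hji
    · exact (RingReach.mul (ha j hj) (hb _ (by omega))).mono_cost (by omega)
    · rw [← zero_sub]
      exact RingReach.sub_of (.mem h0) (.mul (ha j hj) (hb _ (by omega)))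
  simpa [coordSet_singleton] using this

/-- Multiplication modulo `X ^ (M * q) + 1` by means of multiplications modulo `X ^ (2 * q) + 1`,
where `M = 2 ^ a`. -/
theorem mulCost_step {half : R} (hhalf : 2 * half = 1) {a b c M q m n : ℕ} (hab : a ≤ b + 1)
    (hM : M = 2 ^ a) (hq : q = 2 ^ b) (hm : m = 2 * q) (hn : n = M * q)
    (hc : MulCost half m c) :
    MulCost half n (M * c + 11 * a * M * m + 2 * n) := by
  intro K α β h0 hh hα hβ
  have hMpos : 0 < M := by rw [hM]; positivity
  have hqpos : 0 < q := by rw [hq]; positivity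
  have hmb : m = 2 ^ (b + 1) := by rw [hm, hq, pow_succ, mul_comm]
  have hm0 : m ≠ 0 := by omega
  have hn0 : n ≠ 0 := by rw [hn]; positivity
  -- the pieces of a factor, as polynomials
  set piece : Nega R n → ℕ → R[X] := fun γ i =>
    ∑ l ∈ Finset.range q, C (coord γ (i * q + l)) * X ^ l with hpiece
  have hpd : ∀ γ i, (piece γ i).natDegree ≤ q - 1 := fun γ i => by
    refine natDegree_sum_le_of_forall_le _ _ fun l hl => ?_
    rw [Finset.mem_range] at hl
    exact (natDegree_C_mul_X_pow_le _ _).trans (by omega)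
  have hpc : ∀ γ i l, (piece γ i).coeff l = if l < q then coord γ (i * q + l) else 0 := by
    intro γ i l
    simp [hpiece, coeff_C_mul, coeff_X_pow]
  -- With `y = X ^ q` a factor is a polynomial in `y` of length `M`, to be multiplied modulo `y ^ M
  -- + 1`. The pieces have degree below `q`, so their products have degree below `m = 2 * q` and are
  -- not altered modulo `X ^ m + 1`. In that ring `w = ζ ^ e` satisfies `w ^ M = -1` (here `a ≤ b +
  -- 1` is needed), and the odd powers of `w` serve as the `M` roots of `y ^ M = -1`.
  set e := 2 ^ (b + 1 - a) with he
  set w := ζ R m ^ e with hw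
  have hwM : w ^ M = -1 := by
    rw [hw, ← pow_mul, he, hM, ← pow_add, show b + 1 - a + a = b + 1 by omega]
    rw [← hmb]
    exact ζ_pow
  have hw2 : w ^ ((2 * M - 1) + 1) = 1 := by
    rw [show 2 * M - 1 + 1 = M * 2 by omega, pow_mul, hwM]; simp
  have hroots : ∀ l, l + 1 = a → (w ^ 2) ^ 2 ^ l = -1 := by
    rintro l rfl
    rw [← pow_mul, ← pow_succ', ← hM, hwM]
  have hxM : ∀ j, (w ^ 1 * (w ^ 2) ^ j) ^ M = -1 := fun j => by
    calc (w ^ 1 * (w ^ 2) ^ j) ^ M = w ^ M * (w ^ M) ^ (2 * j) := by ring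
      _ = -1 := by rw [hwM, pow_mul]; simp
  set P : Nega R n → ℕ → Nega R m := fun γ i => AdjoinRoot.mk _ (piece γ i) with hP
  have hPK : ∀ γ, coordSet {γ} ⊆ K → ∀ i < M, coordSet {P γ i} ⊆ K := by
    rintro γ hγ i hi _ ⟨_, rfl, l, hl, rfl⟩
    rw [hP]
    dsimp only
    rw [coord_mk_of_natDegree_lt hm0 (lt_of_le_of_lt (hpd γ i) (by omega)), hpc]
    split_ifs with h
    · refine hγ ⟨γ, rfl, _, ?_, rfl⟩
      rw [hn]
      calc i * q + l < i * q + q := by omega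
        _ = (i + 1) * q := by ring
        _ ≤ M * q := Nat.mul_le_mul_right _ hi
    · exact h0
  -- the transforms of the factors
  set ev : (ℕ → Nega R m) → ℕ → Nega R m := fun c j =>
    ∑ i ∈ Finset.range M, c i * (w ^ 1 * (w ^ 2) ^ j) ^ i with hev
  have htr : ∀ γ, coordSet {γ} ⊆ K →
      RingReach (3 * a * M * m) K (coordSet (ev (P γ) '' Finset.range M)) := fun γ hγ =>
    ringReach_coordSet (by
      have := TwiddleStep.reach_eval (half := AdjoinRoot.of (X ^ m + 1 : R[X]) half) a (P γ) 1 2 hroots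
      rwa [← hM] at this) h0 hh (by
        rw [coordSet_image]
        exact Set.iUnion₂_subset fun i hi => hPK γ hγ i (by simpa using hi))
  have h1 := (htr α hα).union (htr β hβ)
  -- the pointwise products
  set Z : ℕ → Nega R m := negConv M (P α) (P β) with hZ
  have hZev : ∀ j, ev Z j = ev (P α) j * ev (P β) j := fun j =>
    (sum_mul_sum_eq_negConv (hxM j) (P α) (P β)).symm
  have h2 : RingReach ((Finset.range M).card * c)
      (K ∪ (coordSet (ev (P α) '' Finset.range M) ∪ coordSet (ev (P β) '' Finset.range M)))
      (⋃ j ∈ Finset.range M, coordSet {ev Z j}) := by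
    refine RingReach.biUnion_const _ fun j hj => ?_
    rw [hZev]
    refine hc _ _ _ (.inl h0) (.inl hh) ?_ ?_
    · exact fun x hx => .inr (.inl (coordSet_mono (by simpa using ⟨j, by simpa using hj, rfl⟩) hx))
    · exact fun x hx => .inr (.inr (coordSet_mono (by simpa using ⟨j, by simpa using hj, rfl⟩) hx))
  have h3 := h1.trans h2
  -- the inverse transform
  have h4 : RingReach (5 * a * M * m) (K ∪ ⋃ j ∈ Finset.range M, coordSet {ev Z j})
      (coordSet (Z '' Finset.range M)) := by
    refine ringReach_coordSet (by
      have := TwiddleStep.reach_interpolate (half := AdjoinRoot.of (X ^ m + 1 : R[X]) half) hw2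
        (by rw [← map_ofNat (AdjoinRoot.of (X ^ m + 1 : R[X])), ← map_mul, hhalf, map_one]) a Z 1 2 hroots
      rwa [← hM] at this)
      (.inl h0) (.inl hh) ?_
    rw [coordSet_image]
    exact Set.subset_union_right
  have h5 := h3.trans h4
  -- recombination
  set Zp : ℕ → R[X] := negConv M (piece α) (piece β) with hZp
  have hZmk : ∀ i, Z i = AdjoinRoot.mk _ (Zp i) := fun i => by
    rw [hZ, hZp, map_negConv]
  have hZd : ∀ i, (Zp i).natDegree < 2 * q := fun i => by
    refine lt_of_le_of_lt (natDegree_sum_le_of_forall_le (n := (q - 1) + (q - 1)) _ _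
      fun j _ => ?_) (by omega)
    split_ifs
    · exact natDegree_mul_le_of_le (hpd _ _) (hpd _ _)
    · rw [natDegree_neg]; exact natDegree_mul_le_of_le (hpd _ _) (hpd _ _)
  have hZc : ∀ i l, coord (Z i) l = (Zp i).coeff l := fun i l => by
    rw [hZmk, coord_mk_of_natDegree_lt hm0 (hm ▸ hZd i)]
  -- Each `Z i` has length `2 * q`, and its upper half overlaps the lower half of the next one. The
  -- upper half of the last one wraps around with a sign.
  set s : ℕ → R := fun t => coord (Z (t / q)) (t % q) +
    (if t / q = 0 then -coord (Z (M - 1)) (t % q + q) else coord (Z (t / q - 1)) (t % q + q))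
    with hs
  have hprod : ∀ t < n, coord (α * β) t = s t := by
    intro t ht
    refine coord_eq_of_eq_sum s ?_ ht
    set y := ζ R n ^ q with hy
    have hrange : Finset.range n = Finset.range (M * q) := by rw [hn]
    have hyM : y ^ M = -1 := by
      rw [hy, ← pow_mul, mul_comm, ← hn, ζ_pow]
    have hfac : ∀ γ : Nega R n, γ = ∑ i ∈ Finset.range M, AdjoinRoot.mk _ (piece γ i) * y ^ i := by
      intro γ
      refine (eq_sum_coord hn0 γ).trans ?_
      rw [hrange, sum_range_mul_eq]
      refine Finset.sum_congr rfl fun i _ => ?_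
      rw [hpiece, map_sum, Finset.sum_mul]
      refine Finset.sum_congr rfl fun l _ => ?_
      rw [map_mul, map_pow, AdjoinRoot.mk_C, AdjoinRoot.mk_X, hy, ← pow_mul, pow_add, mul_comm q]
      ring
    conv_lhs => rw [hfac α, hfac β, sum_mul_sum_eq_negConv hyM]
    simp_rw [← map_negConv (AdjoinRoot.mk (X ^ n + 1 : R[X])), ← hZp]
    rw [hrange, sum_range_mul_eq]
    have hsplit : ∀ i, AdjoinRoot.mk (X ^ n + 1 : R[X]) (Zp i) * y ^ i =
        (∑ l ∈ Finset.range q, AdjoinRoot.of (X ^ n + 1) ((Zp i).coeff l) * ζ R n ^ l) * y ^ i +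
        (∑ l ∈ Finset.range q, AdjoinRoot.of (X ^ n + 1) ((Zp i).coeff (l + q)) * ζ R n ^ l) *
          y ^ (i + 1) := by
      intro i
      rw [mk_eq_sum (hZd i), two_mul, Finset.sum_range_add, add_mul]
      congr 1
      rw [pow_succ', ← mul_assoc, Finset.sum_mul _ _ y]
      congr 1
      refine Finset.sum_congr rfl fun l _ => ?_
      rw [pow_add, ← hy, add_comm q]; ring
    rw [Finset.sum_congr rfl fun i _ => hsplit i, Finset.sum_add_distrib,
      sum_shift_of_pow_eq_neg_one hMpos hyM, ← Finset.sum_add_distrib]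
    refine Finset.sum_congr rfl fun i _ => ?_
    rw [← add_mul]
    have hsi : ∀ l ∈ Finset.range q, AdjoinRoot.of (X ^ n + 1) (s (i * q + l)) * ζ R n ^ (i * q + l)
        = (AdjoinRoot.of (X ^ n + 1) ((Zp i).coeff l) * ζ R n ^ l +
          (if i = 0 then -(AdjoinRoot.of (X ^ n + 1) ((Zp (M - 1)).coeff (l + q)) * ζ R n ^ l)
            else AdjoinRoot.of (X ^ n + 1) ((Zp (i - 1)).coeff (l + q)) * ζ R n ^ l)) * y ^ i := by
      intro l hl
      rw [Finset.mem_range] at hl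
      have hd : (i * q + l) / q = i := by
        rw [mul_comm, Nat.mul_add_div hqpos, Nat.div_eq_of_lt hl, add_zero]
      have hmod : (i * q + l) % q = l := by
        rw [mul_comm, Nat.mul_add_mod, Nat.mod_eq_of_lt hl]
      rw [hs]
      dsimp only
      rw [hd, hmod, hZc, hZc, hZc, pow_add, mul_comm i q, pow_mul, ← hy]
      split_ifs
      · rw [map_add, map_neg]; ring
      · rw [map_add]; ring
    rw [Finset.sum_congr rfl hsi, ← Finset.sum_mul, Finset.sum_add_distrib]
    congr 2
    split_ifs
    · rw [Finset.sum_neg_distrib]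
    · rfl
  have h6 : RingReach (2 * n) (K ∪ coordSet (Z '' Finset.range M)) (coordSet {α * β}) := by
    have : RingReach ((Finset.range n).card * 2) (K ∪ coordSet (Z '' Finset.range M))
        (coord (α * β) '' Finset.range n) := by
      refine RingReach.finset_image _ fun t ht => ?_
      rw [Finset.mem_range] at ht
      rw [hprod t ht]
      have hmem : ∀ i < M, ∀ l < 2 * q,
          coord (Z i) l ∈ K ∪ coordSet (Z '' Finset.range M) := fun i hi l hl =>
        .inr ⟨Z i, ⟨i, by simpa using hi, rfl⟩, l, by omega, rfl⟩
      have htq : t / q < M := Nat.div_lt_of_lt_mul (by rw [mul_comm, ← hn]; exact ht)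
      have htm : t % q < q := Nat.mod_lt _ hqpos
      rw [hs]
      dsimp only
      split_ifs with hi
      · rw [← sub_eq_add_neg]
        exact (RingReach.sub (hmem _ htq _ (by omega)) (hmem _ (by omega) _ (by omega))).mono_cost
          (by omega)
      · exact (RingReach.add (hmem _ htq _ (by omega)) (hmem _ (by omega) _ (by omega))).mono_cost
          (by omega)
    rw [coordSet_singleton]
    exact this.mono_cost (by simp [mul_comm])
  refine (h5.trans h6).mono_cost (le_of_eq ?_)
  simp only [Finset.card_range]; ring

/-- Splitting `k = a + b` into near halves reduces size `2 ^ k` to size `2 ^ (b + 1)`. For the cost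
per coefficient `g` this reads `g k ≤ 2 * g (b + 1) + 22 * a + 2`, and a quadratic `g` absorbs it,
since doubling at half the argument loses a factor two. For `k < 8` the naive method is within the
constant `800`. -/
theorem mulCost_pow_two {half : R} (hhalf : 2 * half = 1) (k : ℕ) :
    MulCost half (2 ^ k) (800 * 2 ^ k * (k ^ 2 + 1)) := by
  induction k using Nat.strong_induction_on with
  | _ k ih =>
    by_cases hk : k < 8
    · intro K α β h0 hh hα hβ
      refine (mulCost_naive half (2 ^ k) K α β h0 hh hα hβ).mono_cost ?_
      have : 2 ^ k ≤ 2 ^ 8 := Nat.pow_le_pow_right (by norm_num) hk.le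
      calc 2 ^ k * (2 ^ k * 3) ≤ 2 ^ k * (800 * (k ^ 2 + 1)) :=
            Nat.mul_le_mul_left _ (by nlinarith [Nat.zero_le (k ^ 2)])
        _ = 800 * 2 ^ k * (k ^ 2 + 1) := by ring
    · push Not at hk
      obtain ⟨a, b, hka, hab, hba⟩ : ∃ a b, k = a + b ∧ a ≤ b + 1 ∧ b ≤ a :=
        ⟨k - k / 2, k / 2, by omega, by omega, by omega⟩
      intro K α β h0 hh hα hβ
      refine (mulCost_step hhalf hab rfl rfl (pow_succ' 2 b) (by rw [hka, pow_add])
        (ih (b + 1) (by omega)) K α β h0 hh hα hβ).mono_cost ?_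
      have hb : 4 ≤ b := by omega
      have key : 1600 * ((b + 1) ^ 2 + 1) + 22 * a + 2 ≤ 800 * (k ^ 2 + 1) := by
        have : 2 * b ≤ k := by omega
        have h1 : (2 * b) ^ 2 ≤ k ^ 2 := Nat.pow_le_pow_left this 2
        have h2 : 4 * b ≤ b ^ 2 := by rw [sq]; exact Nat.mul_le_mul_right _ hb
        have h3 : (2 * b) ^ 2 = 4 * b ^ 2 := by ring
        have h4 : (b + 1) ^ 2 = b ^ 2 + 2 * b + 1 := by ring
        omega
      calc 2 ^ a * (800 * 2 ^ (b + 1) * ((b + 1) ^ 2 + 1)) + 11 * a * 2 ^ a * 2 ^ (b + 1) + 2 * 2 ^ k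
          = 2 ^ k * (1600 * ((b + 1) ^ 2 + 1) + 22 * a + 2) := by
            rw [hka, pow_add, pow_succ]; ring
        _ ≤ 2 ^ k * (800 * (k ^ 2 + 1)) := Nat.mul_le_mul_left _ key
        _ = _ := by ring

end Nega

/-! ### Multiplication of truncated power series -/

open PowerSeries in
/-- The first `n` coefficients of a power series. -/
def coeffsLT {R : Type*} [CommRing R] (n : ℕ) (g : R⟦X⟧) : Set R :=
  (fun i => coeff i g) '' Finset.range n

open PowerSeries in
/-- Power series can be multiplied to precision `n` in `c` operations. -/
def TruncMulCost (R : Type*) [CommRing R] (n c : ℕ) : Prop :=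
  ∀ (K : Set R) (g h : R⟦X⟧), (∀ c : ℕ, (c : R) ∈ K) → coeffsLT n g ⊆ K → coeffsLT n h ⊆ K →
    RingReach c K (coeffsLT n (g * h))

section TruncMul

open PowerSeries

variable {R : Type*} [CommRing R] {n c : ℕ}

theorem coeffsLT_subset {K : Set R} {g : R⟦X⟧} :
    coeffsLT n g ⊆ K ↔ ∀ i < n, coeff i g ∈ K := by
  simp [coeffsLT, Set.subset_def]

theorem RingReach.coeffsLT_of {K : Set R} {g : R⟦X⟧}
    (h : ∀ i < n, RingReach c K {coeff i g}) : RingReach (n * c) K (coeffsLT n g) := by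
  simpa [coeffsLT] using RingReach.finset_image (Finset.range n) (g := fun i => coeff i g)
    fun i hi => h i (Finset.mem_range.1 hi)

theorem truncMulCost_naive : TruncMulCost R n (n * (n * 2)) := by
  intro K g h hK hg hh
  rw [coeffsLT_subset] at hg hh
  refine .coeffsLT_of fun i hi => ?_
  rw [coeff_mul, Finset.Nat.sum_antidiagonal_eq_sum_range_succ_mk]
  refine (RingReach.sum_mul _ (by simpa using hK 0) (fun j hj => hg j ?_)
    (fun j hj => hh _ ?_)).mono_cost ?_
  · rw [Finset.mem_range] at hj; omega
  · dsimp only; omega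
  · simp; omega

/-- The truncated factors have fewer than `n` terms in degree, and `2 * n ≤ 2 ^ k`, so nothing wraps
around modulo `X ^ 2 ^ k + 1`. -/
theorem truncMulCost_fast {half : ℕ} (hhalf : 2 * (half : R) = 1) {k : ℕ} (hk : 2 * n ≤ 2 ^ k) :
    TruncMulCost R n (800 * 2 ^ k * (k ^ 2 + 1)) := by
  intro K g h hK hg hh
  rw [coeffsLT_subset] at hg hh
  set lift : R⟦X⟧ → Nega R (2 ^ k) := fun g =>
    ∑ t ∈ Finset.range (2 ^ k), AdjoinRoot.of _ (if t < n then coeff t g else 0) *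
      Nega.ζ R (2 ^ k) ^ t with hlift
  have hcoord : ∀ g : R⟦X⟧, ∀ i < 2 ^ k,
      Nega.coord (lift g) i = if i < n then coeff i g else 0 := fun g i hi =>
    Nega.coord_sum (fun i => if i < n then coeff i g else 0) hi
  have hK' : ∀ g : R⟦X⟧, (∀ i < n, coeff i g ∈ K) → Nega.coordSet {lift g} ⊆ K := by
    rintro g hg _ ⟨_, rfl, i, hi, rfl⟩
    rw [hcoord g i hi]
    split_ifs with h
    · exact hg i h
    · simpa using hK 0
  refine (Nega.mulCost_pow_two hhalf k K (lift g) (lift h) (by simpa using hK 0) (hK _)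
    (hK' g hg) (hK' h hh)).mono_target ?_
  rintro _ ⟨i, hi, rfl⟩
  simp only [Finset.coe_range, Set.mem_Iio] at hi
  refine ⟨_, rfl, i, by omega, ?_⟩
  change _ = coeff i (g * h)
  rw [Nega.coord_mul _ _ (by omega), negConv, coeff_mul,
    Finset.Nat.sum_antidiagonal_eq_sum_range_succ_mk]
  symm
  refine Finset.sum_subset_zero_on_sdiff (fun j => by simp; omega) (fun j hj => ?_) fun j hj => ?_
  · simp only [Finset.mem_sdiff, Finset.mem_range] at hj
    rw [if_neg (by omega), hcoord g j hj.1]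
    split_ifs with hjn
    · rw [hcoord h _ (by omega), if_neg (by omega)]; simp
    · simp
  · rw [Finset.mem_range] at hj
    rw [if_pos (by omega), hcoord g j (by omega), hcoord h _ (by omega), if_pos (by omega),
      if_pos (by omega)]

/-- Quasi-linear multiplication in characteristic `p`, to a precision that is a multiple of `p`. -/
theorem truncMulCost_charP {p : ℕ} [Fact p.Prime] [CharP R p] {T : ℕ} (hT : T ≠ 0) :
    TruncMulCost R (p * T) (3200 * (p * T ^ 2) * (Nat.log 2 (p * T) + 3) ^ 2) := by
  intro K g h hK hg hh
  have hp := (Fact.out : p.Prime)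
  have hT' : T ≤ T ^ 2 := by rw [sq]; exact Nat.le_mul_of_pos_left _ (by omega)
  -- In characteristic `2` there is no `1 / 2`, and the naive product is used. Its cost `8 * T ^ 2`
  -- is the reason for `T ^ 2` rather than `T` in the bound, which the final estimate tolerates.
  rcases hp.eq_two_or_odd with rfl | hodd
  · refine (truncMulCost_naive K g h hK hg hh).mono_cost ?_
    have : 9 ≤ (Nat.log 2 (2 * T) + 3) ^ 2 := by
      calc 9 = 3 ^ 2 := rfl
        _ ≤ _ := Nat.pow_le_pow_left (by omega) 2
    calc 2 * T * (2 * T * 2) = 8 * T ^ 2 := by ring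
      _ ≤ 3200 * (2 * T ^ 2) * 9 := by omega
      _ ≤ _ := Nat.mul_le_mul_left _ this
  · set k := Nat.log 2 (p * T) + 2 with hk
    have hpT : p * T ≠ 0 := mul_ne_zero hp.ne_zero hT
    have h1 : 2 ^ Nat.log 2 (p * T) ≤ p * T := Nat.pow_log_le_self 2 hpT
    have h2 : p * T < 2 ^ (Nat.log 2 (p * T) + 1) := Nat.lt_pow_succ_log_self (by norm_num) _
    have hhalf : 2 * (((p + 1) / 2 : ℕ) : R) = 1 := by
      have : 2 * ((p + 1) / 2) = p + 1 := by omega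
      have := congrArg (Nat.cast : ℕ → R) this
      push_cast at this
      simpa using this
    refine (truncMulCost_fast hhalf (k := k) ?_ K g h hK hg hh).mono_cost ?_
    · rw [hk, pow_succ]; rw [pow_succ] at h2 ⊢; omega
    · have h3 : 2 ^ k ≤ 4 * (p * T ^ 2) := by
        have : p * T ≤ p * T ^ 2 := Nat.mul_le_mul_left _ hT'
        rw [hk, pow_add]; omega
      have h4 : k ^ 2 + 1 ≤ (Nat.log 2 (p * T) + 3) ^ 2 := by
        rw [show Nat.log 2 (p * T) + 3 = k + 1 by omega]; nlinarith
      calc 800 * 2 ^ k * (k ^ 2 + 1) ≤ 800 * (4 * (p * T ^ 2)) * (Nat.log 2 (p * T) + 3) ^ 2 := by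
            gcongr
        _ = _ := by ring

end TruncMul

/-! ### Newton iteration for the root and the inverse of the derivative -/

section Newton

open PowerSeries

variable {R : Type*} [CommRing R]

/-- Horner's scheme: `d` multiplications and `d` additions of truncated series. -/
theorem TruncMulCost.eval {n c : ℕ} (hc : TruncMulCost R n c) {K : Set R} {f : R⟦X⟧}
    (hK : ∀ c : ℕ, (c : R) ∈ K) (hf : coeffsLT n f ⊆ K) (d : ℕ) :
    ∀ P : Polynomial R⟦X⟧, P.natDegree ≤ d → (∀ j, coeffsLT n (P.coeff j) ⊆ K) →
      RingReach (d * (c + n)) K (coeffsLT n (P.eval f)) := by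
  induction d with
  | zero =>
    intro P hP hPK
    rw [Polynomial.eq_C_of_natDegree_le_zero hP, Polynomial.eval_C]
    exact .done (hPK 0)
  | succ d ih =>
    intro P hP hPK
    have h1 := ih P.divX (by rw [Polynomial.natDegree_divX_eq_natDegree_tsub_one]; omega)
      (fun j => by rw [Polynomial.coeff_divX]; exact hPK _)
    have h2 := h1.trans (hc _ (P.divX.eval f) f (fun c => .inl (hK c)) Set.subset_union_right
      (hf.trans Set.subset_union_left))
    have h3 : P.eval f = P.divX.eval f * f + P.coeff 0 := by
      conv_lhs => rw [← Polynomial.divX_mul_X_add P]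
      simp
    have h4 : RingReach (n * 1) (K ∪ coeffsLT n (P.divX.eval f * f)) (coeffsLT n (P.eval f)) := by
      refine .coeffsLT_of fun i hi => ?_
      rw [h3, map_add]
      exact .add (.inr (coeffsLT_subset.1 le_rfl i hi)) (.inl (coeffsLT_subset.1 (hPK 0) i hi))
    exact (h2.trans h4).mono_cost (by ring_nf; omega)

/-- Newton iteration, for a root of `E` and the inverse of the derivative there. -/
noncomputable def newton {S : Type*} [CommRing S] (E : Polynomial S) (w : S) : ℕ → S × S
  | 0 => (0, w)
  | k + 1 =>
    let f := (newton E w k).1 - E.eval (newton E w k).1 * (newton E w k).2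
    (f, (newton E w k).2 * (2 - E.derivative.eval f * (newton E w k).2))

/-- Quadratic convergence. By Taylor expansion, `E(f - E(f) u)` equals `E(f) (1 - E'(f) u)` plus a
multiple of `E(f) ^ 2`. The new `f'` differs from `f` by a multiple of `E(f)`, so `1 - E'(f') u` is
still divisible by `x ^ 2 ^ k`, and the update of `u` squares this quantity. -/
theorem newton_spec {S : Type*} [CommRing S] (E : Polynomial S) (w x : S)
    (h0 : x ∣ E.eval 0) (h1 : x ∣ 1 - E.derivative.eval 0 * w) (k : ℕ) :
    x ^ 2 ^ k ∣ E.eval (newton E w k).1 ∧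
      x ^ 2 ^ k ∣ 1 - E.derivative.eval (newton E w k).1 * (newton E w k).2 := by
  induction k with
  | zero => simpa [newton] using ⟨h0, h1⟩
  | succ k ih =>
    set f := (newton E w k).1
    set u := (newton E w k).2
    obtain ⟨⟨a, ha⟩, ⟨b, hb⟩⟩ := ih
    set f' := f - E.eval f * u with hf'
    have hf1 : (newton E w (k + 1)).1 = f' := rfl
    have hu1 : (newton E w (k + 1)).2 = u * (2 - E.derivative.eval f' * u) := rfl
    rw [hf1, hu1]
    obtain ⟨r, hr⟩ := Polynomial.binomExpansion E f (-(E.eval f * u))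
    rw [← sub_eq_add_neg, ← hf'] at hr
    obtain ⟨s, hs⟩ := Polynomial.sub_dvd_eval_sub f f' E.derivative
    have hff : f - f' = E.eval f * u := by rw [hf']; ring
    rw [pow_succ, pow_mul]
    constructor
    · refine ⟨a * b + r * (a * u) ^ 2, ?_⟩
      rw [hr]
      have : E.eval f + E.derivative.eval f * -(E.eval f * u) =
          E.eval f * (1 - E.derivative.eval f * u) := by ring
      rw [this, hb, ha]; ring
    · refine ⟨(b + a * u * s * u) ^ 2, ?_⟩
      rw [hff, ha] at hs
      have : 1 - E.derivative.eval f' * u = x ^ 2 ^ k * (b + a * u * s * u) := by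
        linear_combination hb + u * hs
      linear_combination (1 - E.derivative.eval f' * u + x ^ 2 ^ k * (b + a * u * s * u)) * this

theorem newton_succ_sub {S : Type*} [CommRing S] (E : Polynomial S) (w x : S)
    (h0 : x ∣ E.eval 0) (h1 : x ∣ 1 - E.derivative.eval 0 * w) (k l : ℕ) :
    x ^ 2 ^ k ∣ (newton E w k).1 - (newton E w (k + l)).1 := by
  induction l with
  | zero => simp
  | succ l ih =>
    have h2 : x ^ 2 ^ k ∣ E.eval (newton E w (k + l)).1 :=
      (pow_dvd_pow x (Nat.pow_le_pow_right (by norm_num) (by omega))).trans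
        (newton_spec E w x h0 h1 (k + l)).1
    have h3 : (newton E w k).1 - (newton E w (k + (l + 1))).1 =
        ((newton E w k).1 - (newton E w (k + l)).1) +
          E.eval (newton E w (k + l)).1 * (newton E w (k + l)).2 := by
      rw [← add_assoc k l 1, newton]; ring
    rw [h3]
    exact dvd_add ih (h2.mul_right _)

/-- By Taylor expansion `0 = (E'(f) + r (g - f)) (g - f)`, where the first factor has the constant
term `E_y(0, 0)` and is a unit. This avoids any appeal to `R` being a domain. -/
theorem eq_of_eval_eq_zero {E : Polynomial R⟦X⟧}
    (h1 : IsUnit (constantCoeff (E.coeff 1))) {f g : R⟦X⟧} (hf : E.eval f = 0)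
    (hg : E.eval g = 0) (hf0 : constantCoeff f = 0) (hg0 : constantCoeff g = 0) : f = g := by
  obtain ⟨r, hr⟩ := Polynomial.binomExpansion E f (g - f)
  rw [add_sub_cancel, hf, hg, zero_add] at hr
  have hunit : IsUnit (E.derivative.eval f + r * (g - f)) := by
    rw [PowerSeries.isUnit_iff_constantCoeff, map_add, map_mul, map_sub, hf0, hg0, sub_zero,
      mul_zero, add_zero]
    obtain ⟨s, hs⟩ := Polynomial.sub_dvd_eval_sub f 0 E.derivative
    have := congrArg constantCoeff hs
    rw [map_sub, map_mul, sub_zero, hf0, zero_mul, sub_eq_zero] at this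
    rw [this, ← Polynomial.coeff_zero_eq_eval_zero, Polynomial.coeff_derivative]
    simpa using h1
  have : (E.derivative.eval f + r * (g - f)) * (g - f) = 0 := by linear_combination -hr
  exact (sub_eq_zero.1 (hunit.mul_right_eq_zero.1 this)).symm

/-- The series `f` and `u` are the limits of the two components of the iteration; they are fixed
before the precision `n` and the set `K` are chosen. -/
theorem exists_root_reach (E : Polynomial R⟦X⟧) {d : ℕ} (hd : E.natDegree ≤ d) {w : R}
    (h0 : constantCoeff (E.coeff 0) = 0) (h1 : constantCoeff (E.coeff 1) * w = 1) :
    ∃ f u : R⟦X⟧, constantCoeff f = 0 ∧ E.eval f = 0 ∧ E.derivative.eval f * u = 1 ∧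
      ∀ {n c l : ℕ} {K : Set R}, TruncMulCost R n c → n ≤ 2 ^ l → (∀ c : ℕ, (c : R) ∈ K) →
        w ∈ K → (∀ j, coeffsLT n (E.coeff j) ⊆ K) →
          RingReach (l * ((2 * d + 3) * (c + n)) + d * n) K (coeffsLT n f ∪ coeffsLT n u) := by
  have e0 : (X : R⟦X⟧) ∣ E.eval 0 := by
    rw [PowerSeries.X_dvd_iff, ← Polynomial.coeff_zero_eq_eval_zero, h0]
  have e1 : (X : R⟦X⟧) ∣ 1 - E.derivative.eval 0 * C w := by
    rw [PowerSeries.X_dvd_iff, ← Polynomial.coeff_zero_eq_eval_zero, Polynomial.coeff_derivative]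
    simp [h1]
  have hspec := newton_spec E (C w) X e0 e1
  have hlim := newton_succ_sub E (C w) X e0 e1
  set N := newton E (C w) with hN
  -- The `n`-th iterate is correct modulo `X ^ 2 ^ n`, and `n < 2 ^ n`.
  set f : R⟦X⟧ := PowerSeries.mk fun n => coeff n (N n).1 with hf
  have hcoeff : ∀ k n, n < 2 ^ k → coeff n f = coeff n (N k).1 := by
    intro k n hn
    have hn' : n < 2 ^ n := Nat.lt_two_pow_self
    rw [hf, coeff_mk]
    rcases le_total n k with h | h
    · obtain ⟨l, rfl⟩ := Nat.exists_eq_add_of_le h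
      have := PowerSeries.X_pow_dvd_iff.1 (hlim n l) n hn'
      rwa [map_sub, sub_eq_zero] at this
    · obtain ⟨l, rfl⟩ := Nat.exists_eq_add_of_le h
      have := PowerSeries.X_pow_dvd_iff.1 (hlim k l) (k + l) hn
      rw [map_sub, sub_eq_zero] at this
      exact this.symm
  have hfk : ∀ k, (X : R⟦X⟧) ^ 2 ^ k ∣ f - (N k).1 := fun k => by
    rw [PowerSeries.X_pow_dvd_iff]
    intro n hn
    rw [map_sub, hcoeff k n hn, sub_self]
  have heval : ∀ P : Polynomial R⟦X⟧, ∀ k, (X : R⟦X⟧) ^ 2 ^ k ∣ P.eval f - P.eval (N k).1 :=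
    fun P k => (hfk k).trans (Polynomial.sub_dvd_eval_sub _ _ P)
  have hf0 : constantCoeff f = 0 := by
    have := hcoeff 0 0 (by norm_num)
    simpa [hN, newton] using this
  have hroot : E.eval f = 0 := by
    ext n
    have : (X : R⟦X⟧) ^ 2 ^ n ∣ E.eval f := by
      have := dvd_add (heval E n) (hspec n).1
      simpa using this
    simpa using PowerSeries.X_pow_dvd_iff.1 this n Nat.lt_two_pow_self
  have hunit : IsUnit (E.derivative.eval f) := by
    rw [PowerSeries.isUnit_iff_constantCoeff]
    obtain ⟨s, hs⟩ := Polynomial.sub_dvd_eval_sub f 0 E.derivative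
    have := congrArg constantCoeff hs
    rw [map_sub, map_mul, sub_zero, hf0, zero_mul, sub_eq_zero] at this
    rw [this, ← Polynomial.coeff_zero_eq_eval_zero, Polynomial.coeff_derivative]
    simpa using IsUnit.of_mul_eq_one _ h1
  obtain ⟨u, hu⟩ := hunit.exists_right_inv
  have huk : ∀ k, (X : R⟦X⟧) ^ 2 ^ k ∣ u - (N k).2 := fun k => by
    obtain ⟨a, ha⟩ := (hspec k).2
    obtain ⟨b, hb⟩ := heval E.derivative k
    refine ⟨u * (a - b * (N k).2), ?_⟩
    linear_combination u * ha - u * (N k).2 * hb + (N k).2 * hu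
  refine ⟨f, u, hf0, hroot, hu, fun {n c l K} hc hl hK hw hE => ?_⟩
  -- the derivative
  have hK0 : (0 : R) ∈ K := by simpa using hK 0
  set K' : Set R := K ∪ ⋃ j ∈ Finset.range d, coeffsLT n (E.derivative.coeff j) with hK'
  have hder : RingReach (d * n) K (⋃ j ∈ Finset.range d, coeffsLT n (E.derivative.coeff j)) := by
    have := RingReach.biUnion_const (S := K) (Finset.range d) (c := n * 1)
      (T := fun j => coeffsLT n (E.derivative.coeff j)) fun j _ => .coeffsLT_of fun i hi => by
        rw [Polynomial.coeff_derivative, show ((j : R⟦X⟧) + 1) = C ((j + 1 : ℕ) : R) by simp,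
          PowerSeries.coeff_mul_C]
        exact .mul (coeffsLT_subset.1 (hE _) i hi) (hK _)
    simpa using this
  have hKK' : K ⊆ K' := Set.subset_union_left
  have hder' : ∀ j, coeffsLT n (E.derivative.coeff j) ⊆ K' := by
    intro j
    by_cases hj : j < d
    · exact (Set.subset_biUnion_of_mem (u := fun j => coeffsLT n (E.derivative.coeff j))
        (show j ∈ (Finset.range d : Set ℕ) by simpa using hj)).trans Set.subset_union_right
    · rw [Polynomial.coeff_derivative, Polynomial.coeff_eq_zero_of_natDegree_lt (by omega)]
      rw [coeffsLT_subset]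
      intro i _
      simpa using hKK' hK0
  -- All iterations run at full precision `n`, which costs only a logarithmic factor. Each one needs
  -- two Horner evaluations and three further products, whence `2 * d + 3`.
  have hmain : ∀ k, RingReach (k * ((2 * d + 3) * (c + n))) K'
      (coeffsLT n (N k).1 ∪ coeffsLT n (N k).2) := by
    intro k
    induction k with
    | zero =>
      refine .done (Set.union_subset ?_ ?_) <;> rw [coeffsLT_subset] <;> intro i _
      · simpa [hN, newton] using hKK' hK0
      · simp only [hN, newton, PowerSeries.coeff_C]
        split_ifs
        · exact hKK' hw
        · exact hKK' hK0
    | succ k ih =>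
      set g := (N k).1 with hg
      set v := (N k).2 with hv
      set K1 := K' ∪ (coeffsLT n g ∪ coeffsLT n v) with hK1
      have c1 : ∀ a : ℕ, (a : R) ∈ K1 := fun a => .inl (hKK' (hK a))
      have hgK1 : coeffsLT n g ⊆ K1 := fun x hx => .inr (.inl hx)
      have hvK1 : coeffsLT n v ⊆ K1 := fun x hx => .inr (.inr hx)
      set g' := g - E.eval g * v with hg'
      have hN1 : (N (k + 1)).1 = g' := rfl
      have hN2 : (N (k + 1)).2 = v * (2 - E.derivative.eval g' * v) := rfl
      have r1 := hc.eval c1 hgK1 d E hd (fun j => (hE j).trans fun x hx => .inl (hKK' hx))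
      have r2 := r1.trans (hc _ (E.eval g) v (fun a => .inl (c1 a)) Set.subset_union_right
        (hvK1.trans Set.subset_union_left))
      have r3 : RingReach (n * 1) (K1 ∪ coeffsLT n (E.eval g * v)) (coeffsLT n g') :=
        .coeffsLT_of fun i hi => by
          rw [hg', map_sub]
          exact .sub (.inl (coeffsLT_subset.1 hgK1 i hi)) (.inr (coeffsLT_subset.1 le_rfl i hi))
      have r4 := r2.trans r3
      set K2 := K1 ∪ coeffsLT n g' with hK2
      have c2 : ∀ a : ℕ, (a : R) ∈ K2 := fun a => .inl (c1 a)
      have r5 := hc.eval c2 Set.subset_union_right d E.derivative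
        ((Polynomial.natDegree_derivative_le _).trans (by omega))
        (fun j => (hder' j).trans fun x hx => .inl (.inl hx))
      have r6 := r5.trans (hc _ (E.derivative.eval g') v (fun a => .inl (c2 a))
        Set.subset_union_right (hvK1.trans fun x hx => .inl (.inl hx)))
      have r7 : RingReach (n * 1) (K2 ∪ coeffsLT n (E.derivative.eval g' * v))
          (coeffsLT n (2 - E.derivative.eval g' * v)) :=
        .coeffsLT_of fun i hi => by
          rw [map_sub, show (2 : R⟦X⟧) = C ((2 : ℕ) : R) by rw [Nat.cast_ofNat, map_ofNat],
            PowerSeries.coeff_C]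
          refine .sub ?_ (.inr (coeffsLT_subset.1 le_rfl i hi))
          split_ifs
          · exact .inl (c2 2)
          · exact .inl (by simpa using c2 0)
      have r8 := (r6.trans r7).trans (hc _ v (2 - E.derivative.eval g' * v)
        (fun a => .inl (c2 a)) (hvK1.trans fun x hx => .inl (.inl hx)) Set.subset_union_right)
      have r9 := r4.trans (r8.mono_target le_rfl).union_self
      have r10 := ih.trans (r9.mono_target
        (T' := coeffsLT n (N (k + 1)).1 ∪ coeffsLT n (N (k + 1)).2) (by
          rw [hN1, hN2]
          rintro x (hx | hx)
          · exact .inl (.inr hx)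
          · exact .inr hx))
      exact r10.mono_cost (by ring_nf; omega)
  have hsame : ∀ {a b : R⟦X⟧}, X ^ 2 ^ l ∣ a - b → coeffsLT n a = coeffsLT n b := by
    intro a b hab
    refine Set.image_congr fun i hi => ?_
    simp only [Finset.coe_range, Set.mem_Iio] at hi
    have := PowerSeries.X_pow_dvd_iff.1 hab i (by omega)
    rwa [map_sub, sub_eq_zero] at this
  rw [hsame (hfk l), hsame (huk l)]
  exact (hder.trans (hmain l)).mono_cost (by omega)

end Newton

/-! ### Linear algebra without branching -/

section MatrixReach

open Matrix

variable {R : Type*} [CommRing R] {K : Set R}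

theorem RingReach.range {ι : Type*} [Fintype ι] {c : ℕ} {g : ι → R}
    (h : ∀ i, RingReach c K {g i}) : RingReach (Fintype.card ι * c) K (Set.range g) := by
  simpa [Set.image_univ] using RingReach.finset_image Finset.univ (g := g) fun i _ => h i

/-- The set of entries of a matrix. -/
def Matrix.entries {R m n : Type*} (B : Matrix m n R) : Set R := Set.range fun q : m × n => B q.1 q.2

theorem Matrix.entries_subset {R : Type*} {K : Set R} {m n : Type*} {B : Matrix m n R} :
    B.entries ⊆ K ↔ ∀ i k, B i k ∈ K := by
  simp [Matrix.entries, Set.range_subset_iff]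

theorem RingReach.entries {m n : Type*} [Fintype m] [Fintype n] {c : ℕ} {B : Matrix m n R}
    (h : ∀ i k, RingReach c K {B i k}) :
    RingReach (Fintype.card m * Fintype.card n * c) K B.entries := by
  simpa [Matrix.entries] using
    RingReach.range (g := fun q : m × n => B q.1 q.2) fun q => h q.1 q.2

theorem RingReach.dotProduct {n : Type*} [Fintype n] {v w : n → R} (h0 : (0 : R) ∈ K)
    (hv : ∀ i, v i ∈ K) (hw : ∀ i, w i ∈ K) : RingReach (Fintype.card n * 2) K {v ⬝ᵥ w} :=
  RingReach.sum_mul Finset.univ h0 (fun i _ => hv i) fun i _ => hw i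

theorem RingReach.vecMul {m n : Type*} [Fintype m] [Fintype n] {v : m → R} {B : Matrix m n R}
    (h0 : (0 : R) ∈ K) (hv : ∀ i, v i ∈ K) (hB : ∀ i k, B i k ∈ K) :
    RingReach (Fintype.card n * (Fintype.card m * 2)) K (Set.range (v ᵥ* B)) :=
  .range fun k => .dotProduct h0 hv fun i => hB i k

theorem RingReach.mulVec {m n : Type*} [Fintype m] [Fintype n] {v : n → R} {B : Matrix m n R}
    (h0 : (0 : R) ∈ K) (hv : ∀ i, v i ∈ K) (hB : ∀ i k, B i k ∈ K) :
    RingReach (Fintype.card m * (Fintype.card n * 2)) K (Set.range (B *ᵥ v)) :=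
  .range fun i => .dotProduct h0 (hB i) hv

theorem RingReach.matrix_mul {l m n : Type*} [Fintype l] [Fintype m] [Fintype n]
    {A : Matrix l m R} {B : Matrix m n R}
    (h0 : (0 : R) ∈ K) (hA : ∀ i k, A i k ∈ K) (hB : ∀ i k, B i k ∈ K) :
    RingReach (Fintype.card l * Fintype.card n * (Fintype.card m * 2)) K (A * B).entries :=
  .entries fun i k => .dotProduct h0 (hA i) fun j => hB j k

/-- A vector `y` with `u * (1 - y ⬝ᵥ u) = 0`. -/
theorem exists_pivot {p : ℕ} (hp : 2 ≤ p) (hR : ∀ a : R, a ^ p = a) {T : ℕ} (u : Fin T → R)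
    (hK : ∀ c : ℕ, (c : R) ∈ K) (hu : ∀ i, u i ∈ K) :
    ∃ y : Fin T → R, (∀ i, u i * (1 - y ⬝ᵥ u) = 0) ∧
      RingReach (T * (2 * p + 3)) K (Set.range y) := by
  obtain ⟨q, rfl⟩ : ∃ q, p = q + 2 := ⟨p - 2, by omega⟩
  set a : ℕ → R := fun i => if h : i < T then u ⟨i, h⟩ else 0 with ha
  have haK : ∀ i, a i ∈ K := fun i => by
    simp only [ha]; split_ifs
    · exact hu _
    · simpa using hK 0
  -- Here `q + 1 = p - 1`, and `1 - a ^ (p - 1)` is the idempotent that marks where `a` vanishes. So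
  -- `t i` marks where the first `i` entries all vanish, `y i * a i` marks where entry `i` is the
  -- first nonzero one, and the sum of these telescopes to `1 - t T`.
  set t : ℕ → R := fun i => ∏ l ∈ Finset.range i, (1 - a l ^ (q + 1)) with ht
  set y : ℕ → R := fun i => t i * a i ^ q with hy
  have hreach : ∀ n, RingReach (n * (2 * (q + 2) + 3)) K (insert (t n) (y '' Finset.range n)) := by
    intro n
    induction n with
    | zero => exact .done (by simpa [ht] using hK 1)
    | succ n ih =>
      set K1 := K ∪ insert (t n) (y '' Finset.range n) with hK1
      have h1 : (1 : R) ∈ K1 := .inl (by simpa using hK 1)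
      have ht1 : t n ∈ K1 := .inr (by simp)
      have r1 : RingReach (0 + q + 1) K1 {y n} := .mul_of (.mem ht1) (.pow h1 (.inl (haK n)) q)
      have r2 : RingReach (0 + (0 + (q + 1) + 1) + 1) K1 {t (n + 1)} := by
        simp only [ht, Finset.prod_range_succ]
        exact .mul_of (.mem ht1) (.sub_of (.mem h1) (.pow h1 (.inl (haK n)) _))
      have r3 := (r1.union r2).union_self
      refine ((ih.trans r3).mono_cost (by ring_nf; omega)).mono_target ?_
      rintro x (rfl | ⟨i, hi, rfl⟩)
      · exact .inr (.inr rfl)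
      · simp only [Finset.coe_range, Set.mem_Iio] at hi
        rcases Nat.lt_succ_iff_lt_or_eq.1 hi with hi | rfl
        · exact .inl (.inr (.inr ⟨i, by simpa using hi, rfl⟩))
        · exact .inr (.inl rfl)
  refine ⟨fun i => y i, fun i => ?_, ((hreach T).mono_cost (by omega)).mono_target ?_⟩
  · have hsum : (fun i : Fin T => y i) ⬝ᵥ u = 1 - t T := by
      have h1 : (fun i : Fin T => y i) ⬝ᵥ u = ∑ i ∈ Finset.range T, y i * a i := by
        rw [dotProduct, Finset.sum_range]
        refine Finset.sum_congr rfl fun i _ => ?_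
        simp [ha]
      have h2 : ∀ i, y i * a i = t i - t (i + 1) := fun i => by
        simp only [hy, ht, Finset.prod_range_succ]; ring
      rw [h1, Finset.sum_congr rfl fun i _ => h2 i, Finset.sum_range_sub']
      simp [ht]
    rw [hsum, sub_sub_cancel]
    simp only [ht]
    rw [← Finset.mul_prod_erase _ _ (Finset.mem_range.2 i.2), ← mul_assoc]
    have : u i * (1 - a i ^ (q + 1)) = 0 := by
      have := hR (u i)
      simp only [ha, Fin.is_lt, dite_true]
      rw [mul_sub, mul_one, ← pow_succ', this, sub_self]
    rw [this, zero_mul]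
  · rintro _ ⟨i, rfl⟩
    exact .inr ⟨i, by simp, rfl⟩

/-- A generalized inverse can be computed in cubic time, without branching. -/
theorem exists_generalizedInverse {p : ℕ} (hp : 2 ≤ p) (hR : ∀ a : R, a ^ p = a) {T : ℕ}
    {κ : Type*} [Fintype κ] [DecidableEq κ] (s : Finset κ) :
    ∀ (K : Set R) (B : Matrix (Fin T) κ R), (∀ c : ℕ, (c : R) ∈ K) → (∀ i k, B i k ∈ K) →
      (∀ i, ∀ k ∉ s, B i k = 0) →
      ∃ G : Matrix κ (Fin T) R, B * G * B = B ∧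
        RingReach (s.card * (T * (2 * p + 5 + 10 * Fintype.card κ))) K G.entries := by
  induction s using Finset.induction_on with
  | empty =>
    intro K B hK hB h0
    refine ⟨0, ?_, .done ?_⟩
    · ext i k; simp [h0 i k (by simp)]
    · rw [entries_subset]; intro i k; simpa using hK 0
  | insert j s hj ih =>
    intro K B hK hB h0
    have hK0 : (0 : R) ∈ K := by simpa using hK 0
    set D := Fintype.card κ with hD
    set u : Fin T → R := fun i => B i j with hu
    obtain ⟨y, hy, hyr⟩ := exists_pivot hp hR u hK (fun i => hB i j)
    set w := y ᵥ* B with hw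
    -- A rank-one elimination. Column `j` of `B'` is `u * (1 - y ⬝ᵥ u) = 0`, and columns that
    -- already vanish stay zero, so the induction on the set of remaining columns applies to `B'`.
    set B' : Matrix (Fin T) κ R := B - vecMulVec u w with hB'
    set K1 := K ∪ Set.range y with hK1
    have hyK1 : ∀ i, y i ∈ K1 := fun i => .inr ⟨i, rfl⟩
    have hKK1 : K ⊆ K1 := Set.subset_union_left
    have r1 : RingReach (D * (T * 2)) K1 (Set.range w) := by
      simpa using RingReach.vecMul (hKK1 hK0) hyK1 fun i k => hKK1 (hB i k)
    set K2 := K1 ∪ Set.range w with hK2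
    have hwK2 : ∀ k, w k ∈ K2 := fun k => .inr ⟨k, rfl⟩
    have hKK2 : K ⊆ K2 := hKK1.trans Set.subset_union_left
    have r2 : RingReach (T * D * 2) K2 B'.entries := by
      have : RingReach (Fintype.card (Fin T) * D * 2) K2 B'.entries := .entries fun i k => by
        rw [hB', Matrix.sub_apply, vecMulVec_apply]
        exact .sub_of (.mem (hKK2 (hB i k))) (.mul (hKK2 (hB i j)) (hwK2 k))
      simpa using this
    set K3 := K2 ∪ B'.entries with hK3
    have hKK3 : K ⊆ K3 := hKK2.trans Set.subset_union_left
    have hB'K3 : ∀ i k, B' i k ∈ K3 := fun i k => .inr ⟨(i, k), rfl⟩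
    have hB'0 : ∀ i, ∀ k ∉ s, B' i k = 0 := by
      intro i k hk
      rw [hB', Matrix.sub_apply, vecMulVec_apply, hw]
      by_cases hkj : k = j
      · subst hkj
        have := hy i
        rw [mul_sub, mul_one] at this
        exact this
      · have hz : ∀ i, B i k = 0 := fun i => h0 i k (by simp [hkj, hk])
        rw [hz]
        simp [vecMul, dotProduct, hz]
    obtain ⟨G', hG', hG'r⟩ := ih K3 B' (fun c => hKK3 (hK c)) hB'K3 hB'0
    set K4 := K3 ∪ G'.entries with hK4
    have hKK4 : K ⊆ K4 := hKK3.trans Set.subset_union_left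
    have hG'K4 : ∀ k i, G' k i ∈ K4 := fun k i => .inr ⟨(k, i), rfl⟩
    have r4 : RingReach (D * (T * 2)) K4 (Set.range (G' *ᵥ u)) := by
      simpa using RingReach.mulVec (hKK4 hK0) (fun i => hKK4 (hB i j)) hG'K4
    set K5 := K4 ∪ Set.range (G' *ᵥ u) with hK5
    set H : Matrix κ (Fin T) R := G' - vecMulVec (G' *ᵥ u) y with hH
    have hyK4 : ∀ i, y i ∈ K4 := fun i => .inl (.inl (.inl (hyK1 i)))
    have r5 : RingReach (D * T * 2) K5 H.entries := by
      have : RingReach (D * Fintype.card (Fin T) * 2) K5 H.entries := .entries fun k i => by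
        rw [hH, Matrix.sub_apply, vecMulVec_apply]
        exact .sub_of (.mem (.inl (hG'K4 k i))) (.mul (.inr ⟨k, rfl⟩) (.inl (hyK4 i)))
      simpa using this
    set K6 := K5 ∪ H.entries with hK6
    have hHK6 : ∀ k i, H k i ∈ K6 := fun k i => .inr ⟨(k, i), rfl⟩
    have r6 : RingReach (T * (D * 2)) K6 (Set.range (w ᵥ* H)) := by
      simpa using RingReach.vecMul (B := H) (.inl (.inl (hKK4 hK0)))
        (fun k => .inl (.inl (.inl (.inl (hwK2 k))))) hHK6
    set K7 := K6 ∪ Set.range (w ᵥ* H) with hK7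
    set e : κ → R := Pi.single j 1 with he
    -- In factored form `G = (1 - e w) G' (1 - u y) + e y`. Since `B (1 - e w) = B' = (1 - u y) B`,
    -- the product `B G B` is `B' G' B' + u w = B' + u w = B`.
    set G : Matrix κ (Fin T) R := H - vecMulVec e (w ᵥ* H) + vecMulVec e y with hG
    have r7 : RingReach (T * 2) K7 G.entries := by
      have : RingReach (Fintype.card (Fin T) * 2) K7
          (Set.range fun i => H j i - (w ᵥ* H) i + y i) := .range fun i =>
        .add_of (n := 1) (m := 0) (.sub (.inl (hHK6 j i)) (.inr ⟨i, rfl⟩))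
          (.mem (.inl (.inl (.inl (hyK4 i)))))
      rw [Fintype.card_fin] at this
      refine this.union_self.mono_target ?_
      rw [entries_subset]
      intro k i
      rw [hG, Matrix.add_apply, Matrix.sub_apply, vecMulVec_apply, vecMulVec_apply, he]
      by_cases hkj : k = j
      · subst hkj
        exact .inr ⟨i, by simp⟩
      · exact .inl (.inl (by simpa [hkj] using hHK6 k i))
    refine ⟨G, ?_, ?_⟩
    · have e1 : B * vecMulVec e w = vecMulVec u w := by
        rw [mul_vecMulVec, he, mulVec_single_one]; rfl
      have e2 : vecMulVec u y * B = vecMulVec u w := vecMulVec_mul _ _ _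
      have e3 : G = (1 - vecMulVec e w) * (G' * (1 - vecMulVec u y)) + vecMulVec e y := by
        rw [hG, hH, Matrix.mul_sub, Matrix.sub_mul 1, Matrix.one_mul, Matrix.mul_one,
          mul_vecMulVec, vecMulVec_mul]
      have e4 : B * (1 - vecMulVec e w) = B' := by rw [Matrix.mul_sub, e1, Matrix.mul_one]
      have e5 : (1 - vecMulVec u y) * B = B' := by rw [Matrix.sub_mul, e2, Matrix.one_mul]
      have e6 : B * vecMulVec e y * B = vecMulVec u w := by
        rw [Matrix.mul_assoc, vecMulVec_mul, ← hw, e1]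
      calc B * G * B = (B * (1 - vecMulVec e w)) * G' * ((1 - vecMulVec u y) * B) +
            B * vecMulVec e y * B := by
              rw [e3]; simp only [Matrix.mul_add, Matrix.add_mul, Matrix.mul_assoc]
        _ = B := by rw [e4, e5, hG', e6, hB', sub_add_cancel]
    · have := hyr.trans (r1.trans (r2.trans (hG'r.trans (r4.trans (r5.trans (r6.trans r7))))))
      refine this.mono_cost ?_
      rw [Finset.card_insert_of_notMem hj]
      ring_nf; omega

end MatrixReach

/-! ### Sections of power series modulo `p` -/

section Sections

open PowerSeries

variable {R : Type*} [CommRing R] {p : ℕ}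

/-- The series of the coefficients with index congruent to `r` modulo `p`. -/
noncomputable def PowerSeries.section (p r : ℕ) (g : R⟦X⟧) : R⟦X⟧ :=
  PowerSeries.mk fun n => coeff (p * n + r) g

theorem PowerSeries.section_add (p r : ℕ) (a b : R⟦X⟧) :
    PowerSeries.section p r (a + b) = PowerSeries.section p r a + PowerSeries.section p r b := by
  ext n; simp [PowerSeries.section]

theorem PowerSeries.section_sub (p r : ℕ) (a b : R⟦X⟧) :
    PowerSeries.section p r (a - b) = PowerSeries.section p r a - PowerSeries.section p r b := by
  ext n; simp [PowerSeries.section]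

theorem PowerSeries.section_zero (p r : ℕ) : PowerSeries.section p r (0 : R⟦X⟧) = 0 := by
  ext n; simp [PowerSeries.section]

theorem sum_antidiagonal_ite_dvd {r : ℕ} (hr : r < p) (n : ℕ) (G A : ℕ → R) :
    ∑ q ∈ Finset.HasAntidiagonal.antidiagonal (p * n + r), (if p ∣ q.1 then G (q.1 / p) else 0) * A q.2 =
      ∑ q ∈ Finset.HasAntidiagonal.antidiagonal n, G q.1 * A (p * q.2 + r) := by
  have hp : 0 < p := by omega
  symm
  refine Finset.sum_of_injOn (fun q => (p * q.1, p * q.2 + r)) ?_ ?_ ?_ ?_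
  · rintro ⟨a, b⟩ _ ⟨a', b'⟩ _ h
    simp only [Prod.mk.injEq, mul_eq_mul_left_iff, Nat.add_right_cancel_iff] at h ⊢
    omega
  · rintro ⟨a, b⟩ h
    simp only [Finset.mem_coe, Finset.HasAntidiagonal.mem_antidiagonal] at h ⊢
    rw [← h]; ring
  · rintro ⟨a, b⟩ h hn
    simp only [Finset.HasAntidiagonal.mem_antidiagonal] at h
    rw [if_neg, zero_mul]
    rintro ⟨a, rfl⟩
    apply hn
    have : a ≤ n := by
      by_contra hlt
      have : p * (n + 1) ≤ p * a := Nat.mul_le_mul_left _ (by omega)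
      rw [mul_add] at this
      omega
    obtain ⟨l, rfl⟩ := Nat.exists_eq_add_of_le this
    refine ⟨(a, l), by simp, ?_⟩
    rw [mul_add] at h
    simp only [Prod.mk.injEq, true_and]
    omega
  · rintro ⟨a, b⟩ _
    simp [hp]

variable [Fact p.Prime] [CharP R p]

/-- Frobenius fixes the coefficients, so `g ^ p = g(x ^ p)`. -/
theorem PowerSeries.coeff_pow_char (hR : ∀ a : R, a ^ p = a) (g : R⟦X⟧) (n : ℕ) :
    coeff n (g ^ p) = if p ∣ n then coeff (n / p) g else 0 := by
  have hp := (Fact.out : p.Prime).ne_zero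
  have h := MvPowerSeries.map_frobenius_expand (p := p) hp (f := g)
  have hid : frobenius R p = RingHom.id R := by ext a; simpa [frobenius_def] using hR a
  rw [hid] at h
  have h2 : PowerSeries.expand p hp g = g ^ p := by
    rw [← h]; rfl
  rw [← h2, coeff_expand]

/-- A factor `g(x ^ p)` only has exponents divisible by `p`, so it leaves every section as `g(x)`.
-/
theorem PowerSeries.section_pow_char_mul (hR : ∀ a : R, a ^ p = a) {r : ℕ} (hr : r < p)
    (g a : R⟦X⟧) :
    PowerSeries.section p r (g ^ p * a) = g * PowerSeries.section p r a := by
  ext n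
  simp only [PowerSeries.section, coeff_mk, coeff_mul, coeff_pow_char hR]
  exact sum_antidiagonal_ite_dvd hr n (fun i => coeff i g) fun i => coeff i a

end Sections

/-! ### Cartier operators in two variables -/

section Cartier

open PowerSeries

variable {R : Type*} [CommRing R] {p : ℕ}

/-- The bivariate section operator: the coefficients of `x ^ (p * i + r) * y ^ (p * j + p - 1)`. -/
noncomputable def cartier (p r : ℕ) (P : Polynomial R⟦X⟧) : Polynomial R⟦X⟧ :=
  ∑ j ∈ Finset.range (P.natDegree + 1),
    Polynomial.monomial j (PowerSeries.section p r (P.coeff (p * j + (p - 1))))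

theorem coeff_cartier [Fact p.Prime] (r : ℕ) (P : Polynomial R⟦X⟧) (j : ℕ) :
    (cartier p r P).coeff j = PowerSeries.section p r (P.coeff (p * j + (p - 1))) := by
  simp only [cartier, Polynomial.finsetSum_coeff, Polynomial.coeff_monomial]
  rw [Finset.sum_ite_eq']
  split_ifs with h
  · rfl
  · rw [Finset.mem_range, not_lt] at h
    rw [Polynomial.coeff_eq_zero_of_natDegree_lt, PowerSeries.section_zero]
    have : j ≤ p * j := Nat.le_mul_of_pos_left _ (Fact.out : p.Prime).pos
    omega

theorem cartier_add [Fact p.Prime] (r : ℕ) (P Q : Polynomial R⟦X⟧) :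
    cartier p r (P + Q) = cartier p r P + cartier p r Q := by
  ext1 j
  simp [coeff_cartier, PowerSeries.section_add]

variable [Fact p.Prime] [CharP R p]

/-- The factor `(y - f) ^ p = y ^ p - f(x ^ p)` is a series in `x ^ p` and `y ^ p`, so it can be
pulled out. -/
theorem cartier_X_sub_C_pow_mul (hR : ∀ a : R, a ^ p = a) {r : ℕ} (hr : r < p) (f : R⟦X⟧)
    (B : Polynomial R⟦X⟧) :
    cartier p r ((Polynomial.X - Polynomial.C f) ^ p * B) =
      (Polynomial.X - Polynomial.C f) * cartier p r B := by
  have : CharP (R⟦X⟧) p := by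
    refine charP_of_injective_ringHom (f := (PowerSeries.C : R →+* R⟦X⟧)) ?_ p
    exact PowerSeries.C_injective
  have hp := (Fact.out : p.Prime).pos
  rw [sub_pow_char, ← Polynomial.C_pow]
  ext1 j
  rw [coeff_cartier, sub_mul, sub_mul, Polynomial.coeff_sub, Polynomial.coeff_sub,
    Polynomial.coeff_C_mul, Polynomial.coeff_C_mul, PowerSeries.section_sub,
    PowerSeries.section_pow_char_mul hR hr, coeff_cartier, Polynomial.coeff_X_pow_mul']
  congr 1
  cases j with
  | zero => rw [if_neg (by omega), PowerSeries.section_zero, Polynomial.coeff_X_mul_zero]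
  | succ j =>
    rw [Polynomial.coeff_X_mul, coeff_cartier, if_pos (by rw [mul_add]; omega)]
    congr 2
    rw [mul_add]; omega

/-- In degree at most `p - 1` only the leading coefficient `1` sits at an exponent of the form `p *
j + p - 1`. -/
theorem cartier_C_mul_X_sub_C_pow (r : ℕ) (a f : R⟦X⟧) :
    cartier p r (Polynomial.C a * (Polynomial.X - Polynomial.C f) ^ (p - 1)) =
      Polynomial.C (PowerSeries.section p r a) := by
  have hp := (Fact.out : p.Prime).pos
  have hmonic : ((Polynomial.X - Polynomial.C f) ^ (p - 1)).Monic :=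
    (Polynomial.monic_X_sub_C f).pow _
  have : Nontrivial R := CharP.nontrivial_of_char_ne_one (Fact.out : p.Prime).ne_one
  have hdeg : ((Polynomial.X - Polynomial.C f) ^ (p - 1)).natDegree = p - 1 := by
    rw [(Polynomial.monic_X_sub_C f).natDegree_pow, Polynomial.natDegree_X_sub_C, mul_one]
  ext1 j
  rw [coeff_cartier, Polynomial.coeff_C_mul, Polynomial.coeff_C]
  split_ifs with h
  · subst h
    have h1 := hmonic.coeff_natDegree
    rw [hdeg] at h1
    rw [mul_zero, zero_add, h1, mul_one]
  · rw [Polynomial.coeff_eq_zero_of_natDegree_lt, mul_zero, PowerSeries.section_zero]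
    rw [hdeg]
    have : 0 < p * j := Nat.mul_pos hp (by omega)
    omega

/-- A section of `P(x, f) / E_y(x, f)` is again of this form. -/
theorem section_eval_mul (hR : ∀ a : R, a ^ p = a) {r : ℕ} (hr : r < p)
    {E : Polynomial R⟦X⟧} {f u : R⟦X⟧} (hf : E.eval f = 0) (hu : E.derivative.eval f * u = 1)
    (P : Polynomial R⟦X⟧) :
    PowerSeries.section p r (P.eval f * u) = (cartier p r (P * E ^ (p - 1))).eval f * u := by
  have hp := (Fact.out : p.Prime).pos
  -- With `E = (y - f) U` one has `E_y(f) = U(f)` and `P E ^ (p - 1) = A (y - f) ^ (p - 1)` for `A =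
  -- P U ^ (p - 1)`. Writing `A = A(f) + (y - f) B`, the second part contributes a multiple of `y -
  -- f`, which dies at `y = f`. The first part contributes the section of `A(f) = U(f) ^ p * (P(f) *
  -- u)`, that is, `U(f)` times the desired section.
  obtain ⟨U, hU⟩ := Polynomial.dvd_iff_isRoot.2 (show E.IsRoot f from hf)
  have hUf : E.derivative.eval f = U.eval f := by
    rw [hU]; simp
  rw [hUf] at hu
  set A := P * U ^ (p - 1) with hA
  obtain ⟨B, hB⟩ := Polynomial.X_sub_C_dvd_sub_C_eval (a := f) (p := A)
  have h1 : P * E ^ (p - 1) =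
      Polynomial.C (A.eval f) * (Polynomial.X - Polynomial.C f) ^ (p - 1) +
        (Polynomial.X - Polynomial.C f) ^ p * B := by
    have h2 : (Polynomial.X - Polynomial.C f) ^ p =
        (Polynomial.X - Polynomial.C f) ^ (p - 1) * (Polynomial.X - Polynomial.C f) := by
      rw [← pow_succ]; congr 1; omega
    rw [hU, mul_pow, h2]
    linear_combination (Polynomial.X - Polynomial.C f) ^ (p - 1) * hB
  rw [h1, cartier_add, cartier_C_mul_X_sub_C_pow, cartier_X_sub_C_pow_mul hR hr]
  have h3 : A.eval f = U.eval f ^ p * (P.eval f * u) := by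
    have h4 : U.eval f ^ p = U.eval f ^ (p - 1) * U.eval f := by
      rw [← pow_succ]; congr 1; omega
    rw [hA, h4]; simp only [Polynomial.eval_mul, Polynomial.eval_pow]
    linear_combination -(P.eval f * U.eval f ^ (p - 1)) * hu
  rw [h3, PowerSeries.section_pow_char_mul hR hr]
  simp only [Polynomial.eval_add, Polynomial.eval_C, Polynomial.eval_mul, Polynomial.eval_sub,
    Polynomial.eval_X, sub_self, zero_mul, add_zero]
  linear_combination -(PowerSeries.section p r (P.eval f * u)) * hu

end Cartier

/-! ### The rows of coefficients and their transition matrices -/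

section Transition

open PowerSeries Matrix

variable {R : Type*} [CommRing R]

/-- The degree in `x` is at most `h`. -/
def XDegLE (h : ℕ) (P : Polynomial R⟦X⟧) : Prop := ∀ j i, h < i → coeff i (P.coeff j) = 0

theorem XDegLE.mul {a b : ℕ} {P Q : Polynomial R⟦X⟧} (hP : XDegLE a P) (hQ : XDegLE b Q) :
    XDegLE (a + b) (P * Q) := by
  intro j i hi
  rw [Polynomial.coeff_mul, map_sum]
  refine Finset.sum_eq_zero fun q _ => ?_
  rw [PowerSeries.coeff_mul]
  refine Finset.sum_eq_zero fun t ht => ?_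
  rw [Finset.HasAntidiagonal.mem_antidiagonal] at ht
  rcases lt_or_ge a t.1 with h | h
  · rw [hP _ _ h, zero_mul]
  · rw [hQ _ _ (by omega), mul_zero]

theorem XDegLE.pow {a : ℕ} {P : Polynomial R⟦X⟧} (hP : XDegLE a P) (n : ℕ) :
    XDegLE (n * a) (P ^ n) := by
  induction n with
  | zero =>
    intro j i hi
    rw [pow_zero, Polynomial.coeff_one]
    split_ifs
    · rw [PowerSeries.coeff_one, if_neg (by omega)]
    · simp
  | succ n ih =>
    rw [pow_succ, Nat.succ_mul]
    exact ih.mul hP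

/-- The exponents of the numerators. -/
abbrev Exponents (h d : ℕ) : Type := Fin (h + 1) × Fin d

theorem eval_eq_sum_exponents {h d : ℕ} {Q : Polynomial R⟦X⟧} (hx : XDegLE h Q)
    (hd : ∀ j, d ≤ j → Q.coeff j = 0) (f : R⟦X⟧) :
    Q.eval f = ∑ b : Exponents h d, C (coeff b.1 (Q.coeff b.2)) * (X ^ (b.1 : ℕ) * f ^ (b.2 : ℕ)) := by
  rcases Nat.eq_zero_or_pos d with rfl | hdpos
  · have : Q = 0 := by ext1 j; simpa using hd j (by omega)
    simp [this]
  have hnat : Q.natDegree < d := by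
    by_contra hlt
    have h0 := hd _ (not_lt.1 hlt)
    rw [Polynomial.coeff_natDegree, Polynomial.leadingCoeff_eq_zero] at h0
    rw [h0, Polynomial.natDegree_zero] at hlt
    exact hlt hdpos
  rw [Polynomial.eval_eq_sum_range' hnat, Fintype.sum_prod_type_right, Finset.sum_range]
  refine Finset.sum_congr rfl fun j _ => ?_
  simp only [← mul_assoc]
  rw [← Finset.sum_mul]
  congr 1
  rw [← Finset.sum_range (fun i => C (coeff i (Q.coeff j)) * (X : R⟦X⟧) ^ i)]
  ext n
  simp only [map_sum, PowerSeries.coeff_C_mul, PowerSeries.coeff_X_pow, mul_ite, mul_one, mul_zero,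
    Finset.sum_ite_eq, Finset.mem_range]
  split_ifs with hn
  · rfl
  · exact hx _ _ (by omega)

/-- The coefficients of `x ^ n` in `x ^ i * f ^ j * u`. -/
noncomputable def coeffRow (h d : ℕ) (f u : R⟦X⟧) (n : ℕ) (b : Exponents h d) : R :=
  coeff n (X ^ (b.1 : ℕ) * f ^ (b.2 : ℕ) * u)

theorem coeff_eval_mul_eq {h d : ℕ} {Q : Polynomial R⟦X⟧} (hx : XDegLE h Q)
    (hd : ∀ j, d ≤ j → Q.coeff j = 0) (f u : R⟦X⟧) (n : ℕ) :
    coeff n (Q.eval f * u) =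
      coeffRow h d f u n ⬝ᵥ fun b => coeff (b.1 : ℕ) (Q.coeff (b.2 : ℕ)) := by
  rw [eval_eq_sum_exponents hx hd, Finset.sum_mul, map_sum]
  refine Finset.sum_congr rfl fun b _ => ?_
  rw [mul_assoc, PowerSeries.coeff_C_mul, coeffRow, mul_comm]

/-- The numerators are stable: the section of `x ^ i * y ^ j * E ^ (p - 1)` has degree at most `(h +
(p - 1) * h) / p = h` in `x`, and degree below `d` in `y` because `(d - 1) + (p - 1) * d < p * d + p
- 1`. Only the existence of `L` is used later; its entries are never computed. -/
theorem exists_transition {p : ℕ} [Fact p.Prime] [CharP R p] (hR : ∀ a : R, a ^ p = a)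
    {h d : ℕ} {E : Polynomial R⟦X⟧} (hd : E.natDegree ≤ d) (hx : XDegLE h E) {f u : R⟦X⟧}
    (hf : E.eval f = 0) (hu : E.derivative.eval f * u = 1) {r : ℕ} (hr : r < p) :
    ∃ L : Matrix (Exponents h d) (Exponents h d) R,
      ∀ n, coeffRow h d f u (p * n + r) = coeffRow h d f u n ᵥ* L := by
  have hp := (Fact.out : p.Prime).pos
  set Q : Exponents h d → Polynomial R⟦X⟧ := fun b =>
    cartier p r (Polynomial.monomial (b.2 : ℕ) (X ^ (b.1 : ℕ)) * E ^ (p - 1)) with hQ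
  have hQx : ∀ b, XDegLE h (Q b) := by
    intro b j i hi
    rw [hQ]; dsimp only
    rw [coeff_cartier, PowerSeries.section, coeff_mk]
    have hmon : XDegLE h (Polynomial.monomial (b.2 : ℕ) ((X : R⟦X⟧) ^ (b.1 : ℕ))) := by
      intro j i hi
      rw [Polynomial.coeff_monomial]
      split_ifs
      · rw [PowerSeries.coeff_X_pow, if_neg (by have := b.1.2; omega)]
      · simp
    refine (hmon.mul (hx.pow (p - 1))) _ _ ?_
    have h1 : h + (p - 1) * h = p * h := by
      obtain ⟨q, rfl⟩ : ∃ q, p = q + 1 := ⟨p - 1, by omega⟩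
      simp only [Nat.add_sub_cancel]; ring
    have h2 : p * h < p * i := Nat.mul_lt_mul_of_pos_left hi hp
    omega
  have hQd : ∀ b j, d ≤ j → (Q b).coeff j = 0 := by
    intro b j hj
    rw [hQ]; dsimp only
    rw [coeff_cartier, Polynomial.coeff_eq_zero_of_natDegree_lt, PowerSeries.section_zero]
    have h1 := Polynomial.natDegree_mul_le_of_le
      (Polynomial.natDegree_monomial_le (m := (b.2 : ℕ)) ((X : R⟦X⟧) ^ (b.1 : ℕ)))
      (Polynomial.natDegree_pow_le_of_le (p - 1) hd)
    refine lt_of_le_of_lt h1 ?_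
    have h2 : d + (p - 1) * d = p * d := by
      obtain ⟨q, rfl⟩ : ∃ q, p = q + 1 := ⟨p - 1, by omega⟩
      simp only [Nat.add_sub_cancel]; ring
    have h3 : p * d ≤ p * j := Nat.mul_le_mul_left _ hj
    have := b.2.2
    omega
  refine ⟨Matrix.of fun b' b => coeff (b'.1 : ℕ) ((Q b).coeff (b'.2 : ℕ)), fun n => ?_⟩
  funext b
  have h1 : coeffRow h d f u (p * n + r) b = coeff n (PowerSeries.section p r
      ((Polynomial.monomial (b.2 : ℕ) ((X : R⟦X⟧) ^ (b.1 : ℕ))).eval f * u)) := by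
    rw [PowerSeries.section, coeff_mk, Polynomial.eval_monomial, coeffRow]
  rw [h1, section_eval_mul hR hr hf hu, coeff_eval_mul_eq (hQx b) (hQd b)]
  rfl

/-- The numerator `y * E_y` represents `f` but may have degree `d` in `y`. Subtracting `d * E`,
which vanishes at `f`, removes its term in `y ^ d`. -/
theorem coeff_root_eq {h d : ℕ} {E : Polynomial R⟦X⟧} (hd : E.natDegree ≤ d) (hx : XDegLE h E)
    {f u : R⟦X⟧} (hf : E.eval f = 0) (hu : E.derivative.eval f * u = 1) (n : ℕ) :
    coeff n f = coeffRow h d f u n ⬝ᵥ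
      fun b => ((b.2 : ℕ) - d : R) * coeff (b.1 : ℕ) (E.coeff (b.2 : ℕ)) := by
  set Q : Polynomial R⟦X⟧ := Polynomial.X * E.derivative - Polynomial.C (C (d : R)) * E with hQ
  have hQc : ∀ j, Q.coeff j = C ((j : R) - d) * E.coeff j := by
    intro j
    rw [hQ, Polynomial.coeff_sub, Polynomial.coeff_C_mul]
    cases j with
    | zero => simp
    | succ j => rw [Polynomial.coeff_X_mul, Polynomial.coeff_derivative]; simp; ring
  have h1 : Q.eval f * u = f := by
    rw [hQ]
    simp only [Polynomial.eval_sub, Polynomial.eval_mul, Polynomial.eval_X, hf, mul_zero, sub_zero]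
    linear_combination f * hu
  have h2 := coeff_eval_mul_eq (h := h) (d := d) (Q := Q)
    (fun j i hi => by rw [hQc, PowerSeries.coeff_C_mul, hx j i hi, mul_zero])
    (fun j hj => by
      rw [hQc]
      rcases hj.eq_or_lt with rfl | hj
      · simp
      · rw [Polynomial.coeff_eq_zero_of_natDegree_lt (by omega), mul_zero]) f u n
  rw [h1] at h2
  rw [h2]
  congr 1
  funext b
  rw [hQc, PowerSeries.coeff_C_mul]

end Transition

/-! ### How far a nonzero `P(x, f)` can vanish at the origin -/

section Bound

open Polynomial

variable {F : Type*} [Field F]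

theorem coeff_coeff_swap {R : Type*} [CommRing R] (P : R[X][X]) (i j : ℕ) :
    ((Bivariate.swap P).coeff i).coeff j = (P.coeff j).coeff i := by
  induction P using Polynomial.induction_on' with
  | add P Q hP hQ => simp only [map_add, coeff_add, hP, hQ]
  | monomial n a =>
    induction a using Polynomial.induction_on' with
    | add a b ha hb => simp only [map_add, coeff_add, ha, hb]
    | monomial m r =>
      rw [Bivariate.swap_monomial_monomial]
      simp only [coeff_monomial]
      split_ifs <;> simp_all [coeff_monomial]

theorem natDegree_swap_le_iff {R : Type*} [CommRing R] {P : R[X][X]} {h : ℕ} :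
    (Bivariate.swap P).natDegree ≤ h ↔ ∀ j, (P.coeff j).natDegree ≤ h := by
  simp only [natDegree_le_iff_coeff_eq_zero]
  constructor
  · intro H j i hi
    rw [← coeff_coeff_swap, H i hi, coeff_zero]
  · intro H i hi
    ext1 j
    rw [coeff_coeff_swap, H j i hi, coeff_zero]

/-- After swapping the variables the degree in `x` is an ordinary degree over a domain, so a divisor
cannot exceed it. -/
theorem natDegree_coeff_le_of_dvd {P Q : F[X][X]} {h : ℕ} (hQ : Q ≠ 0) (hPQ : P ∣ Q)
    (hh : ∀ j, (Q.coeff j).natDegree ≤ h) (j : ℕ) : (P.coeff j).natDegree ≤ h := by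
  refine natDegree_swap_le_iff.1 ((natDegree_le_of_dvd ?_ ?_).trans (natDegree_swap_le_iff.2 hh)) j
  · obtain ⟨r, rfl⟩ := hPQ
    exact ⟨Bivariate.swap r, map_mul _ _ _⟩
  · simpa using hQ

theorem natDegree_det_le {R n : Type*} [CommRing R] [Fintype n] [DecidableEq n]
    (M : Matrix n n R[X]) {h : ℕ} (hM : ∀ i j, (M i j).natDegree ≤ h) :
    M.det.natDegree ≤ Fintype.card n * h := by
  rw [Matrix.det_apply]
  refine natDegree_sum_le_of_forall_le _ _ fun σ _ => ?_
  refine (natDegree_smul_le _ _).trans ((natDegree_prod_le _ _).trans ?_)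
  refine (Finset.sum_le_card_nsmul _ _ h fun i _ => hM _ _).trans ?_
  simp

theorem natDegree_resultant_le {R : Type*} [CommRing R] (P Q : R[X][X]) {h : ℕ}
    (hP : ∀ j, (P.coeff j).natDegree ≤ h) (hQ : ∀ j, (Q.coeff j).natDegree ≤ h) (m n : ℕ) :
    (resultant P Q m n).natDegree ≤ (m + n) * h := by
  refine (natDegree_det_le (h := h) _ fun i j => ?_).trans (by simp)
  induction j using Fin.addCases <;> simp only [sylvester, Matrix.of_apply, Fin.addCases_left,
    Fin.addCases_right] <;> split_ifs <;> simp [hP, hQ]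

/-- A zero resultant forces a common factor over `F(x)`; as `P` is irreducible there, it divides
`Q`, and Gauss's lemma brings this back to `F[x][y]`. -/
theorem dvd_of_resultant_eq_zero {P Q : F[X][X]} (hP : Irreducible P) (hdeg : P.natDegree ≠ 0)
    (h : resultant P Q = 0) : P ∣ Q := by
  classical
  let K := FractionRing F[X]
  have hinj := IsFractionRing.injective F[X] K
  have hprim := hP.isPrimitive hdeg
  have hPK : Irreducible (P.map (algebraMap F[X] K)) :=
    hprim.irreducible_iff_irreducible_map_fraction_map.1 hP
  have h1 : resultant (P.map (algebraMap F[X] K)) (Q.map (algebraMap F[X] K)) = 0 := by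
    rw [natDegree_map_eq_of_injective hinj, natDegree_map_eq_of_injective hinj,
      resultant_map_map, h, map_zero]
  have h2 := (resultant_eq_zero_iff.1 h1).2
  have h3 : P.map (algebraMap F[X] K) ∣ Q.map (algebraMap F[X] K) := by
    by_contra hn
    exact h2 (hPK.coprime_iff_not_dvd.2 hn)
  exact hprim.dvd_of_fraction_map_dvd_fraction_map h3

/-- `P` may share with `E` a factor that does not vanish at `f`, so `E` is first replaced by an
irreducible factor `E₁` with `E₁(x, f) = 0`. The resultant of `E₁` and `P` is a combination `a E₁ +
b P`, so at `y = f` it is divisible by `x ^ (2 * d * h + 1)`. Its degree is at most `2 * d * h`;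
hence it is zero and `E₁` divides `P`. -/
theorem eval₂_eq_zero_of_X_pow_dvd {E P : F[X][X]} {f : PowerSeries F} {h d : ℕ} (hE : E ≠ 0)
    (hEd : E.natDegree ≤ d) (hEh : ∀ j, (E.coeff j).natDegree ≤ h)
    (hf : E.eval₂ coeToPowerSeries.ringHom f = 0)
    (hPd : P.natDegree ≤ d) (hPh : ∀ j, (P.coeff j).natDegree ≤ h)
    (hP : PowerSeries.X ^ (2 * d * h + 1) ∣ P.eval₂ coeToPowerSeries.ringHom f) :
    P.eval₂ coeToPowerSeries.ringHom f = 0 := by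
  classical
  set ev := eval₂RingHom (coeToPowerSeries.ringHom (R := F)) f with hev
  obtain ⟨E₁, hE₁, hirr, hE₁f⟩ : ∃ E₁, E₁ ∣ E ∧ Irreducible E₁ ∧ ev E₁ = 0 := by
    obtain ⟨s, hs, u, hu⟩ := WfDvdMonoid.exists_factors E hE
    have h0 : ev s.prod = 0 := by
      have : ev E = 0 := hf
      rw [← hu, map_mul] at this
      exact (mul_eq_zero.1 this).resolve_right (u.isUnit.map ev).ne_zero
    rw [map_multiset_prod, Multiset.prod_eq_zero_iff, Multiset.mem_map] at h0
    obtain ⟨q, hq, hq0⟩ := h0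
    exact ⟨q, (Multiset.dvd_prod hq).trans ⟨u, hu.symm⟩, hs q hq, hq0⟩
  have hcoe : ∀ a : F[X], ev (C a) = (a : PowerSeries F) := fun a => by simp [hev]
  have hdeg : E₁.natDegree ≠ 0 := by
    intro h0
    rw [natDegree_eq_zero] at h0
    obtain ⟨a, rfl⟩ := h0
    rw [hcoe, coe_eq_zero_iff] at hE₁f
    rw [hE₁f, map_zero] at hirr
    exact hirr.ne_zero rfl
  have hdvd : E₁ ∣ P := by
    refine dvd_of_resultant_eq_zero hirr hdeg ?_
    obtain ⟨a, b, -, -, hab⟩ := exists_mul_add_mul_eq_C_resultant E₁ P le_rfl le_rfl (.inl hdeg)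
    have h1 := congrArg ev hab
    rw [map_add, map_mul, map_mul, hE₁f, zero_mul, zero_add, hcoe] at h1
    have h2 : (PowerSeries.X : PowerSeries F) ^ (2 * d * h + 1) ∣
        ((resultant E₁ P : F[X]) : PowerSeries F) := by
      rw [← h1]; exact Dvd.dvd.mul_right hP _
    have h3 : (resultant E₁ P).natDegree ≤ 2 * d * h := by
      refine (natDegree_resultant_le E₁ P (natDegree_coeff_le_of_dvd hE hE₁ hEh) hPh _ _).trans ?_
      have := natDegree_le_of_dvd hE₁ hE
      exact Nat.mul_le_mul_right _ (by omega)
    ext1 i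
    rw [coeff_zero]
    rcases lt_or_ge i (2 * d * h + 1) with hi | hi
    · have := PowerSeries.X_pow_dvd_iff.1 h2 i hi
      rwa [coeff_coe] at this
    · exact coeff_eq_zero_of_natDegree_lt (by omega)
  obtain ⟨r, rfl⟩ := hdvd
  have : ev (E₁ * r) = 0 := by rw [map_mul, hE₁f, zero_mul]
  exact this

end Bound

/-! ### Finitely many rows span all rows -/

section Span

open Matrix

variable {F : Type*} [Field F]

/-- The first `2 * d * h + 1` rows span all of them. -/
theorem coeffRow_mem_rowSpan {h d : ℕ} {E : Polynomial (Polynomial F)} (hE : E ≠ 0)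
    (hEd : E.natDegree ≤ d) (hEh : ∀ j, (E.coeff j).natDegree ≤ h) {f u v : PowerSeries F}
    (hf : E.eval₂ Polynomial.coeToPowerSeries.ringHom f = 0) (hu : v * u = 1) (n : ℕ) :
    ∃ c : Fin (2 * d * h + 1) → F,
      coeffRow h d f u n = c ᵥ* Matrix.of fun t : Fin (2 * d * h + 1) => coeffRow h d f u t := by
  classical
  let L : ℕ → (Exponents h d → F) →ₗ[F] F := fun n => dotProductBilin F F (coeffRow h d f u n)
  have hL : ∀ n a, L n a = coeffRow h d f u n ⬝ᵥ a := fun n a => rfl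
  let P : (Exponents h d → F) → Polynomial (Polynomial F) := fun a =>
    ∑ b, Polynomial.monomial (b.2 : ℕ) (Polynomial.monomial (b.1 : ℕ) (a b))
  have hPL : ∀ n a, L n a =
      PowerSeries.coeff n ((P a).eval₂ Polynomial.coeToPowerSeries.ringHom f * u) := by
    intro n a
    rw [hL, Polynomial.eval₂_finsetSum, Finset.sum_mul, map_sum]
    refine Finset.sum_congr rfl fun b _ => ?_
    rw [Polynomial.eval₂_monomial, Polynomial.coeToPowerSeries.ringHom_apply,
      Polynomial.coe_monomial, PowerSeries.monomial_eq_C_mul_X_pow, coeffRow]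
    simp only [mul_assoc]
    rw [PowerSeries.coeff_C_mul, mul_comm]
  have hspan : L n ∈ Submodule.span F (Set.range fun t : Fin (2 * d * h + 1) => L t) := by
    -- By duality it suffices that a numerator killed by the first `2 * d * h + 1` rows is killed by
    -- row `n`. The unit `u` is stripped off by multiplying with `v`.
    refine mem_span_of_iInf_ker_le_ker fun a ha => ?_
    simp only [Submodule.mem_iInf, LinearMap.mem_ker] at ha
    have h1 : PowerSeries.X ^ (2 * d * h + 1) ∣
        (P a).eval₂ Polynomial.coeToPowerSeries.ringHom f * u := by
      rw [PowerSeries.X_pow_dvd_iff]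
      intro m hm
      rw [← hPL]; exact ha ⟨m, hm⟩
    have h2 : (P a).eval₂ Polynomial.coeToPowerSeries.ringHom f = 0 := by
      refine eval₂_eq_zero_of_X_pow_dvd hE hEd hEh hf ?_ ?_ ?_
      · refine Polynomial.natDegree_sum_le_of_forall_le _ _ fun b _ => ?_
        exact (Polynomial.natDegree_monomial_le _).trans b.2.2.le
      · intro j
        rw [Polynomial.finsetSum_coeff]
        refine Polynomial.natDegree_sum_le_of_forall_le _ _ fun b _ => ?_
        rw [Polynomial.coeff_monomial]
        split_ifs
        · exact (Polynomial.natDegree_monomial_le _).trans (by have := b.1.2; omega)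
        · simp
      · have := h1.mul_right v
        rwa [mul_assoc _ u v, mul_comm u v, hu, mul_one] at this
    rw [LinearMap.mem_ker, hPL, h2, zero_mul, map_zero]
  obtain ⟨c, hc⟩ := (Submodule.mem_span_range_iff_exists_fun F).1 hspan
  refine ⟨c, ?_⟩
  funext b
  have := congrArg (fun l => l (Pi.single b 1)) hc
  simp only [LinearMap.sum_apply, LinearMap.smul_apply, hL, dotProduct_single_one, smul_eq_mul]
    at this
  rw [← this]
  rfl

end Span

/-! ### The algorithm and its cost -/

section Algorithm

open PowerSeries Matrix

variable {R : Type*} [CommRing R]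

/-- The number of operations of the algorithm: `c` bounds a multiplication to precision `p * T`,
`D` is the dimension of the space of numerators, `p * T ≤ 2 ^ l` and `N < p ^ k`. -/
def algorithmCost (p d c T D l k : ℕ) : ℕ :=
  l * ((2 * d + 3) * (c + p * T)) + d * (p * T) + d * c + D * (T * (2 * p + 5 + 10 * D)) +
    p * (D * D * (T * 2)) + k * (D * (D * 2)) + D * 4

theorem RingReach.coeff_root {p : ℕ} [Fact p.Prime] [CharP R p] (hR : ∀ a : R, a ^ p = a)
    {h d T c l : ℕ} (hT : T ≠ 0) {E : Polynomial R⟦X⟧} (hd : E.natDegree ≤ d) (hx : XDegLE h E)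
    {f u : R⟦X⟧} (hf : E.eval f = 0) (hu : E.derivative.eval f * u = 1)
    (hspan : ∀ n, ∃ c : Fin T → R,
      coeffRow h d f u n = c ᵥ* Matrix.of fun t : Fin T => coeffRow h d f u t)
    (hc : TruncMulCost R (p * T) c) {K : Set R} (hK : ∀ c : ℕ, (c : R) ∈ K)
    (hE : ∀ j i, coeff i (E.coeff j) ∈ K)
    (hnewton : RingReach (l * ((2 * d + 3) * (c + p * T)) + d * (p * T)) K
      (coeffsLT (p * T) f ∪ coeffsLT (p * T) u)) {N k : ℕ} (hN : N < p ^ k) :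
    RingReach (algorithmCost p d c T (Fintype.card (Exponents h d)) l k) K {coeff N f} := by
  have hp := (Fact.out : p.Prime)
  have hK0 : (0 : R) ∈ K := by simpa using hK 0
  set D := Fintype.card (Exponents h d) with hD
  -- the powers of the root
  set K1 := K ∪ (coeffsLT (p * T) f ∪ coeffsLT (p * T) u) with hK1
  have hpow : ∀ m, RingReach (m * c) K1 (⋃ j ∈ Finset.range (m + 1), coeffsLT (p * T) (f ^ j * u)) := by
    intro m
    induction m with
    | zero =>
      refine .done ?_
      simp only [zero_add, Finset.range_one, Finset.mem_singleton, Set.iUnion_iUnion_eq_left,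
        pow_zero, one_mul]
      exact fun x hx => .inr (.inr hx)
    | succ m ih =>
      have h1 := ih.trans ((hc _ f (f ^ m * u) (fun c => .inl (.inl (hK c)))
        (fun x hx => .inl (.inr (.inl hx)))
        (fun x hx => .inr (Set.mem_biUnion (x := m) (by simp) hx))).union_self)
      rw [Nat.succ_mul]
      refine h1.mono_target ?_
      rw [Finset.range_add_one, Finset.set_biUnion_insert, pow_succ', mul_assoc]
      rintro x (hx | hx)
      · exact .inr hx
      · exact .inl (.inr hx)
  set K2 := K1 ∪ ⋃ j ∈ Finset.range (d + 1), coeffsLT (p * T) (f ^ j * u) with hK2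
  have hKK2 : K ⊆ K2 := fun x hx => .inl (.inl hx)
  have hrow : ∀ n < p * T, ∀ b, coeffRow h d f u n b ∈ K2 := by
    intro n hn b
    rw [coeffRow, mul_assoc, PowerSeries.coeff_X_pow_mul']
    split_ifs with hb
    · refine .inr (Set.mem_biUnion (x := (b.2 : ℕ)) (by simp) ?_)
      exact coeffsLT_subset.1 le_rfl _ (by omega)
    · exact hKK2 hK0
  have hTp : T ≤ p * T := Nat.le_mul_of_pos_left _ hp.pos
  -- the generalized inverse
  set B : Matrix (Fin T) (Exponents h d) R := Matrix.of fun t => coeffRow h d f u t with hB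
  obtain ⟨G, hG, hGr⟩ := exists_generalizedInverse hp.two_le hR (Finset.univ) K2 B
    (fun c => hKK2 (hK c)) (fun t b => hrow t (t.2.trans_le hTp) b) (by simp)
  rw [Finset.card_univ, ← hD] at hGr
  set K3 := K2 ∪ G.entries with hK3
  -- the transition matrices
  set Br : ℕ → Matrix (Fin T) (Exponents h d) R := fun r =>
    Matrix.of fun t => coeffRow h d f u (p * t + r) with hBr
  have hlt : ∀ r < p, ∀ t : Fin T, p * t + r < p * T := fun r hr t => by
    have : p * (t + 1) ≤ p * T := Nat.mul_le_mul_left _ t.2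
    rw [mul_add] at this; omega
  have htr : RingReach (p * (D * D * (T * 2))) K3 (⋃ r ∈ Finset.range p, (G * Br r).entries) := by
    have := RingReach.biUnion_const (S := K3) (Finset.range p) (c := D * D * (T * 2))
      (T := fun r => (G * Br r).entries) fun r hr => by
        have := RingReach.matrix_mul (A := G) (B := Br r) (K := K3) (.inl (hKK2 hK0))
          (fun b t => .inr ⟨(b, t), rfl⟩)
          (fun t b => .inl (hrow _ (hlt r (Finset.mem_range.1 hr) t) b))
        rwa [Fintype.card_fin, ← hD] at this
    simpa using this
  set K4 := K3 ∪ ⋃ r ∈ Finset.range p, (G * Br r).entries with hK4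
  have hstep : ∀ n, ∀ r < p, coeffRow h d f u (p * n + r) =
      coeffRow h d f u n ᵥ* (G * Br r) := by
    intro n r hr
    -- If `ρ(n) = a B`, then `ρ(p * n + r) = a B L = a B G B L = ρ(n) G B_r`. The matrices `G * Br
    -- r` and `L` need not be equal; they only agree on the row space.
    obtain ⟨L, hL⟩ := exists_transition hR hd hx hf hu hr
    obtain ⟨a, ha⟩ := hspan n
    have hBL : Br r = B * L := by
      ext t b
      exact congrFun (hL t) b
    rw [hL, hBL, ha, vecMul_vecMul, vecMul_vecMul]
    rw [← Matrix.mul_assoc, ← Matrix.mul_assoc, hG]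
  -- The digits in base `p` are consumed from the most significant one, starting at row `0`, and
  -- each costs one vector-matrix product.
  have hdig : ∀ k n, n < p ^ k → RingReach (k * (D * (D * 2))) K4 (Set.range (coeffRow h d f u n)) := by
    intro k
    induction k with
    | zero =>
      intro n hn
      obtain rfl : n = 0 := by simpa using hn
      refine .done ?_
      rintro _ ⟨b, rfl⟩
      exact .inl (.inl (hrow 0 (Nat.mul_pos hp.pos (by omega)) b))
    | succ k ih =>
      intro n hn
      have h1 := ih (n / p) (Nat.div_lt_of_lt_mul (by rwa [← pow_succ']))
      have hr : n % p < p := Nat.mod_lt _ hp.pos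
      have h2 := hstep (n / p) (n % p) hr
      rw [Nat.div_add_mod] at h2
      rw [h2, Nat.succ_mul]
      refine h1.trans ?_
      refine RingReach.vecMul (.inl (.inl (.inl (hKK2 hK0)))) (fun b => .inr ⟨b, rfl⟩)
        fun b b' => .inl (.inr (Set.mem_biUnion (x := n % p) (by simpa using hr) ⟨(b, b'), rfl⟩))
  -- the final scalar product
  set K5 := K4 ∪ Set.range (coeffRow h d f u N) with hK5
  have hKK5 : K ⊆ K5 := fun x hx => .inl (.inl (.inl (hKK2 hx)))
  have hini : RingReach (D * 2) K5 (Set.range fun b : Exponents h d =>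
      ((b.2 : ℕ) - d : R) * coeff (b.1 : ℕ) (E.coeff (b.2 : ℕ))) :=
    .range fun b => .mul_of (n := 1) (m := 0) (.sub (hKK5 (hK _)) (hKK5 (hK _)))
      (.mem (hKK5 (hE _ _)))
  have hfin := hini.trans (RingReach.dotProduct (v := coeffRow h d f u N) (.inl (hKK5 hK0))
    (fun b => .inl (.inr ⟨b, rfl⟩)) (fun b => .inr ⟨b, rfl⟩))
  rw [← coeff_root_eq hd hx hf hu N] at hfin
  have := hnewton.trans ((hpow d).trans (hGr.trans (htr.trans ((hdig k N hN).trans hfin))))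
  refine this.mono_cost ?_
  rw [algorithmCost, ← hD]
  omega

end Algorithm

/-! ### From ring computations to straight-line programs -/

section Program

variable {F : Type*} [Field F]

theorem Operand.value_append {e : ℕ → ℕ → F} {mem : List F} {o : Operand} {x : F}
    (h : o.value e mem = some x) (l : List F) : o.value e (mem ++ l) = some x := by
  cases o with
  | coeff i j => exact h
  | const c => exact h
  | result k =>
    simp only [Operand.value] at h ⊢
    have hk : k < mem.length := by
      by_contra hk
      rw [List.getElem?_eq_none (by omega)] at h
      exact absurd h (by simp)
    rw [List.getElem?_append_left hk, h]

variable [DecidableEq F]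

/-- A computation in the ring of functions of the input gives a straight-line program. -/
theorem RingReach.exists_steps {ι : Type*} (e : ι → ℕ → ℕ → F) {n : ℕ} {S T : Set (ι → F)}
    (h : RingReach n S T) : ∀ mem : List (ι → F),
      (∀ x ∈ S, ∃ o : Operand, ∀ i, o.value (e i) (mem.map (· i)) = some (x i)) →
      ∃ (steps : List ArithStep) (mem' : List (ι → F)), steps.length ≤ n ∧
        (∀ i, ArithProgram.run (e i) steps (mem.map (· i)) = some (mem'.map (· i))) ∧
        ∀ x ∈ T, ∃ o : Operand, ∀ i, o.value (e i) (mem'.map (· i)) = some (x i) := by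
  induction h with
  | done h => exact fun mem hmem => ⟨[], mem, by simp, fun i => rfl, fun x hx => hmem x (h hx)⟩
  | @next n S T x hx _ ih =>
    intro mem hmem
    obtain ⟨op, oa, ob, hop⟩ : ∃ (op : ArithOp) (oa ob : Operand), ∀ i, ∃ a b,
        oa.value (e i) (mem.map (· i)) = some a ∧ ob.value (e i) (mem.map (· i)) = some b ∧
        op.apply a b = some (x i) := by
      obtain ⟨a, ha, b, hb, hx⟩ := hx
      obtain ⟨oa, hoa⟩ := hmem a ha
      obtain ⟨ob, hob⟩ := hmem b hb
      rcases hx with rfl | rfl | rfl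
      · exact ⟨.add, oa, ob, fun i => ⟨a i, b i, hoa i, hob i, rfl⟩⟩
      · exact ⟨.sub, oa, ob, fun i => ⟨a i, b i, hoa i, hob i, rfl⟩⟩
      · exact ⟨.mul, oa, ob, fun i => ⟨a i, b i, hoa i, hob i, rfl⟩⟩
    obtain ⟨steps, mem', hlen, hrun, hT⟩ := ih (mem ++ [x]) (by
      intro y hy
      rcases hy with rfl | hy
      · exact ⟨.result mem.length, fun i => by simp [Operand.value]⟩
      · obtain ⟨o, ho⟩ := hmem y hy
        exact ⟨o, fun i => by rw [List.map_append]; exact Operand.value_append (ho i) _⟩)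
    refine ⟨⟨op, oa, ob⟩ :: steps, mem', by simpa using hlen, fun i => ?_, hT⟩
    obtain ⟨a, b, ha, hb, hab⟩ := hop i
    rw [ArithProgram.run]
    simp only [ha, hb, hab, Option.bind_some]
    simpa using hrun i

/-- The index `t` ranges over all inputs at once, so the program obtained does not depend on the
input. -/
theorem RingReach.exists_program {ι : Type*} (e : ι → ℕ → ℕ → F) {n : ℕ} {S : Set (ι → F)}
    {x : ι → F} (h : RingReach n S {x})
    (hS : ∀ y ∈ S, (∃ c : ℕ, y = c) ∨ ∃ i j, y = fun t => e t i j) :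
    ∃ P : ArithProgram, P.cost ≤ n ∧ ∀ t, P.eval (e t) = some (x t) := by
  obtain ⟨steps, mem, hlen, hrun, hT⟩ := h.exists_steps e [] (by
    intro y hy
    rcases hS y hy with ⟨c, rfl⟩ | ⟨i, j, rfl⟩
    · exact ⟨.const c, fun t => rfl⟩
    · exact ⟨.coeff i j, fun t => rfl⟩)
  obtain ⟨o, ho⟩ := hT x rfl
  refine ⟨⟨steps, o⟩, hlen, fun t => ?_⟩
  have := hrun t
  simp only [List.map_nil] at this
  simp only [ArithProgram.eval, this, Option.bind_some, ho]

end Program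

/-! ### A program for each choice of `p`, `h`, `d`, `N` -/

section Existence

open PowerSeries

/-- The polynomials of the given degrees with a simple root at the origin. -/
structure IsAdmissible {F : Type*} [Field F] (h d : ℕ) (E : Polynomial (Polynomial F)) : Prop where
  natDegree_le : E.natDegree ≤ d
  natDegree_coeff_le : ∀ j, (E.coeff j).natDegree ≤ h
  evalEval_eq_zero : E.evalEval 0 0 = 0
  evalEval_derivative_ne_zero : (Polynomial.derivative E).evalEval 0 0 ≠ 0

theorem evalEval_zero_zero {F : Type*} [Field F] (E : Polynomial (Polynomial F)) :
    E.evalEval 0 0 = (E.coeff 0).coeff 0 := by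
  rw [Polynomial.evalEval, Polynomial.C_0, ← Polynomial.coeff_zero_eq_eval_zero,
    ← Polynomial.coeff_zero_eq_eval_zero]

theorem IsAdmissible.coeff_one_ne_zero {F : Type*} [Field F] {h d : ℕ}
    {E : Polynomial (Polynomial F)} (hE : IsAdmissible h d E) : (E.coeff 1).coeff 0 ≠ 0 := by
  have := hE.evalEval_derivative_ne_zero
  rw [evalEval_zero_zero, Polynomial.coeff_derivative] at this
  simpa using this

theorem IsRootAtOrigin.unique {F : Type*} [Field F] {h d : ℕ} {E : Polynomial (Polynomial F)}
    (hE : IsAdmissible h d E) {f g : F⟦X⟧} (hf : IsRootAtOrigin E f) (hg : IsRootAtOrigin E g) :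
    g = f := by
  refine eq_of_eval_eq_zero (E := E.map Polynomial.coeToPowerSeries.ringHom) ?_ ?_ ?_ hg.2 hf.2
  · rw [Polynomial.coeff_map, isUnit_iff_ne_zero]
    simpa using hE.coeff_one_ne_zero
  · rw [Polynomial.eval_map]; exact hg.1
  · rw [Polynomial.eval_map]; exact hf.1

theorem exists_program_coeff_root {p : ℕ} [Fact p.Prime] (h d N : ℕ) {k l : ℕ} (hN : N < p ^ k)
    (hl : p * (2 * d * h + 1) ≤ 2 ^ l) :
    ∃ P : ArithProgram, P.cost ≤ p + algorithmCost p d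
        (3200 * (p * (2 * d * h + 1) ^ 2) * (Nat.log 2 (p * (2 * d * h + 1)) + 3) ^ 2)
        (2 * d * h + 1) ((h + 1) * d) l k ∧
      ∀ E : Polynomial (Polynomial (ZMod p)), IsAdmissible h d E →
        ∃ f : (ZMod p)⟦X⟧, IsRootAtOrigin E f ∧
          P.eval (fun i j => (E.coeff j).coeff i) = some (PowerSeries.coeff N f) := by
  classical
  set T := 2 * d * h + 1 with hT
  have hp := (Fact.out : p.Prime)
  let ι := {E : Polynomial (Polynomial (ZMod p)) // IsAdmissible h d E}
  -- If no polynomial is admissible, the ring of functions is trivial and does not have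
  -- characteristic `p`.
  rcases isEmpty_or_nonempty ι with hι | hι
  · exact ⟨⟨[], .const 0⟩, by simp [ArithProgram.cost], fun E hE => (hι.false ⟨E, hE⟩).elim⟩
  let R := ι → ZMod p
  have : CharP R p := inferInstance
  have hR : ∀ a : R, a ^ p = a := fun a => by funext t; exact ZMod.pow_card (a t)
  let co : ℕ → ℕ → R := fun i j t => (t.1.coeff j).coeff i
  let E : Polynomial R⟦X⟧ := ∑ j ∈ Finset.range (d + 1),
    Polynomial.monomial j (PowerSeries.mk fun i => co i j)
  have hEc : ∀ j, E.coeff j = PowerSeries.mk fun i => co i j := by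
    intro j
    simp only [E, Polynomial.finsetSum_coeff, Polynomial.coeff_monomial]
    rw [Finset.sum_ite_eq']
    split_ifs with hj
    · rfl
    · rw [Finset.mem_range, not_lt] at hj
      ext i t
      rw [coeff_mk]
      change 0 = (t.1.coeff j).coeff i
      rw [Polynomial.coeff_eq_zero_of_natDegree_lt (n := j)
        (by have := t.2.natDegree_le; omega), Polynomial.coeff_zero]
  have hEd : E.natDegree ≤ d := Polynomial.natDegree_sum_le_of_forall_le _ _ fun j hj =>
    (Polynomial.natDegree_monomial_le _).trans (by rw [Finset.mem_range] at hj; omega)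
  have hEx : XDegLE h E := by
    intro j i hi
    rw [hEc, coeff_mk]
    funext t
    exact Polynomial.coeff_eq_zero_of_natDegree_lt
      (lt_of_le_of_lt (t.2.natDegree_coeff_le j) hi)
  -- The inverse of `E_y(0, 0)` as a power, by Fermat; its computation is the summand `p` of the
  -- cost.
  set w : R := co 0 1 ^ (p - 2) with hw
  have hw1 : constantCoeff (E.coeff 1) * w = 1 := by
    rw [hEc, ← coeff_zero_eq_constantCoeff_apply, coeff_mk, hw, ← pow_succ']
    funext t
    have h2 := hp.two_le
    rw [show p - 2 + 1 = p - 1 by omega]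
    exact ZMod.pow_card_sub_one_eq_one t.2.coeff_one_ne_zero
  have hE0 : constantCoeff (E.coeff 0) = 0 := by
    rw [hEc, ← coeff_zero_eq_constantCoeff_apply, coeff_mk]
    funext t
    exact (evalEval_zero_zero t.1).symm.trans t.2.evalEval_eq_zero
  obtain ⟨f, u, hf0, hf, hu, hnewton⟩ := exists_root_reach E hEd hE0 hw1
  -- specialization
  let φ : ι → R →+* ZMod p := fun t => Pi.evalRingHom _ t
  have hmap : ∀ t : ι, E.map (PowerSeries.map (φ t)) =
      t.1.map Polynomial.coeToPowerSeries.ringHom := by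
    intro t
    ext j i
    rw [Polynomial.coeff_map, Polynomial.coeff_map, hEc, PowerSeries.coeff_map, coeff_mk,
      Polynomial.coeToPowerSeries.ringHom_apply, Polynomial.coeff_coe]
    rfl
  have hroot : ∀ t : ι,
      t.1.eval₂ Polynomial.coeToPowerSeries.ringHom (PowerSeries.map (φ t) f) = 0 := by
    intro t
    rw [← Polynomial.eval_map, ← hmap, Polynomial.eval_map, Polynomial.eval₂_at_apply, hf, map_zero]
  have hspan : ∀ n, ∃ c : Fin T → R, coeffRow h d f u n =
      Matrix.vecMul c (Matrix.of fun t : Fin T => coeffRow h d f u t) := by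
    intro n
    have hrow : ∀ (t : ι) n b, (coeffRow h d f u n b) t =
        coeffRow h d (PowerSeries.map (φ t) f) (PowerSeries.map (φ t) u) n b := by
      intro t n b
      have : coeffRow h d (PowerSeries.map (φ t) f) (PowerSeries.map (φ t) u) n b =
          φ t (coeffRow h d f u n b) := by
        simp only [coeffRow]
        rw [← PowerSeries.coeff_map]
        simp only [map_mul, map_pow, PowerSeries.map_X]
      rw [this]; rfl
    -- The resultant argument needs a field, so the row is expanded separately for each input. The
    -- coefficients assemble into elements of `R`, and they are never computed.
    have hpt : ∀ t : ι, ∃ c : Fin T → ZMod p, ∀ b, (coeffRow h d f u n b) t =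
        ∑ s, c s * (coeffRow h d f u s b) t := by
      intro t
      have hu' : PowerSeries.map (φ t) (E.derivative.eval f) * PowerSeries.map (φ t) u = 1 := by
        rw [← map_mul, hu, map_one]
      have hne : t.1 ≠ 0 := by
        intro h0
        have := t.2.coeff_one_ne_zero
        rw [h0] at this
        simp at this
      obtain ⟨c, hc⟩ := coeffRow_mem_rowSpan hne t.2.natDegree_le t.2.natDegree_coeff_le
        (hroot t) hu' n
      refine ⟨c, fun b => ?_⟩
      rw [hrow, hc]
      simp only [hrow]
      rfl
    choose c hc using hpt
    refine ⟨fun s t => c t s, ?_⟩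
    funext b t
    rw [hc]
    simp only [Matrix.vecMul, dotProduct, Matrix.of_apply]
    exact (Finset.sum_apply (M := fun _ : ι => ZMod p) t Finset.univ
      fun s : Fin T => (fun t => c t s) * coeffRow h d f u s b).symm
  set K0 : Set R := Set.range (fun c : ℕ => (c : R)) ∪ Set.range fun q : ℕ × ℕ => co q.1 q.2
    with hK0
  have hwr : RingReach p K0 {w} :=
    (RingReach.pow (.inl ⟨1, Nat.cast_one⟩) (.inr ⟨(0, 1), rfl⟩) (p - 2)).mono_cost (by omega)
  set K := K0 ∪ {w} with hK
  have hKc : ∀ c : ℕ, (c : R) ∈ K := fun c => .inl (.inl ⟨c, rfl⟩)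
  have hKE : ∀ j i, coeff i (E.coeff j) ∈ K := fun j i => by
    rw [hEc, coeff_mk]
    exact .inl (.inr ⟨(i, j), rfl⟩)
  have hc := truncMulCost_charP (R := R) (p := p) (T := T) (by omega)
  have hmain := RingReach.coeff_root hR (T := T) (by omega) hEd hEx hf hu hspan hc hKc hKE
    (hnewton hc hl hKc (.inr rfl) fun j => coeffsLT_subset.2 fun i _ => hKE j i) hN
  obtain ⟨P, hPc, hP⟩ := (hwr.trans hmain).exists_program
    (fun (t : ι) i j => (t.1.coeff j).coeff i) (by
      rintro y (⟨c, rfl⟩ | ⟨q, rfl⟩)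
      · exact .inl ⟨c, rfl⟩
      · exact .inr ⟨q.1, q.2, rfl⟩)
  refine ⟨P, ?_, fun E' hE' => ⟨PowerSeries.map (φ ⟨E', hE'⟩) f, ⟨hroot ⟨E', hE'⟩, ?_⟩, ?_⟩⟩
  · simpa [Fintype.card_prod] using hPc
  · rw [← coeff_zero_eq_constantCoeff_apply, PowerSeries.coeff_map,
      coeff_zero_eq_constantCoeff_apply, hf0, map_zero]
  · rw [hP ⟨E', hE'⟩, PowerSeries.coeff_map]
    rfl

end Existence

/-! ### Primitive recursive predicates and unbounded search -/

section Computability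

namespace Primrec

variable {α : Type*} [Primcodable α]

theorem nat_add_comp {f g : α → ℕ} (hf : Primrec f) (hg : Primrec g) : Primrec fun a => f a + g a :=
  nat_add.comp hf hg

theorem nat_mul_comp {f g : α → ℕ} (hf : Primrec f) (hg : Primrec g) : Primrec fun a => f a * g a :=
  nat_mul.comp hf hg

theorem nat_pow_comp {f g : α → ℕ} (hf : Primrec f) (hg : Primrec g) : Primrec fun a => f a ^ g a :=
  (Primrec₂.unpaired'.1 Nat.Primrec.pow : Primrec₂ fun m n : ℕ => m ^ n).comp hf hg

theorem nat_log_two_comp {f : α → ℕ} (hf : Primrec f) : Primrec fun a => Nat.log 2 (f a) := by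
  have h : PrimrecRel fun (a : α) (k : ℕ) => 2 ^ k ≤ f a :=
    nat_le.comp₂ ((nat_pow_comp (const 2) snd).to₂) (hf.comp fst).to₂
  refine (nat_findGreatest hf h).of_eq fun a => ?_
  rcases Nat.eq_zero_or_pos (f a) with h0 | h0
  · simp [h0]
  · refine Nat.findGreatest_eq_iff.2 ⟨Nat.log_le_self _ _, fun _ => Nat.pow_log_le_self _ h0.ne',
      fun _ hk _ hle => ?_⟩
    exact absurd (Nat.le_log_of_pow_le one_lt_two hle) (by omega)

theorem nat_sum_range_comp {f : α → ℕ → ℕ} {n : α → ℕ} (hf : Primrec₂ f) (hn : Primrec n) :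
    Primrec fun a => ∑ i ∈ Finset.range (n a), f a i := by
  refine (nat_rec' hn (const 0) (h := fun a q => q.2 + f a q.1) ?_).of_eq fun a => ?_
  · exact (nat_add_comp (snd.comp snd) (hf.comp fst (fst.comp snd))).to₂
  · induction n a with
    | zero => rfl
    | succ m ih => rw [Finset.sum_range_succ, ← ih]

end Primrec

theorem PrimrecRel.forall_lt_comp {α : Type*} [Primcodable α] {R : ℕ → α → Prop} {n : α → ℕ}
    (hR : PrimrecRel R) (hn : Primrec n) : PrimrecPred fun a => ∀ i < n a, R i a :=
  (hR.forall_mem_list.comp (Primrec.list_range.comp hn) .id).of_eq fun a => by simp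

theorem PrimrecPred.natPrime {α : Type*} [Primcodable α] {f : α → ℕ} (hf : Primrec f) :
    PrimrecPred fun a => (f a).Prime := by
  have h : PrimrecRel fun (m : ℕ) (a : α) => ¬ f a % m = 0 ∨ m = 1 :=
    (Primrec.eq.comp (Primrec.nat_mod.comp (hf.comp .snd) .fst) (.const 0)).not.or
      (Primrec.eq.comp .fst (.const 1))
  refine ((Primrec.nat_le.comp (.const 2) hf).and (h.forall_lt_comp hf)).of_eq fun a => ?_
  rw [Nat.prime_def_lt]
  simp only [Nat.dvd_iff_mod_eq_zero, imp_iff_not_or]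

/-- Unbounded search for an element with a primitive recursive property. -/
theorem exists_computable_of_primrecRel {α β : Type*} [Primcodable α] [Primcodable β]
    {R : α → β → Prop} (hR : PrimrecRel R) (h : ∀ a, ∃ b, R a b) :
    ∃ f : α → β, Computable f ∧ ∀ a, R a (f a) := by
  classical
  choose f₀ hf₀ using h
  let g : α → ℕ → Option β := fun a n =>
    (Encodable.decode (α := β) n).bind fun b => if R a b then some b else none
  have hg : Primrec₂ g :=
    Primrec.option_bind (Primrec.decode.comp .snd)
      (Primrec.ite (hR.comp (Primrec.fst.comp .fst) .snd) (Primrec.option_some.comp .snd)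
        (.const none)).to₂
  have hdom : ∀ a, (Nat.rfindOpt (g a)).Dom := fun a =>
    Nat.rfindOpt_dom.2 ⟨Encodable.encode (f₀ a), f₀ a, by simp [g, hf₀ a]⟩
  refine ⟨fun a => (Nat.rfindOpt (g a)).get (hdom a), ?_, fun a => ?_⟩
  · exact (Partrec.rfindOpt hg.to_comp).of_eq fun a => (Part.some_get (hdom a)).symm
  · obtain ⟨n, hn⟩ := Nat.rfindOpt_spec (Part.get_mem (hdom a))
    simp only [g, Option.mem_def, Option.bind_eq_some_iff] at hn
    obtain ⟨b, -, hb⟩ := hn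
    split_ifs at hb with hab
    · have e : b = (Nat.rfindOpt (g a)).get (hdom a) := Option.some_inj.1 hb
      change R a ((Nat.rfindOpt (g a)).get (hdom a))
      rwa [← e]

end Computability

/-! ### Evaluating programs on representatives of residues -/

section NaturalArithmetic

/-- The operations of `ZMod p` on natural numbers that represent residues modulo a prime `p`. -/
def ArithOp.natApply (p : ℕ) : ArithOp → ℕ → ℕ → Option ℕ
  | add, a, b => some (a + b)
  | sub, a, b => some (a + (p - 1) * b)
  | mul, a, b => some (a * b)
  | div, a, b => if b % p = 0 then none else some (a * b ^ (p - 2))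

def Operand.natValue (e : ℕ → ℕ → ℕ) (mem : List ℕ) : Operand → Option ℕ
  | coeff i j => some (e i j)
  | const c => some c
  | result k => mem[k]?

def ArithStep.natRun (p : ℕ) (e : ℕ → ℕ → ℕ) (s : ArithStep) (mem : List ℕ) : Option (List ℕ) :=
  (s.left.natValue e mem).bind fun a =>
    (s.right.natValue e mem).bind fun b => (s.op.natApply p a b).map fun c => mem ++ [c]

/-- The evaluation of a program on natural numbers that represent residues modulo a prime `p`. -/
def ArithProgram.natEval (p : ℕ) (e : ℕ → ℕ → ℕ) (P : ArithProgram) : Option ℕ :=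
  (P.steps.foldl (fun mem s => mem.bind (s.natRun p e)) (some [])).bind fun mem =>
    P.output.natValue e mem

variable {p : ℕ} [Fact p.Prime]

/-- Modulo `p`, negation is multiplication by `p - 1`, and inversion is the power `p - 2`. -/
theorem ArithOp.apply_natCast (o : ArithOp) (a b : ℕ) :
    o.apply (a : ZMod p) b = (o.natApply p a b).map (↑) := by
  have hp := (Fact.out : p.Prime)
  cases o with
  | add => simp [apply, natApply]
  | sub =>
    simp only [apply, natApply, Option.map_some, Nat.cast_add, Nat.cast_mul,
      Nat.cast_pred hp.pos, CharP.cast_eq_zero]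
    congr 1; ring
  | mul => simp [apply, natApply]
  | div =>
    have hb : (b : ZMod p) = 0 ↔ b % p = 0 := by
      rw [ZMod.natCast_eq_zero_iff, Nat.dvd_iff_mod_eq_zero]
    simp only [apply, natApply, hb]
    split_ifs with h
    · rfl
    · rw [← hb] at h
      simp only [Option.map_some, Nat.cast_mul, Nat.cast_pow]
      rw [div_eq_mul_inv, inv_eq_of_mul_eq_one_left (a := (b : ZMod p) ^ (p - 2))]
      rw [← pow_succ, show p - 2 + 1 = p - 1 by have := hp.two_le; omega,
        ZMod.pow_card_sub_one_eq_one h]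

theorem Operand.value_natCast (e : ℕ → ℕ → ℕ) (mem : List ℕ) (o : Operand) :
    o.value (fun i j => (e i j : ZMod p)) (mem.map (↑)) = (o.natValue e mem).map (↑) := by
  cases o <;> simp [value, natValue]

theorem ArithProgram.run_natCast (e : ℕ → ℕ → ℕ) (l : List ArithStep) : ∀ mem : List ℕ,
    run (fun i j => (e i j : ZMod p)) l (mem.map (↑)) =
      (l.foldl (fun mem s => mem.bind (s.natRun p e)) (some mem)).map (List.map (↑)) := by
  have hnone : ∀ l : List ArithStep,
      l.foldl (fun mem s => mem.bind (s.natRun p e)) none = none := fun l => by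
    induction l with
    | nil => rfl
    | cons s l ih => simpa using ih
  induction l with
  | nil => exact fun mem => rfl
  | cons s l ih =>
    intro mem
    rw [run, List.foldl_cons, Option.bind_some, ArithStep.natRun, Operand.value_natCast,
      Operand.value_natCast]
    cases s.left.natValue e mem with
    | none => simp [hnone]
    | some a =>
      cases s.right.natValue e mem with
      | none => simp [hnone]
      | some b =>
        simp only [Option.map_some, Option.bind_some, ArithOp.apply_natCast]
        cases s.op.natApply p a b with
        | none => simp [hnone]
        | some c => simpa using ih (mem ++ [c])

theorem ArithProgram.eval_natCast (e : ℕ → ℕ → ℕ) (P : ArithProgram) :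
    P.eval (fun i j => (e i j : ZMod p)) = (P.natEval p e).map (↑) := by
  have h := run_natCast (p := p) e P.steps []
  rw [List.map_nil] at h
  rw [eval, h, natEval]
  cases P.steps.foldl (fun mem s => mem.bind (s.natRun p e)) (some []) with
  | none => rfl
  | some mem => simp [Operand.value_natCast]

end NaturalArithmetic

/-! ### The evaluation of programs is primitive recursive -/

section PrimrecEval

open Primrec

variable {α : Type*} [Primcodable α]

theorem ArithOp.primrec_natApply {p a b : α → ℕ} {o : α → ArithOp} (hp : Primrec p)
    (ho : Primrec o) (ha : Primrec a) (hb : Primrec b) :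
    Primrec fun x => (o x).natApply (p x) (a x) (b x) := by
  have hn : Primrec fun x => (equivFin (o x) : ℕ) := fin_val.comp ((of_equiv (e := equivFin)).comp ho)
  refine (ite (Primrec.eq.comp hn (const 0)) (option_some.comp (nat_add_comp ha hb)) <|
    ite (Primrec.eq.comp hn (const 1))
      (option_some.comp (nat_add_comp ha (nat_mul_comp (nat_sub.comp hp (const 1)) hb))) <|
    ite (Primrec.eq.comp hn (const 2)) (option_some.comp (nat_mul_comp ha hb)) <|
    ite (Primrec.eq.comp (nat_mod.comp hb hp) (const 0)) (const none)
      (option_some.comp (nat_mul_comp ha (nat_pow_comp hb (nat_sub.comp hp (const 2)))))).of_eq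
    fun x => ?_
  cases o x <;> rfl

theorem Operand.primrec_natValue {e : α → ℕ → ℕ → ℕ} {mem : α → List ℕ} {o : α → Operand}
    (he : Primrec fun q : α × ℕ × ℕ => e q.1 q.2.1 q.2.2) (hm : Primrec mem) (ho : Primrec o) :
    Primrec fun x => (o x).natValue (e x) (mem x) := by
  have hs : Primrec fun x => equivSum (o x) := (of_equiv (e := equivSum)).comp ho
  refine (sumCasesOn hs (g := fun x q => some (e x q.1 q.2))
    (h := fun x q => Sum.casesOn q (fun c => some c) fun k => (mem x)[k]?)
    (option_some.comp he).to₂ ?_).of_eq fun x => ?_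
  · exact (sumCasesOn snd (option_some.comp snd).to₂
      (list_getElem?.comp (hm.comp (fst.comp fst)) snd).to₂).to₂
  · cases o x <;> rfl

theorem ArithStep.primrec_natRun {p : α → ℕ} {e : α → ℕ → ℕ → ℕ} {s : α → ArithStep}
    {mem : α → List ℕ} (hp : Primrec p)
    (he : Primrec fun q : α × ℕ × ℕ => e q.1 q.2.1 q.2.2) (hs : Primrec s) (hm : Primrec mem) :
    Primrec fun x => (s x).natRun (p x) (e x) (mem x) := by
  have hs' : Primrec fun x => equivProd (s x) := (of_equiv (e := equivProd)).comp hs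
  have hop : Primrec fun x => (s x).op := fst.comp hs'
  have hl : Primrec fun x => (s x).left := fst.comp (snd.comp hs')
  have hr : Primrec fun x => (s x).right := snd.comp (snd.comp hs')
  have h₃ : Primrec₂ fun (x : (α × ℕ) × ℕ) (c : ℕ) => mem x.1.1 ++ [c] :=
    (list_concat.comp (hm.comp (fst.comp (fst.comp fst))) snd).to₂
  have h₂ : Primrec₂ fun (x : α × ℕ) (b : ℕ) =>
      ((s x.1).op.natApply (p x.1) x.2 b).map fun c => mem x.1 ++ [c] :=
    (option_map (ArithOp.primrec_natApply (hp.comp (fst.comp fst)) (hop.comp (fst.comp fst))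
      (snd.comp fst) snd) h₃).to₂
  have h₁ : Primrec₂ fun (x : α) (a : ℕ) => ((s x).right.natValue (e x) (mem x)).bind fun b =>
      ((s x).op.natApply (p x) a b).map fun c => mem x ++ [c] :=
    (option_bind ((Operand.primrec_natValue he hm hr).comp fst) h₂).to₂
  exact option_bind (Operand.primrec_natValue he hm hl) h₁

theorem ArithProgram.primrec_natEval {p : α → ℕ} {e : α → ℕ → ℕ → ℕ} {P : α → ArithProgram}
    (hp : Primrec p) (he : Primrec fun q : α × ℕ × ℕ => e q.1 q.2.1 q.2.2) (hP : Primrec P) :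
    Primrec fun x => (P x).natEval (p x) (e x) := by
  have hP' : Primrec fun x => equivProd (P x) := (of_equiv (e := equivProd)).comp hP
  have hs : Primrec fun x => (P x).steps := fst.comp hP'
  have ho : Primrec fun x => (P x).output := snd.comp hP'
  have h₃ : Primrec₂ fun (x : α × Option (List ℕ) × ArithStep) (mem : List ℕ) =>
      x.2.2.natRun (p x.1) (e x.1) mem :=
    (ArithStep.primrec_natRun
      (e := fun y : (α × Option (List ℕ) × ArithStep) × List ℕ => e y.1.1) (hp.comp (fst.comp fst))
      (he.comp (pair (fst.comp (fst.comp fst)) snd)) (snd.comp (snd.comp fst)) snd).to₂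
  have h₂ : Primrec₂ fun (x : α) (q : Option (List ℕ) × ArithStep) =>
      q.1.bind (q.2.natRun (p x) (e x)) := (option_bind (fst.comp snd) h₃).to₂
  have h₁ : Primrec₂ fun (x : α) (mem : List ℕ) => (P x).output.natValue (e x) mem :=
    (Operand.primrec_natValue (e := fun y : α × List ℕ => e y.1)
      (he.comp (pair (fst.comp fst) snd)) snd (ho.comp fst)).to₂
  exact option_bind (list_foldl hs (const (some [])) h₂) h₁

end PrimrecEval

/-! ### A slow primitive recursive reference value for `f_N` -/

section RootCoefficient

open Primrec

/-- The `n`-th approximation at `x = B` to the root of `∑ e i j x ^ i y ^ j` modulo `p`. -/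
def approxRoot (p h d : ℕ) (e : ℕ → ℕ → ℕ) (B n : ℕ) : ℕ :=
  -- Newton iteration with the derivative frozen at the origin: the factor represents `-1 / E_y(0,
  -- 0)` modulo `p`. Nothing is reduced, so the value is that of a polynomial in `B` with natural
  -- coefficients.
  n.rec 0 fun _ y => y + (p - 1) * e 0 1 ^ (p - 2) *
    ∑ i ∈ Finset.range (h + 1), ∑ j ∈ Finset.range (d + 1), e i j * B ^ i * y ^ j

/-- A natural number that represents the `N`-th coefficient of the root of `∑ e i j x ^ i y ^ j`
modulo `p`. -/
def rootCoeff (p h d : ℕ) (e : ℕ → ℕ → ℕ) (N : ℕ) : ℕ :=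
  -- Kronecker substitution. The value at `1` bounds every coefficient, so in the base exceeding it
  -- by one the `N`-th digit is the `N`-th coefficient.
  approxRoot p h d e (approxRoot p h d e 1 (N + 1) + 1) (N + 1) /
    (approxRoot p h d e 1 (N + 1) + 1) ^ N % (approxRoot p h d e 1 (N + 1) + 1)

variable {α : Type*} [Primcodable α]

theorem primrec_approxRoot {p h d B n : α → ℕ} {e : α → ℕ → ℕ → ℕ} (hp : Primrec p)
    (hh : Primrec h) (hd : Primrec d) (hB : Primrec B) (hn : Primrec n)
    (he : Primrec fun q : α × ℕ × ℕ => e q.1 q.2.1 q.2.2) :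
    Primrec fun x => approxRoot (p x) (h x) (d x) (e x) (B x) (n x) := by
  have h₃ : Primrec₂ fun (x : (α × ℕ × ℕ) × ℕ) (j : ℕ) =>
      e x.1.1 x.2 j * B x.1.1 ^ x.2 * x.1.2.2 ^ j := by
    have h₄ : Primrec fun x : ((α × ℕ × ℕ) × ℕ) × ℕ => e x.1.1.1 x.1.2 x.2 :=
      he.comp (pair (fst.comp (fst.comp fst)) (pair (snd.comp fst) snd))
    exact (nat_mul_comp (nat_mul_comp h₄ (nat_pow_comp (hB.comp (fst.comp (fst.comp fst)))
      (snd.comp fst))) (nat_pow_comp (snd.comp (snd.comp (fst.comp fst))) snd)).to₂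
  have h₂ : Primrec₂ fun (x : α × ℕ × ℕ) (i : ℕ) =>
      ∑ j ∈ Finset.range (d x.1 + 1), e x.1 i j * B x.1 ^ i * x.2.2 ^ j :=
    (nat_sum_range_comp h₃ (succ.comp (hd.comp (fst.comp fst)))).to₂
  have h₁ : Primrec₂ fun (x : α) (q : ℕ × ℕ) => q.2 + (p x - 1) * e x 0 1 ^ (p x - 2) *
      ∑ i ∈ Finset.range (h x + 1), ∑ j ∈ Finset.range (d x + 1), e x i j * B x ^ i * q.2 ^ j := by
    have h₀ : Primrec fun x : α × ℕ × ℕ => e x.1 0 1 := he.comp (pair fst (const (0, 1)))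
    exact (nat_add_comp (snd.comp snd) (nat_mul_comp (nat_mul_comp
      (nat_sub.comp (hp.comp fst) (const 1)) (nat_pow_comp h₀
        (nat_sub.comp (hp.comp fst) (const 2)))) (nat_sum_range_comp h₂
          (succ.comp (hh.comp fst))))).to₂
  exact nat_rec' hn (const 0) h₁

theorem primrec_rootCoeff {p h d N : α → ℕ} {e : α → ℕ → ℕ → ℕ} (hp : Primrec p)
    (hh : Primrec h) (hd : Primrec d) (hN : Primrec N)
    (he : Primrec fun q : α × ℕ × ℕ => e q.1 q.2.1 q.2.2) :
    Primrec fun x => rootCoeff (p x) (h x) (d x) (e x) (N x) := by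
  have hB := succ.comp (primrec_approxRoot hp hh hd (const 1) (succ.comp hN) he)
  exact nat_mod.comp (nat_div.comp (primrec_approxRoot hp hh hd hB (succ.comp hN) he)
    (nat_pow_comp hB hN)) hB

end RootCoefficient

/-! ### Decidable specification and search for the program -/

section Specification

open Primrec

/-- The arrays of residues modulo `p` with support in `{0, …, h} × {0, …, d}`, numbered by the
natural numbers below `p ^ ((h + 1) * (d + 1))`. -/
def inputCoeff (p h d c i j : ℕ) : ℕ :=
  if i ≤ h ∧ j ≤ d then c / p ^ (i * (d + 1) + j) % p else 0

/-- The number of operations that suffices to compute the `N`-th coefficient of a root. -/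
def costBound (p h d N : ℕ) : ℕ :=
  -- The asserted bound is zero for `h = 0`, so no operation is allowed; then `E` does not involve
  -- `x` and the root is `0`. For `d = 0` nothing is admissible.
  if h * d = 0 then 0 else
    p + algorithmCost p d
      (3200 * (p * (2 * d * h + 1) ^ 2) * (Nat.log 2 (p * (2 * d * h + 1)) + 3) ^ 2)
      (2 * d * h + 1) ((h + 1) * d) (Nat.log 2 (p * (2 * d * h + 1)) + 1) (Nat.log 2 N + 1)

/-- A bounded form of the assertion that a program computes the `N`-th coefficient of a root. -/
def ComputesRootCoeff (p h d N : ℕ) (P : ArithProgram) : Prop :=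
  -- All coefficient arrays modulo `p` are tested; the first two alternatives discard those with
  -- `E(0, 0) ≠ 0` or `E_y(0, 0) = 0`.
  ∀ c < p ^ ((h + 1) * (d + 1)), inputCoeff p h d c 0 0 ≠ 0 ∨ inputCoeff p h d c 0 1 = 0 ∨
    (P.natEval p (inputCoeff p h d c)).map (· % p) =
      some (rootCoeff p h d (inputCoeff p h d c) N % p)

variable {α : Type*} [Primcodable α]

theorem primrec_inputCoeff {p h d c i j : α → ℕ} (hp : Primrec p) (hh : Primrec h)
    (hd : Primrec d) (hc : Primrec c) (hi : Primrec i) (hj : Primrec j) :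
    Primrec fun x => inputCoeff (p x) (h x) (d x) (c x) (i x) (j x) :=
  ite ((nat_le.comp hi hh).and (nat_le.comp hj hd))
    (nat_mod.comp (nat_div.comp hc (nat_pow_comp hp
      (nat_add_comp (nat_mul_comp hi (succ.comp hd)) hj))) hp) (const 0)

theorem primrec_costBound {p h d N : α → ℕ} (hp : Primrec p) (hh : Primrec h) (hd : Primrec d)
    (hN : Primrec N) : Primrec fun x => costBound (p x) (h x) (d x) (N x) := by
  refine ite (Primrec.eq.comp (nat_mul_comp hh hd) (const 0)) (const 0) ?_
  unfold algorithmCost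
  repeat' first
    | assumption
    | exact const _
    | apply nat_add_comp
    | apply nat_mul_comp
    | apply nat_pow_comp
    | apply nat_log_two_comp

theorem primrecPred_computesRootCoeff {p h d N : α → ℕ} {P : α → ArithProgram} (hp : Primrec p)
    (hh : Primrec h) (hd : Primrec d) (hN : Primrec N) (hP : Primrec P) :
    PrimrecPred fun x => ComputesRootCoeff (p x) (h x) (d x) (N x) (P x) := by
  refine PrimrecRel.forall_lt_comp ?_
    (nat_pow_comp hp (nat_mul_comp (succ.comp hh) (succ.comp hd)))
  have hinput : ∀ {β : Type _} [Primcodable β] {i j : β → ℕ} {q : β → ℕ × α}, Primrec q →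
      Primrec i → Primrec j →
      Primrec fun x : β => inputCoeff (p (q x).2) (h (q x).2) (d (q x).2) (q x).1 (i x) (j x) :=
    fun hq hi hj => primrec_inputCoeff (hp.comp (snd.comp hq)) (hh.comp (snd.comp hq))
      (hd.comp (snd.comp hq)) (fst.comp hq) hi hj
  have he : Primrec fun q : (ℕ × α) × ℕ × ℕ =>
      inputCoeff (p q.1.2) (h q.1.2) (d q.1.2) q.1.1 q.2.1 q.2.2 :=
    hinput fst (fst.comp snd) (snd.comp snd)
  refine ((Primrec.eq.comp (he.comp (pair .id (const (0, 0)))) (const 0)).not.or <|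
    (Primrec.eq.comp (he.comp (pair .id (const (0, 1)))) (const 0)).or <|
    Primrec.eq.comp (option_map (ArithProgram.primrec_natEval (hp.comp snd) he (hP.comp snd))
      (nat_mod.comp snd (hp.comp (snd.comp fst))).to₂)
      (option_some.comp (nat_mod.comp (primrec_rootCoeff (hp.comp snd) (hh.comp snd) (hd.comp snd)
        (hN.comp snd) he) (hp.comp snd))))

theorem ArithProgram.primrec_cost : Primrec ArithProgram.cost :=
  list_length.comp (fst.comp (of_equiv (e := equivProd)))

/-- Programs of bounded cost that are correct can be found if they exist. -/
theorem exists_computable_program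
    (h : ∀ p h d N, p.Prime → 1 ≤ N →
      ∃ P : ArithProgram, P.cost ≤ costBound p h d N ∧ ComputesRootCoeff p h d N P) :
    ∃ A : ℕ × ℕ × ℕ × ℕ → ArithProgram, Computable A ∧ ∀ p h d N, p.Prime → 1 ≤ N →
      (A (p, h, d, N)).cost ≤ costBound p h d N ∧ ComputesRootCoeff p h d N (A (p, h, d, N)) := by
  have hp : Primrec fun x : (ℕ × ℕ × ℕ × ℕ) × ArithProgram => x.1.1 := fst.comp fst
  have hh : Primrec fun x : (ℕ × ℕ × ℕ × ℕ) × ArithProgram => x.1.2.1 :=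
    fst.comp (snd.comp fst)
  have hd : Primrec fun x : (ℕ × ℕ × ℕ × ℕ) × ArithProgram => x.1.2.2.1 :=
    fst.comp (snd.comp (snd.comp fst))
  have hN : Primrec fun x : (ℕ × ℕ × ℕ × ℕ) × ArithProgram => x.1.2.2.2 :=
    snd.comp (snd.comp (snd.comp fst))
  -- Outside the range of the theorem every program is accepted, so that the search always
  -- terminates.
  have hR : PrimrecRel fun (x : ℕ × ℕ × ℕ × ℕ) (P : ArithProgram) =>
      ¬ (x.1.Prime ∧ 1 ≤ x.2.2.2) ∨ P.cost ≤ costBound x.1 x.2.1 x.2.2.1 x.2.2.2 ∧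
        ComputesRootCoeff x.1 x.2.1 x.2.2.1 x.2.2.2 P :=
    ((PrimrecPred.natPrime hp).and (nat_le.comp (const 1) hN)).not.or
      ((nat_le.comp (ArithProgram.primrec_cost.comp snd) (primrec_costBound hp hh hd hN)).and
        (primrecPred_computesRootCoeff hp hh hd hN snd))
  obtain ⟨A, hA, hAR⟩ := exists_computable_of_primrecRel hR fun x => by
    by_cases hx : x.1.Prime ∧ 1 ≤ x.2.2.2
    · obtain ⟨P, hP⟩ := h x.1 x.2.1 x.2.2.1 x.2.2.2 hx.1 hx.2
      exact ⟨P, .inr hP⟩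
    · exact ⟨⟨[], .const 0⟩, .inl hx⟩
  exact ⟨A, hA, fun p h d N hp hN => (hAR (p, h, d, N)).resolve_left (not_not.2 ⟨hp, hN⟩)⟩

end Specification

/-! ### Correctness of the reference value -/

section RootCoefficientSpec

open PowerSeries

theorem Polynomial.eval_div_pow_mod {B : ℕ} : ∀ (N : ℕ) (F : Polynomial ℕ),
    (∀ i, F.coeff i < B) → F.eval B / B ^ N % B = F.coeff N := by
  have hF : ∀ F : Polynomial ℕ, F.eval B = F.coeff 0 + B * F.divX.eval B := fun F => by
    conv_lhs => rw [← F.divX_mul_X_add]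
    simp only [Polynomial.eval_add, Polynomial.eval_mul, Polynomial.eval_X, Polynomial.eval_C]
    ring
  intro N
  induction N with
  | zero =>
    intro F h
    rw [pow_zero, Nat.div_one, hF, Nat.add_mul_mod_self_left, Nat.mod_eq_of_lt (h 0)]
  | succ N ih =>
    intro F h
    have hB : 0 < B := (Nat.zero_le _).trans_lt (h 0)
    rw [pow_succ', ← Nat.div_div_eq_div_mul, hF, Nat.add_mul_div_left _ _ hB,
      Nat.div_eq_of_lt (h 0), zero_add, ih _ fun i => by rw [Polynomial.coeff_divX]; exact h _,
      Polynomial.coeff_divX]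

theorem Polynomial.coeff_le_eval_one (F : Polynomial ℕ) (i : ℕ) : F.coeff i ≤ F.eval 1 := by
  rw [Polynomial.eval_eq_sum_range]
  simp only [one_pow, mul_one]
  rcases le_or_gt i F.natDegree with hi | hi
  · exact Finset.single_le_sum (f := fun i => F.coeff i) (fun _ _ => Nat.zero_le _)
      (Finset.mem_range.2 (by omega))
  · rw [Polynomial.coeff_eq_zero_of_natDegree_lt hi]; exact Nat.zero_le _

/-- The polynomial in `x` behind `approxRoot`. -/
noncomputable def approxRootPolynomial (p h d : ℕ) (e : ℕ → ℕ → ℕ) : ℕ → Polynomial ℕ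
  | 0 => 0
  | n + 1 => approxRootPolynomial p h d e n + Polynomial.C ((p - 1) * e 0 1 ^ (p - 2)) *
      ∑ i ∈ Finset.range (h + 1), ∑ j ∈ Finset.range (d + 1),
        Polynomial.C (e i j) * Polynomial.X ^ i * approxRootPolynomial p h d e n ^ j

theorem eval_approxRootPolynomial (p h d : ℕ) (e : ℕ → ℕ → ℕ) (B n : ℕ) :
    (approxRootPolynomial p h d e n).eval B = approxRoot p h d e B n := by
  induction n with
  | zero => simp [approxRootPolynomial, approxRoot]
  | succ n ih =>
    simp only [approxRootPolynomial, Polynomial.eval_add, Polynomial.eval_mul, Polynomial.eval_C,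
      Polynomial.eval_finsetSum, Polynomial.eval_pow, Polynomial.eval_X, ih]
    rfl

theorem rootCoeff_eq (p h d : ℕ) (e : ℕ → ℕ → ℕ) (N : ℕ) :
    rootCoeff p h d e N = (approxRootPolynomial p h d e (N + 1)).coeff N := by
  rw [rootCoeff, ← eval_approxRootPolynomial, ← eval_approxRootPolynomial]
  exact Polynomial.eval_div_pow_mod N _ fun i =>
    Nat.lt_succ_of_le (Polynomial.coeff_le_eval_one _ i)

theorem Polynomial.eval₂_eq_sum_sum {F : Type*} [Field F] {h d : ℕ}
    {E : Polynomial (Polynomial F)} (hd : E.natDegree ≤ d) (hh : ∀ j, (E.coeff j).natDegree ≤ h)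
    (y : F⟦X⟧) : E.eval₂ coeToPowerSeries.ringHom y =
      ∑ i ∈ Finset.range (h + 1), ∑ j ∈ Finset.range (d + 1),
        PowerSeries.C ((E.coeff j).coeff i) * PowerSeries.X ^ i * y ^ j := by
  rw [Polynomial.eval₂_eq_sum_range' _ (Nat.lt_succ_of_le hd), Finset.sum_comm]
  refine Finset.sum_congr rfl fun j _ => ?_
  rw [← Finset.sum_mul]
  conv_lhs => rw [(E.coeff j).as_sum_range_C_mul_X_pow' (Nat.lt_succ_of_le (hh j))]
  simp [map_sum]

variable {p : ℕ} [Fact p.Prime]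

/-- The root of a polynomial with simple root is the limit of `approxRootPolynomial`. -/
theorem X_pow_dvd_approxRootPolynomial_sub {h d : ℕ} {E : Polynomial (Polynomial (ZMod p))}
    (hE : IsAdmissible h d E) {e : ℕ → ℕ → ℕ} (he : ∀ i j, (E.coeff j).coeff i = e i j)
    {f : (ZMod p)⟦X⟧} (hf : IsRootAtOrigin E f) (n : ℕ) :
    (X : (ZMod p)⟦X⟧) ^ (n + 1) ∣
      (((approxRootPolynomial p h d e n).map (Nat.castRingHom (ZMod p)) :
        Polynomial (ZMod p)) : (ZMod p)⟦X⟧) - f := by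
  have hp := (Fact.out : p.Prime)
  induction n with
  | zero =>
    rw [zero_add, pow_one, X_dvd_iff, map_sub, hf.2]
    simp [approxRootPolynomial]
  | succ n ih =>
    set g : (ZMod p)⟦X⟧ := (((approxRootPolynomial p h d e n).map (Nat.castRingHom (ZMod p)) :
        Polynomial (ZMod p)) : (ZMod p)⟦X⟧) with hg
    set w : ZMod p := (((p - 1) * e 0 1 ^ (p - 2) : ℕ) : ZMod p) with hw
    have hstep : (((approxRootPolynomial p h d e (n + 1)).map (Nat.castRingHom (ZMod p)) :
        Polynomial (ZMod p)) : (ZMod p)⟦X⟧) =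
        g + C w * E.eval₂ Polynomial.coeToPowerSeries.ringHom g := by
      rw [Polynomial.eval₂_eq_sum_sum hE.natDegree_le hE.natDegree_coeff_le]
      simp only [he]
      let φ : Polynomial ℕ →+* (ZMod p)⟦X⟧ :=
        Polynomial.coeToPowerSeries.ringHom.comp (Polynomial.mapRingHom (Nat.castRingHom (ZMod p)))
      have hC : ∀ a : ℕ, φ (Polynomial.C a) = C (a : ZMod p) := fun a => by simp [φ]
      have hX : φ Polynomial.X = X := by simp [φ]
      change φ (approxRootPolynomial p h d e (n + 1)) = φ (approxRootPolynomial p h d e n) +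
        C w * ∑ i ∈ Finset.range (h + 1), ∑ j ∈ Finset.range (d + 1),
          C (e i j : ZMod p) * X ^ i * φ (approxRootPolynomial p h d e n) ^ j
      rw [approxRootPolynomial, map_add, map_mul, hC]
      simp only [map_sum, map_mul φ, map_pow φ, hC, hX, hw]
    have hwe : 1 + w * (E.coeff 1).coeff 0 = 0 := by
      have h1 : (e 0 1 : ZMod p) ≠ 0 := by rw [← he]; exact hE.coeff_one_ne_zero
      rw [hw, he, Nat.cast_mul, Nat.cast_pow, Nat.cast_pred hp.pos, CharP.cast_eq_zero, mul_assoc,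
        ← pow_succ, show p - 2 + 1 = p - 1 by have := hp.two_le; omega,
        ZMod.pow_card_sub_one_eq_one h1]
      ring
    obtain ⟨k, hk⟩ := Polynomial.binomExpansion (E.map Polynomial.coeToPowerSeries.ringHom) f (g - f)
    rw [add_sub_cancel, Polynomial.eval_map, Polynomial.eval_map, hf.1, zero_add] at hk
    have hgf : constantCoeff (g - f) = 0 := X_dvd_iff.1 ((dvd_pow_self X n.succ_ne_zero).trans ih)
    rw [hstep, hk, pow_succ]
    set D := Polynomial.eval f (Polynomial.derivative (E.map Polynomial.coeToPowerSeries.ringHom))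
      with hDdef
    have hD : constantCoeff D = (E.coeff 1).coeff 0 := by
      obtain ⟨r, hr⟩ := Polynomial.sub_dvd_eval_sub f 0
        (Polynomial.derivative (E.map Polynomial.coeToPowerSeries.ringHom))
      have := congrArg constantCoeff hr
      rw [map_sub, map_mul, sub_zero, hf.2, zero_mul, sub_eq_zero,
        ← Polynomial.coeff_zero_eq_eval_zero, Polynomial.coeff_derivative,
        Polynomial.coeff_map] at this
      rw [hDdef, this]
      simp
    -- One step multiplies the error `g - f` by a series with constant term `1 + w * E_y(0, 0) = 0`,
    -- so it gains one coefficient.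
    have : g + C w * (D * (g - f) + k * (g - f) ^ 2) - f =
        (g - f) * (1 + C w * D + C w * k * (g - f)) := by ring
    rw [this]
    refine mul_dvd_mul ih (X_dvd_iff.2 ?_)
    rw [map_add, map_add, map_mul, map_mul _ _ (g - f), hgf, hD, map_one, constantCoeff_C, hwe]
    ring

theorem natCast_rootCoeff {h d : ℕ} {E : Polynomial (Polynomial (ZMod p))}
    (hE : IsAdmissible h d E) {e : ℕ → ℕ → ℕ} (he : ∀ i j, (E.coeff j).coeff i = e i j)
    {f : (ZMod p)⟦X⟧} (hf : IsRootAtOrigin E f) (N : ℕ) :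
    (rootCoeff p h d e N : ZMod p) = coeff N f := by
  have h := X_pow_dvd_iff.1 (X_pow_dvd_approxRootPolynomial_sub hE he hf (N + 1)) N (by omega)
  rw [map_sub, sub_eq_zero, Polynomial.coeff_coe, Polynomial.coeff_map] at h
  rw [rootCoeff_eq, ← h]
  rfl

end RootCoefficientSpec

/-! ### The tested condition is equivalent to correctness -/

section Correctness

open PowerSeries

theorem exists_digits {p : ℕ} (n : ℕ) : ∀ g : ℕ → ℕ, (∀ k, g k < p) →
    ∃ c < p ^ n, ∀ k < n, c / p ^ k % p = g k := by
  induction n with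
  | zero => exact fun g _ => ⟨0, by simp, by simp⟩
  | succ n ih =>
    intro g hg
    obtain ⟨c, hc, hcg⟩ := ih (fun k => g (k + 1)) fun k => hg _
    have hp : 0 < p := (Nat.zero_le _).trans_lt (hg 0)
    refine ⟨g 0 + p * c, ?_, fun k hk => ?_⟩
    · calc g 0 + p * c < p + p * c := by have := hg 0; omega
        _ = p * (c + 1) := by ring
        _ ≤ p ^ (n + 1) := by rw [pow_succ']; exact Nat.mul_le_mul_left _ hc
    · cases k with
      | zero => rw [pow_zero, Nat.div_one, Nat.add_mul_mod_self_left, Nat.mod_eq_of_lt (hg 0)]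
      | succ k =>
        rw [pow_succ', ← Nat.div_div_eq_div_mul, Nat.add_mul_div_left _ _ hp,
          Nat.div_eq_of_lt (hg 0), zero_add, hcg k (by omega)]

variable {p : ℕ} [Fact p.Prime]

theorem exists_inputCoeff_eq {h d : ℕ} {E : Polynomial (Polynomial (ZMod p))}
    (hd : E.natDegree ≤ d) (hh : ∀ j, (E.coeff j).natDegree ≤ h) :
    ∃ c < p ^ ((h + 1) * (d + 1)), ∀ i j,
      (E.coeff j).coeff i = (inputCoeff p h d c i j : ZMod p) := by
  obtain ⟨c, hc, hcg⟩ := exists_digits ((h + 1) * (d + 1))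
    (fun k => ((E.coeff (k % (d + 1))).coeff (k / (d + 1))).val) fun k => ZMod.val_lt _
  refine ⟨c, hc, fun i j => ?_⟩
  rw [inputCoeff]
  split_ifs with hij
  · rw [hcg _ (by nlinarith [hij.1, hij.2]), add_comm, Nat.add_mul_mod_self_right,
      Nat.mod_eq_of_lt (by omega), Nat.add_mul_div_right _ _ d.succ_pos,
      Nat.div_eq_of_lt (by omega), zero_add, ZMod.natCast_zmod_val]
  · rw [Nat.cast_zero]
    rw [not_and_or, not_le, not_le] at hij
    rcases hij with hi | hj
    · exact Polynomial.coeff_eq_zero_of_natDegree_lt ((hh j).trans_lt hi)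
    · rw [Polynomial.coeff_eq_zero_of_natDegree_lt (hd.trans_lt hj), Polynomial.coeff_zero]

theorem exists_polynomial_of_inputCoeff (p h d c : ℕ) :
    ∃ E : Polynomial (Polynomial (ZMod p)), E.natDegree ≤ d ∧ (∀ j, (E.coeff j).natDegree ≤ h) ∧
      ∀ i j, (E.coeff j).coeff i = (inputCoeff p h d c i j : ZMod p) := by
  let a : ℕ → Polynomial (ZMod p) := fun j => ∑ i ∈ Finset.range (h + 1),
    Polynomial.monomial i (inputCoeff p h d c i j : ZMod p)
  have ha : ∀ j, (a j).natDegree ≤ h := fun j =>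
    Polynomial.natDegree_sum_le_of_forall_le _ _ fun i hi =>
      (Polynomial.natDegree_monomial_le _).trans (by rw [Finset.mem_range] at hi; omega)
  have hcoeff : ∀ j, (∑ j ∈ Finset.range (d + 1), Polynomial.monomial j (a j)).coeff j =
      if j ∈ Finset.range (d + 1) then a j else 0 := fun j => by
    simp only [Polynomial.finsetSum_coeff, Polynomial.coeff_monomial]
    rw [Finset.sum_ite_eq']
  refine ⟨∑ j ∈ Finset.range (d + 1), Polynomial.monomial j (a j), ?_, fun j => ?_, fun i j => ?_⟩
  · exact Polynomial.natDegree_sum_le_of_forall_le _ _ fun j hj =>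
      (Polynomial.natDegree_monomial_le _).trans (by rw [Finset.mem_range] at hj; omega)
  · rw [hcoeff]
    split_ifs
    · exact ha j
    · simp
  · rw [hcoeff]
    split_ifs with hj
    · simp only [a, Polynomial.finsetSum_coeff, Polynomial.coeff_monomial]
      rw [Finset.sum_ite_eq']
      split_ifs with hi
      · rfl
      · rw [inputCoeff, if_neg, Nat.cast_zero]
        rw [Finset.mem_range] at hi; omega
    · rw [inputCoeff, if_neg, Nat.cast_zero, Polynomial.coeff_zero]
      rw [Finset.mem_range] at hj; omega

theorem exists_isRootAtOrigin {h d : ℕ} {E : Polynomial (Polynomial (ZMod p))}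
    (hE : IsAdmissible h d E) : ∃ f, IsRootAtOrigin E f := by
  obtain ⟨P, -, hP⟩ := exists_program_coeff_root (p := p) h d 0 (k := 0) (by simp)
    (Nat.lt_two_pow_self.le : p * (2 * d * h + 1) ≤ _)
  obtain ⟨f, hf, -⟩ := hP E hE
  exact ⟨f, hf⟩

/-- Every admissible `E` has its coefficients listed by some number `c`, so passing the finite test
covers it. -/
theorem ComputesRootCoeff.eval_eq {h d N : ℕ} {P : ArithProgram}
    (hP : ComputesRootCoeff p h d N P) {E : Polynomial (Polynomial (ZMod p))}
    (hE : IsAdmissible h d E) {f : (ZMod p)⟦X⟧} (hf : IsRootAtOrigin E f) :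
    P.eval (fun i j => (E.coeff j).coeff i) = some (coeff N f) := by
  obtain ⟨c, hc, he⟩ := exists_inputCoeff_eq hE.natDegree_le hE.natDegree_coeff_le
  have hlt : ∀ i j, inputCoeff p h d c i j < p := fun i j => by
    have hp := (Fact.out : p.Prime).pos
    rw [inputCoeff]; split_ifs
    exacts [Nat.mod_lt _ hp, hp]
  have h0 : inputCoeff p h d c 0 0 = 0 := by
    have := (he 0 0).symm.trans ((evalEval_zero_zero E).symm.trans hE.evalEval_eq_zero)
    rw [ZMod.natCast_eq_zero_iff] at this
    exact Nat.eq_zero_of_dvd_of_lt this (hlt _ _)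
  have h1 : inputCoeff p h d c 0 1 ≠ 0 := fun h1 => by
    have := he 0 1
    rw [h1, Nat.cast_zero] at this
    exact hE.coeff_one_ne_zero this
  have hval := ((hP c hc).resolve_left (not_not.2 h0)).resolve_left h1
  rw [Option.map_eq_some_iff] at hval
  obtain ⟨v, hv, hvp⟩ := hval
  rw [← natCast_rootCoeff hE he hf, ← (ZMod.natCast_eq_natCast_iff' _ _ _).2 hvp]
  simp only [he, ArithProgram.eval_natCast, hv, Option.map_some]

/-- Every array that is not discarded comes from an admissible polynomial, so a correct program
passes the test and can be found. -/
theorem computesRootCoeff_of_eval_eq {h d N : ℕ} {P : ArithProgram}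
    (hP : ∀ E : Polynomial (Polynomial (ZMod p)), IsAdmissible h d E →
      ∀ f : (ZMod p)⟦X⟧, IsRootAtOrigin E f →
        P.eval (fun i j => (E.coeff j).coeff i) = some (coeff N f)) :
    ComputesRootCoeff p h d N P := by
  intro c _
  by_contra! hcon
  obtain ⟨h0, h1, hne⟩ := hcon
  obtain ⟨E, hd, hh, he⟩ := exists_polynomial_of_inputCoeff p h d c
  have hlt : ∀ i j, inputCoeff p h d c i j < p := fun i j => by
    have hp := (Fact.out : p.Prime).pos
    rw [inputCoeff]; split_ifs
    exacts [Nat.mod_lt _ hp, hp]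
  have hE : IsAdmissible h d E := by
    refine ⟨hd, hh, ?_, ?_⟩
    · rw [evalEval_zero_zero, he, h0, Nat.cast_zero]
    · rw [evalEval_zero_zero, Polynomial.coeff_derivative]
      simp only [zero_add, Nat.cast_zero, mul_one, he]
      rw [Ne, ZMod.natCast_eq_zero_iff]
      exact fun hdvd => h1 (Nat.eq_zero_of_dvd_of_lt hdvd (hlt _ _))
  obtain ⟨f, hf⟩ := exists_isRootAtOrigin hE
  have hv := hP E hE f hf
  simp only [he, ArithProgram.eval_natCast, Option.map_eq_some_iff] at hv
  obtain ⟨v, hv, hvf⟩ := hv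
  refine hne ?_
  rw [hv, Option.map_some, Option.some_inj]
  rw [← natCast_rootCoeff hE he hf] at hvf
  exact (ZMod.natCast_eq_natCast_iff' _ _ _).1 hvf

theorem exists_program_le_costBound (h d N : ℕ) :
    ∃ P : ArithProgram, P.cost ≤ costBound p h d N ∧ ComputesRootCoeff p h d N P := by
  have hp := (Fact.out : p.Prime)
  rw [costBound]
  split_ifs with h0
  · refine ⟨⟨[], .const 0⟩, le_rfl, computesRootCoeff_of_eval_eq fun E hE f hf => ?_⟩
    have hf0 : f = 0 := by
      rcases Nat.mul_eq_zero.1 h0 with rfl | rfl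
      · refine (IsRootAtOrigin.unique hE hf ?_).symm
        have h00 : E.coeff 0 = 0 := by
          rw [Polynomial.eq_C_of_natDegree_le_zero (hE.natDegree_coeff_le 0),
            ← evalEval_zero_zero, hE.evalEval_eq_zero, Polynomial.C_0]
        refine ⟨?_, map_zero _⟩
        rw [Polynomial.eval₂_at_zero, h00, map_zero]
      · exact absurd (by rw [Polynomial.coeff_eq_zero_of_natDegree_lt
          (hE.natDegree_le.trans_lt one_pos), Polynomial.coeff_zero]) hE.coeff_one_ne_zero
    rw [hf0, map_zero]
    simp [ArithProgram.eval, ArithProgram.run, Operand.value]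
  · obtain ⟨P, hPc, hP⟩ := exists_program_coeff_root (p := p) h d N (k := Nat.log 2 N + 1)
      (l := Nat.log 2 (p * (2 * d * h + 1)) + 1)
      ((Nat.lt_pow_succ_log_self one_lt_two N).trans_le (Nat.pow_le_pow_left hp.two_le _))
      (Nat.lt_pow_succ_log_self one_lt_two _).le
    refine ⟨P, hPc, computesRootCoeff_of_eval_eq fun E hE f hf => ?_⟩
    obtain ⟨g, hg, hPg⟩ := hP E hE
    rw [hPg, IsRootAtOrigin.unique hE hf hg]

end Correctness

/-! ### Estimating the cost -/

section Estimate

/-- Everything is measured by `u = d * h`, with `T ≤ 3 * u` and `D ≤ 2 * u`. The digit steps cost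
`O(u ^ 2)` each, and all else is `O(u ^ 3 * p * M ^ 3)`. Then `u ^ 2 ≤ h ^ 2 * (d + h) ^ 2` and `u ^
3 = h * (d ^ 3 * h ^ 2) ≤ h * (d + h) ^ 5`. -/
theorem costBound_le {p h d N : ℕ} (hp : 1 ≤ p) :
    costBound p h d N ≤ 8 * (h ^ 2 * (d + h) ^ 2 * Nat.log 2 N) +
      5069096 * ((h * (d + h) ^ 5 * p) * Nat.log 2 (2 + h * (d + h) ^ 5 * p) ^ 3) := by
  rw [costBound]
  split_ifs with h0
  · exact Nat.zero_le _
  obtain ⟨hh, hd⟩ : 1 ≤ h ∧ 1 ≤ d := by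
    rw [Nat.mul_eq_zero, not_or] at h0; omega
  set G := h * (d + h) ^ 5 * p with hG
  set M := Nat.log 2 (2 + G) with hM
  obtain ⟨u, hu⟩ : ∃ u, u = d * h := ⟨_, rfl⟩
  have hu1 : 1 ≤ u := hu ▸ Nat.mul_pos hd hh
  have hdu : d ≤ u := hu ▸ Nat.le_mul_of_pos_right d hh
  have hhu : h ≤ u := hu ▸ Nat.le_mul_of_pos_left h hd
  obtain ⟨T, hT⟩ : ∃ T, T = 2 * d * h + 1 := ⟨_, rfl⟩
  have hTu : T ≤ 3 * u := by rw [hT, mul_assoc, ← hu]; omega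
  obtain ⟨D, hD⟩ : ∃ D, D = (h + 1) * d := ⟨_, rfl⟩
  have hDu : D ≤ 2 * u := by rw [hD, add_mul, one_mul, mul_comm h d, ← hu]; omega
  have hu2 : u ^ 2 ≤ h ^ 2 * (d + h) ^ 2 := by
    rw [hu, mul_pow, mul_comm]; gcongr; omega
  have hu3 : u ^ 3 * p ≤ G := by
    have : u ^ 3 = h * (d ^ 3 * h ^ 2) := by rw [hu]; ring
    rw [hG, this]
    gcongr
    calc d ^ 3 * h ^ 2 ≤ (d + h) ^ 3 * (d + h) ^ 2 := by gcongr <;> omega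
      _ = (d + h) ^ 5 := by ring
  have hTG : p * T ≤ 2 + G :=
    calc p * T ≤ p * (3 * u) := Nat.mul_le_mul_left _ hTu
      _ = h * (3 * d) * p := by rw [hu]; ring
      _ ≤ h * (2 ^ 4 * (d + h)) * p := by gcongr <;> omega
      _ ≤ h * ((d + h) ^ 4 * (d + h)) * p := by gcongr; omega
      _ = G := by rw [hG]; ring
      _ ≤ 2 + G := Nat.le_add_left _ _
  have hlog : Nat.log 2 (p * T) ≤ M := Nat.log_mono_right hTG
  have hM1 : 1 ≤ M := Nat.le_log_of_pow_le one_lt_two (by omega)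
  rw [← hT, ← hD]
  set L := Nat.log 2 N
  have hQ : u ^ 3 * p * M ^ 3 ≤ G * M ^ 3 := Nat.mul_le_mul_right _ hu3
  have hc : 3200 * (p * T ^ 2) * (Nat.log 2 (p * T) + 3) ^ 2 ≤ 460800 * (u ^ 2 * p * M ^ 2) :=
    calc _ ≤ 3200 * (p * (3 * u) ^ 2) * (4 * M) ^ 2 := by gcongr; omega
      _ = _ := by ring
  generalize 3200 * (p * T ^ 2) * (Nat.log 2 (p * T) + 3) ^ 2 = c at hc ⊢
  have hmono : ∀ i j : ℕ, i ≤ 3 → j ≤ 3 → u ^ i * p * M ^ j ≤ G * M ^ 3 := by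
    intro i j hi hj
    refine le_trans ?_ hQ
    gcongr
  have hpT : p * T ≤ 9 * (u ^ 2 * p * M ^ 2) :=
    calc p * T ≤ p * (3 * u) := Nat.mul_le_mul_left _ hTu
      _ = 3 * (u ^ 1 * p * 1) := by ring
      _ ≤ 9 * (u ^ 2 * p * M ^ 2) := by
        gcongr
        · omega
        · omega
        · exact Nat.one_le_pow _ _ hM1
  have h1 : (Nat.log 2 (p * T) + 1) * ((2 * d + 3) * (c + p * T)) ≤ 4608090 * (G * M ^ 3) :=
    calc _ ≤ (2 * M) * ((5 * u) * (460800 * (u ^ 2 * p * M ^ 2) + 9 * (u ^ 2 * p * M ^ 2))) := by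
          gcongr <;> omega
      _ = 4608090 * (u ^ 3 * p * M ^ 3) := by ring
      _ ≤ _ := Nat.mul_le_mul_left _ hQ
  have h2 : d * (p * T) ≤ 3 * (G * M ^ 3) :=
    calc _ ≤ u * (p * (3 * u)) := by gcongr
      _ = 3 * (u ^ 2 * p * M ^ 0) := by ring
      _ ≤ _ := Nat.mul_le_mul_left _ (hmono 2 0 (by omega) (by omega))
  have h3 : d * c ≤ 460800 * (G * M ^ 3) :=
    calc _ ≤ u * (460800 * (u ^ 2 * p * M ^ 2)) := by gcongr
      _ = 460800 * (u ^ 3 * p * M ^ 2) := by ring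
      _ ≤ _ := Nat.mul_le_mul_left _ (hmono 3 2 (by omega) (by omega))
  have h4 : D * (T * (2 * p + 5 + 10 * D)) ≤ 162 * (G * M ^ 3) :=
    calc _ ≤ (2 * u) * ((3 * u) * (27 * (p * u))) := by
          gcongr
          calc 2 * p + 5 + 10 * D ≤ 2 * (p * 1) + 5 * (1 * 1) + 10 * (1 * (2 * u)) := by omega
            _ ≤ 2 * (p * u) + 5 * (p * u) + 10 * (p * (2 * u)) := by gcongr
            _ = 27 * (p * u) := by ring
      _ = 162 * (u ^ 3 * p * M ^ 0) := by ring
      _ ≤ _ := Nat.mul_le_mul_left _ (hmono 3 0 (by omega) (by omega))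
  have h5 : p * (D * D * (T * 2)) ≤ 24 * (G * M ^ 3) :=
    calc _ ≤ p * (2 * u * (2 * u) * (3 * u * 2)) := by gcongr
      _ = 24 * (u ^ 3 * p * M ^ 0) := by ring
      _ ≤ _ := Nat.mul_le_mul_left _ (hmono 3 0 (by omega) (by omega))
  have h6 : (L + 1) * (D * (D * 2)) ≤ 8 * (h ^ 2 * (d + h) ^ 2 * L) + 8 * (G * M ^ 3) :=
    calc _ ≤ (L + 1) * (2 * u * (2 * u * 2)) := by gcongr
      _ = 8 * (u ^ 2 * L) + 8 * (u ^ 2 * 1 * M ^ 0) := by ring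
      _ ≤ 8 * (h ^ 2 * (d + h) ^ 2 * L) + 8 * (u ^ 2 * p * M ^ 0) := by gcongr
      _ ≤ _ := Nat.add_le_add_left
        (Nat.mul_le_mul_left _ (hmono 2 0 (by omega) (by omega))) _
  have h7 : D * 4 ≤ 8 * (G * M ^ 3) :=
    calc _ ≤ 2 * u * 4 := by gcongr
      _ = 8 * (u ^ 1 * 1 * M ^ 0) := by ring
      _ ≤ 8 * (u ^ 1 * p * M ^ 0) := by gcongr
      _ ≤ _ := Nat.mul_le_mul_left _ (hmono 1 0 (by omega) (by omega))
  have h8 : p ≤ G * M ^ 3 := by simpa using hmono 0 0 (by omega) (by omega)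
  -- The constant `5069096` is the sum of those in `h1` to `h8`.
  rw [algorithmCost]
  omega

end Estimate

/-! ### The main theorem -/

theorem natLog_two_le (n : ℕ) : (Nat.log 2 n : ℝ) ≤ 2 * Real.log n := by
  rcases Nat.eq_zero_or_pos n with rfl | hn
  · simp
  have h1 : (Nat.log 2 n : ℝ) * Real.log 2 ≤ Real.log n := by
    rw [← Real.log_pow]
    exact Real.log_le_log (by positivity) (by exact_mod_cast Nat.pow_log_le_self 2 hn.ne')
  have h2 := Real.log_two_gt_d9
  have h3 : (0 : ℝ) ≤ Nat.log 2 n := Nat.cast_nonneg _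
  nlinarith

theorem theorem4 :
    ∃ A : ℕ × ℕ × ℕ × ℕ → ArithProgram, Computable A ∧
      ∃ (C : ℝ) (k : ℕ), ∀ (p : ℕ) [Fact p.Prime] (h d N : ℕ), 1 ≤ N →
        ((A (p, h, d, N)).cost : ℝ) ≤
            C * ((h : ℝ) ^ 2 * ((d : ℝ) + h) ^ 2 * Real.log N) +
              C * (((h : ℝ) * ((d : ℝ) + h) ^ 5 * p) *
                Real.log (2 + (h : ℝ) * ((d : ℝ) + h) ^ 5 * p) ^ k) ∧
          ∀ E : Polynomial (Polynomial (ZMod p)),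
            E.natDegree ≤ d → (∀ j, (E.coeff j).natDegree ≤ h) →
            E.evalEval 0 0 = 0 → (Polynomial.derivative E).evalEval 0 0 ≠ 0 →
              ∃ f : PowerSeries (ZMod p),
                (IsRootAtOrigin E f ∧ ∀ g, IsRootAtOrigin E g → g = f) ∧
                (A (p, h, d, N)).eval (fun i j => (E.coeff j).coeff i) =
                  some (PowerSeries.coeff N f) := by
  obtain ⟨A, hA, hAs⟩ := exists_computable_program fun p h d N hp _ =>
    haveI := Fact.mk hp; exists_program_le_costBound (p := p) h d N
  -- `40552768 = 2 ^ 3 * 5069096`: passing from the binary to the natural logarithm costs a factor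
  -- of at most `2`, cubed here.
  refine ⟨A, hA, 40552768, 3, fun p hp h d N hN => ?_⟩
  obtain ⟨hcost, hcorrect⟩ := hAs p h d N hp.out hN
  refine ⟨?_, fun E h1 h2 h3 h4 => ?_⟩
  · have hlog := natLog_two_le (2 + h * (d + h) ^ 5 * p)
    have hlogN := natLog_two_le N
    have hb : ((A (p, h, d, N)).cost : ℝ) ≤ _ :=
      Nat.cast_le.2 (hcost.trans (costBound_le hp.out.one_le))
    push_cast at hb hlog
    have hlogN0 : 0 ≤ Real.log N := Real.log_natCast_nonneg N
    refine hb.trans (add_le_add ?_ ?_)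
    · calc _ ≤ 8 * ((h : ℝ) ^ 2 * ((d : ℝ) + h) ^ 2 * (2 * Real.log N)) := by gcongr
        _ = 16 * ((h : ℝ) ^ 2 * ((d : ℝ) + h) ^ 2 * Real.log N) := by ring
        _ ≤ _ := mul_le_mul_of_nonneg_right (by norm_num) (by positivity)
    · calc _ ≤ 5069096 * (((h : ℝ) * ((d : ℝ) + h) ^ 5 * p) *
            (2 * Real.log (2 + (h : ℝ) * ((d : ℝ) + h) ^ 5 * p)) ^ 3) := by gcongr
        _ = _ := by ring
  · have hE : IsAdmissible h d E := ⟨h1, h2, h3, h4⟩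
    obtain ⟨f, hf⟩ := exists_isRootAtOrigin hE
    exact ⟨f, ⟨hf, fun g hg => IsRootAtOrigin.unique hE hf hg⟩, hcorrect.eval_eq hE hf⟩
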